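/- Let $n\ge 1$ and let $F$ be a compact smooth manifold of dimension $2n$ with boundary $K=\partial F$ and interior $F^o=F\setminus K$. Say that a smooth function $u:F\to[0,+\infty)$ is boundary-defining if $u^{-1}(0)=K$ and $du\neq 0$ at every point of $K$. Let $(F,\omega)$ be an ideal Liouville domain: $\omega$ is a symplectic form on $F^o$ which admits an ideal Liouville form, that is, a smooth 1-form $\lambda$ on $F^o$ with $d\lambda=\omega$ such that for some boundary-defining function $u$ the form $u\lambda$ extends to a smooth 1-form on $F$ whose restriction to $TK$ is a contact form on $K$ (a 1-form $\alpha$ with $\alpha\wedge(d\alpha)^{n-1}$ nowhere zero). Let $\lambda$ be an ideal Liouville form for $\omega$, let $u$ be a boundary-defining function, and let $\beta$ be the smooth 1-form on $F$ that extends $u\lambda$. Put $\xi=\ker(\beta|_{TK})$, co-oriented by $\beta|_{TK}$. Then for every positive contact form $\alpha_0$ on $(K,\xi)$ (a contact form on $K$ with kernel $\xi$ that induces the given co-orientation of $\xi$) there exist a constant $R>0$ and a smooth embedding $\iota:[0,R]\times K\to F$ such that $\iota(0,q)=q$ for all $q\in K$, $\iota$ maps $(0,R]\times K$ into $F^o$,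 and $$\iota^*\lambda=\frac1r\,\alpha_0\quad\text{on }(0,R]\times K,$$ where $r$ is the coordinate on $[0,R]$ and $\alpha_0$ also denotes its pullback under the projection to $K$. In particular, $$\iota^*\beta=\frac{u\circ\iota}{r}\,\alpha_0\quad\text{on }(0,R]\times K,$$ and for all $q\in K$ $$(\beta|_{TK})(q)=\frac{\partial(u\circ\iota)}{\partial r}(0,q)\,\alpha_0(q).$$ -/

import Mathlib

open scoped Manifold ContDiff Topology

noncomputable section

namespace IdealLiouville

section Forms

variable {E : Type*} [NormedAddCommGroup E] [NormedSpace ℝ E]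
  {H : Type*} [TopologicalSpace H]
  {E' : Type*} [NormedAddCommGroup E'] [NormedSpace ℝ E']
  {H' : Type*} [TopologicalSpace H']

/-- A (not necessarily continuous) field of alternating `k`-linear forms on the tangent spaces
of `M`. Forms that live on an open subset `U` are represented by such fields, of which only the
values on `U` are ever used. -/
abbrev DiffForm (I : ModelWithCorners ℝ E H) (M : Type*) [TopologicalSpace M]
    [ChartedSpace H M] (k : ℕ) :=
  ∀ x : M, TangentSpace I x [⋀^Fin k]→L[ℝ] ℝ

variable {I : ModelWithCorners ℝ E H} {M : Type*} [TopologicalSpace M] [ChartedSpace H M]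
  {I' : ModelWithCorners ℝ E' H'} {N : Type*} [TopologicalSpace N] [ChartedSpace H' N]
  {k : ℕ}

/-- The pullback `f^* Ω`. -/
def pullback (f : M → N) (Ω : DiffForm I' N k) : DiffForm I M k :=
  fun x => (Ω (f x)).compContinuousLinearMap (mfderiv I I' f x)

/-- The expression of the form `Ω` in the chart around `x₀`: the pullback of `Ω` under the inverse
of the extended chart. -/
def localRep (Ω : DiffForm I M k) (x₀ : M) (y : E) : E [⋀^Fin k]→L[ℝ] ℝ :=
  (Ω ((extChartAt I x₀).symm y)).compContinuousLinearMap
    (mfderivWithin 𝓘(ℝ, E) I (extChartAt I x₀).symm (Set.range I) y)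

/-- `Ω` is a smooth form on the open set `U`: its expression in every chart is smooth. -/
def IsSmoothFormOn (Ω : DiffForm I M k) (U : Set M) : Prop :=
  ∀ x₀ : M, ContDiffOn ℝ ∞ (localRep Ω x₀)
    ((extChartAt I x₀).target ∩ (extChartAt I x₀).symm ⁻¹' U)

/-- The exterior derivative. At `x` it is computed in the chart around `x`, through which Mathlib
identifies the tangent space at `x` with the model space. -/
def extD (Ω : DiffForm I M k) : DiffForm I M (k + 1) :=
  fun x => (extDerivWithin (localRep Ω x) (Set.range I) (extChartAt I x x) :
    E [⋀^Fin (k + 1)]→L[ℝ] ℝ)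

/-- `Ω` is a symplectic form on the open set `U`: smooth, closed and non-degenerate. -/
structure IsSymplecticOn (Ω : DiffForm I M 2) (U : Set M) : Prop where
  smooth : IsSmoothFormOn Ω U
  closed : ∀ x ∈ U, extD Ω x = 0
  nondegenerate : ∀ x ∈ U, ∀ v : TangentSpace I x, v ≠ 0 → ∃ w, Ω x ![v, w] ≠ 0

end Forms

/-- The value at `(v 0, …, v (2 * m))` of the exterior product `α ∧ τ ∧ ⋯ ∧ τ` of a covector `α`
with `m` copies of an alternating bilinear form `τ`. -/
def wedgePow {V : Type*} [AddCommGroup V] [Module ℝ V] [TopologicalSpace V] (m : ℕ)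
    (α : V [⋀^Fin 1]→L[ℝ] ℝ) (τ : V [⋀^Fin 2]→L[ℝ] ℝ) (v : Fin (2 * m + 1) → V) : ℝ :=
  ((2 : ℝ) ^ m)⁻¹ * ∑ σ : Equiv.Perm (Fin (2 * m + 1)), ((Equiv.Perm.sign σ : ℤ) : ℝ) *
    (α ![v (σ 0)] * ∏ i : Fin m,
      τ ![v (σ ⟨2 * i + 1, by omega⟩), v (σ ⟨2 * i + 2, by omega⟩)])

variable {m : ℕ}
  {F : Type*} [TopologicalSpace F] [ChartedSpace (EuclideanHalfSpace (2 * m + 2)) F]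
  {K : Type*} [TopologicalSpace K] [ChartedSpace (EuclideanSpace ℝ (Fin (2 * m + 1))) K]

/-- A contact form on a manifold of dimension `2 * m + 1`: a smooth 1-form `α` such that
`α ∧ (dα)^m` vanishes nowhere. -/
structure IsContactForm (α : DiffForm (𝓡 (2 * m + 1)) K 1) : Prop where
  smooth : IsSmoothFormOn α Set.univ
  contact : ∀ q : K, ∃ v : Fin (2 * m + 1) → TangentSpace (𝓡 (2 * m + 1)) q,
    wedgePow m (α q) (extD α q) v ≠ 0

/-- `α` is a positive contact form on the co-oriented contact manifold `(K, ker β₀)`: a contact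
form with the same kernel as `β₀` which induces the same co-orientation of it. -/
structure IsPositiveContactFormOn (β₀ α : DiffForm (𝓡 (2 * m + 1)) K 1) : Prop where
  isContactForm : IsContactForm α
  ker_eq : ∀ (q : K) (v : TangentSpace (𝓡 (2 * m + 1)) q), α q ![v] = 0 ↔ β₀ q ![v] = 0
  pos_iff : ∀ (q : K) (v : TangentSpace (𝓡 (2 * m + 1)) q), 0 < α q ![v] ↔ 0 < β₀ q ![v]

/-- `j : K → F` exhibits the manifold `K` as the boundary of `F`. -/
structure IsBoundaryInclusion (m : ℕ) {F : Type*} [TopologicalSpace F]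
    [ChartedSpace (EuclideanHalfSpace (2 * m + 2)) F] {K : Type*} [TopologicalSpace K]
    [ChartedSpace (EuclideanSpace ℝ (Fin (2 * m + 1))) K] (j : K → F) : Prop where
  isSmoothEmbedding : Manifold.IsSmoothEmbedding (𝓡 (2 * m + 1)) (𝓡∂ (2 * m + 2)) ∞ j
  range_eq : Set.range j = (𝓡∂ (2 * m + 2)).boundary F

/-- A smooth function `u : F → [0, ∞)` whose zero set is the boundary of `F`, where it is
regular. -/
structure IsBoundaryDefining (m : ℕ) {F : Type*} [TopologicalSpace F]
    [ChartedSpace (EuclideanHalfSpace (2 * m + 2)) F] (u : F → ℝ) : Prop where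
  smooth : ContMDiff (𝓡∂ (2 * m + 2)) 𝓘(ℝ, ℝ) ∞ u
  nonneg : ∀ x, 0 ≤ u x
  eq_zero_iff : ∀ x, u x = 0 ↔ x ∈ (𝓡∂ (2 * m + 2)).boundary F
  regular : ∀ x ∈ (𝓡∂ (2 * m + 2)).boundary F, mfderiv (𝓡∂ (2 * m + 2)) 𝓘(ℝ, ℝ) u x ≠ 0

/-- `β` is a smooth 1-form on `F` which extends the form `u • lam` on the interior of `F`. -/
structure IsExtension (u : F → ℝ) (lam β : DiffForm (𝓡∂ (2 * m + 2)) F 1) : Prop where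
  smooth : IsSmoothFormOn β Set.univ
  eq_smul : ∀ x ∈ (𝓡∂ (2 * m + 2)).interior F, β x = u x • lam x

/-- `lam` is an ideal Liouville form for `Ω`: a smooth primitive of `Ω` on the interior of `F` such
that, for some boundary-defining function `u`, the form `u • lam` extends to a smooth 1-form on `F`
that induces a contact form on the boundary. -/
structure IsIdealLiouvilleForm (j : K → F) (Ω : DiffForm (𝓡∂ (2 * m + 2)) F 2)
    (lam : DiffForm (𝓡∂ (2 * m + 2)) F 1) : Prop where
  smooth : IsSmoothFormOn lam ((𝓡∂ (2 * m + 2)).interior F)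
  primitive : ∀ x ∈ (𝓡∂ (2 * m + 2)).interior F, extD lam x = Ω x
  exists_extension : ∃ (u : F → ℝ) (β : DiffForm (𝓡∂ (2 * m + 2)) F 1),
    IsBoundaryDefining m u ∧ IsExtension u lam β ∧
      IsContactForm (pullback j β : DiffForm (𝓡 (2 * m + 1)) K 1)

/-- `(F, Ω)` is an ideal Liouville domain with boundary `j : K → F`: `Ω` is a symplectic form on the
interior of `F` which admits an ideal Liouville form. -/
structure IsIdealLiouvilleDomain (j : K → F) (Ω : DiffForm (𝓡∂ (2 * m + 2)) F 2) : Prop where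
  isSymplectic : IsSymplecticOn Ω ((𝓡∂ (2 * m + 2)).interior F)
  exists_form : ∃ lam, IsIdealLiouvilleForm j Ω lam

end IdealLiouville

end

/-! In charts at a boundary point, `F` becomes a half space `t ≥ 0` and `β = u λ` a covector field
smooth up to `t = 0`, whose restriction to the slice `t = 0` is `c α₀`; here `c > 0` because the
co-orientations agree. The contact condition is used in one form throughout: the operator `(z, g) ↦
(ι_z dα - g α, α z)` is invertible (`contactOp`; the link with `α ∧ (dα)^m ≠ 0` is
`eq_zero_of_wedgePow_ne_zero`). Invertibility is open, so on nearby slices it yields a unique field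
`(1, Z)` in the kernel of `β` whose contraction with `dβ` equals `g β` on slices
(`exists_characteristic_field`). Its flow `Φ` out of the boundary scales `β` at rate `g`, so `Φ^*β =
e^η c α₀` without `dt` term, where `η` is the integral of `g` along the flow (`exists_contact_flow`,
`exists_straightened_collar`).

Dividing by `u` gives `Φ^*λ = α₀ / ρ` with `ρ = (u ∘ Φ) / (e^η c)`. As `u` vanishes on the boundary
with `du ≠ 0`, `ρ` vanishes at `t = 0` with nonzero normal derivative. In the coordinates `(r, q)`
with `r = ρ`, the map `Φ` becomes a collar `κ` with `κ^*λ = α₀ / r` (`exists_isModelSolution`).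
Moreover `u ∘ κ = r e^η c`, whose `r`-derivative at `0` is `c`: this is the last formula of the
theorem.

The local collars glue because they are unique. Near a boundary point, the transition map `(τ, θ)`
between two of them is the identity at `r = 0` and satisfies `θ^*α₀ = (τ / r) α₀`. So `∂θ/∂r` lies
in the kernel of `α₀` and its contraction with `dα₀` is a multiple of `α₀`; by the contact condition
it vanishes, hence `θ (r, q) = q` and `τ = r` (`eq_snd_of_pullback_contact`,
`IsModelSolution.eventually_eq`). Compactness of `K` then gives a collar on `[0, δ) × K`
(`exists_isCollar_univ`), which is injective on `[0, R] × K` for small `R` and an immersion of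
manifolds with boundary (and corners, in the sense of the product model).

Everything lives on `t ≥ 0`, so two analytic tools are needed up to the boundary.
`exists_smooth_flow` solves the differential equation as an integral equation in the Banach space
`C([0, δ], X)`. `exists_halfSpace_inverse` is the inverse function theorem for boundary-preserving
maps of half spaces. -/

noncomputable section

set_option linter.unusedSectionVars false

namespace IdealLiouville

open Set Filter

universe v

/-! ### Superposition operators on spaces of continuous curves. -/

section Nemytskii

variable {T : Type*} [TopologicalSpace T] [CompactSpace T] [LocallyCompactSpace T]
  {X Y : Type*} [NormedAddCommGroup X] [NormedSpace ℝ X] [NormedAddCommGroup Y] [NormedSpace ℝ Y]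

/-- The superposition operator `γ ↦ (t ↦ W (t, γ t))`. -/
def nemytskii (W : C(T × X, Y)) (γ : C(T, X)) : C(T, Y) :=
  W.comp ((ContinuousMap.id T).prodMk γ)

@[simp] lemma nemytskii_apply (W : C(T × X, Y)) (γ : C(T, X)) (t : T) :
    nemytskii W γ t = W (t, γ t) := rfl

lemma continuous_nemytskii (W : C(T × X, Y)) : Continuous (nemytskii W) := by
  refine ContinuousMap.continuous_of_continuous_uncurry _ ?_
  change Continuous fun p : C(T, X) × T => W (p.2, p.1 p.2)
  fun_prop

variable (T X Y) in
/-- Pointwise application of a continuous family of operators to a continuous family of vectors. -/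
def pointwiseApply : C(T, X →L[ℝ] Y) →L[ℝ] C(T, X) →L[ℝ] C(T, Y) :=
  LinearMap.mkContinuous₂
    (LinearMap.mk₂ ℝ
      (fun (L : C(T, X →L[ℝ] Y)) (h : C(T, X)) =>
        (⟨fun t => L t (h t), L.continuous.clm_apply h.continuous⟩ : C(T, Y)))
      (fun _ _ _ => by ext; simp) (fun _ _ _ => by ext; simp)
      (fun _ _ _ => by ext; simp) (fun _ _ _ => by ext; simp)) 1
    (fun L h => by
      rw [ContinuousMap.norm_le _ (by positivity)]
      intro t
      rw [one_mul]
      exact (ContinuousLinearMap.le_opNorm _ _).trans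
        (mul_le_mul (L.norm_coe_le_norm t) (h.norm_coe_le_norm t) (norm_nonneg _) (norm_nonneg L)))

@[simp] lemma pointwiseApply_apply (L : C(T, X →L[ℝ] Y)) (h : C(T, X)) (t : T) :
    pointwiseApply T X Y L h t = L t (h t) := rfl

lemma norm_pointwiseApply_le (L : C(T, X →L[ℝ] Y)) : ‖pointwiseApply T X Y L‖ ≤ ‖L‖ := by
  refine ContinuousLinearMap.opNorm_le_bound _ (norm_nonneg L) fun h => ?_
  rw [ContinuousMap.norm_le _ (by positivity)]
  intro t
  exact (ContinuousLinearMap.le_opNorm _ _).trans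
    (mul_le_mul (L.norm_coe_le_norm t) (h.norm_coe_le_norm t) (norm_nonneg _) (norm_nonneg L))

/-- The mean value inequality is applied pointwise in `t`, on the segment from `γ t` to `γ t + η t`.
The uniformity in `t` comes from continuity of the superposition operator of `DW` at `γ`: the whole
curve `γ + s • η` is close to `γ` in the sup norm. -/
lemma hasFDerivAt_nemytskii {W : C(T × X, Y)} {DW : C(T × X, X →L[ℝ] Y)}
    (h : ∀ t x, HasFDerivAt (fun x => W (t, x)) (DW (t, x)) x) (γ : C(T, X)) :
    HasFDerivAt (nemytskii W) (pointwiseApply T X Y (nemytskii DW γ)) γ := by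
  rw [hasFDerivAt_iff_isLittleO_nhds_zero, Asymptotics.isLittleO_iff]
  intro c hc
  have hcont := (continuous_nemytskii DW).continuousAt (x := γ)
  obtain ⟨ρ, hρ, hρ'⟩ := Metric.continuousAt_iff.1 hcont c hc
  filter_upwards [Metric.ball_mem_nhds (0 : C(T, X)) hρ] with η hη
  rw [mem_ball_zero_iff] at hη
  rw [ContinuousMap.norm_le _ (by positivity)]
  intro t
  have key := Convex.norm_image_sub_le_of_norm_hasFDerivWithin_le' (𝕜 := ℝ)
    (f := fun x => W (t, x)) (f' := fun x => DW (t, x)) (C := c) (φ := DW (t, γ t))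
    (s := segment ℝ (γ t) (γ t + η t)) (x := γ t) (y := γ t + η t)
    (fun x _ => (h t x).hasFDerivWithinAt) ?_ (convex_segment _ _) (left_mem_segment _ _ _)
    (right_mem_segment _ _ _)
  · simp only [add_sub_cancel_left] at key
    simpa using key.trans (mul_le_mul_of_nonneg_left (η.norm_coe_le_norm t) hc.le)
  · intro x hx
    rw [segment_eq_image'] at hx
    obtain ⟨s, ⟨hs0, hs1⟩, rfl⟩ := hx
    have h1 : dist (γ + s • η) γ < ρ := by
      rw [dist_eq_norm, add_sub_cancel_left, norm_smul, Real.norm_of_nonneg hs0]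
      exact (mul_le_of_le_one_left (norm_nonneg _) hs1).trans_lt hη
    have h2 := (hρ' h1).le
    rw [dist_eq_norm] at h2
    have h3 := (ContinuousMap.norm_coe_le_norm _ t).trans h2
    simpa using h3

end Nemytskii

/-! ### Smoothness of superposition operators over the strip `[0, δ] × X`. -/

section FiberDeriv

variable {X Y : Type*} [NormedAddCommGroup X] [NormedSpace ℝ X] [NormedAddCommGroup Y]
  [NormedSpace ℝ Y] {δ : ℝ}

/-- The strip `[0, δ] × X`. -/
abbrev strip (δ : ℝ) (X : Type*) : Set (ℝ × X) := Icc 0 δ ×ˢ univ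

lemma uniqueDiffOn_strip (hδ : 0 < δ) : UniqueDiffOn ℝ (strip δ X) :=
  (uniqueDiffOn_Icc hδ).prod uniqueDiffOn_univ

/-- The restriction of a map on the strip, as a continuous map. -/
def stripMap (W : ℝ × X → Y) (hW : ContinuousOn W (strip δ X)) : C(Icc (0 : ℝ) δ × X, Y) :=
  ⟨fun p => W (p.1, p.2), hW.comp_continuous (by fun_prop) fun p => ⟨p.1.2, mem_univ _⟩⟩

@[simp] lemma stripMap_apply (W : ℝ × X → Y) (hW : ContinuousOn W (strip δ X))
    (p : Icc (0 : ℝ) δ × X) : stripMap W hW p = W (p.1, p.2) := rfl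

/-- The derivative in the second variable. -/
def fiberDeriv (δ : ℝ) (W : ℝ × X → Y) (p : ℝ × X) : X →L[ℝ] Y :=
  (fderivWithin ℝ W (strip δ X) p).comp (ContinuousLinearMap.inr ℝ ℝ X)

lemma contDiffOn_fiberDeriv (hδ : 0 < δ) {W : ℝ × X → Y} (hW : ContDiffOn ℝ ∞ W (strip δ X)) :
    ContDiffOn ℝ ∞ (fiberDeriv δ W) (strip δ X) :=
  ((contDiffOn_infty_iff_fderivWithin (uniqueDiffOn_strip hδ)).1 hW).2.clm_comp contDiffOn_const

lemma hasFDerivAt_fiberDeriv {W : ℝ × X → Y} (hW : ContDiffOn ℝ ∞ W (strip δ X)) {t : ℝ}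
    (ht : t ∈ Icc 0 δ) (x : X) : HasFDerivAt (fun x => W (t, x)) (fiberDeriv δ W (t, x)) x := by
  have h1 : HasFDerivWithinAt W (fderivWithin ℝ W (strip δ X) (t, x)) (strip δ X) (t, x) :=
    (hW.differentiableOn (by simp) _ ⟨ht, mem_univ _⟩).hasFDerivWithinAt
  rw [← hasFDerivWithinAt_univ]
  exact h1.comp x (hasFDerivAt_prodMk_right t x).hasFDerivWithinAt
    fun y _ => ⟨ht, mem_univ _⟩

/-- The derivative of the superposition operator of `W` is `pointwiseApply` after the superposition
operator of `fiberDeriv δ W`, which has the same shape with target `X →L[ℝ] Y`. So the induction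
runs over all `Y` at once, and `X` and `Y` share a universe to keep `X →L[ℝ] Y` in range. -/
lemma contDiff_nemytskii_stripMap {X : Type v} [NormedAddCommGroup X] [NormedSpace ℝ X]
    (hδ : 0 < δ) (n : ℕ) :
    ∀ {Y : Type v} [NormedAddCommGroup Y] [NormedSpace ℝ Y] {W : ℝ × X → Y}
      (hW : ContDiffOn ℝ ∞ W (strip δ X)),
      ContDiff ℝ n (nemytskii (stripMap W hW.continuousOn)) := by
  induction n with
  | zero =>
    intro Y _ _ W hW
    exact contDiff_zero.2 (continuous_nemytskii _)
  | succ n ih =>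
    intro Y _ _ W hW
    have hD := contDiffOn_fiberDeriv hδ hW
    refine contDiff_succ_iff_hasFDerivAt.2
      ⟨fun γ => pointwiseApply (Icc (0 : ℝ) δ) X Y (nemytskii (stripMap _ hD.continuousOn) γ),
        ?_, ?_⟩
    · exact (ContinuousLinearMap.contDiff (E := C(Icc (0 : ℝ) δ, X →L[ℝ] Y))
        (F := C(Icc (0 : ℝ) δ, X) →L[ℝ] C(Icc (0 : ℝ) δ, Y))
        (pointwiseApply (Icc (0 : ℝ) δ) X Y)).comp (ih hD)
    · intro γ
      exact hasFDerivAt_nemytskii (fun t x => hasFDerivAt_fiberDeriv hW t.2 x) γ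

end FiberDeriv

/-! ### The Volterra operator. -/

section Volterra

variable {X : Type*} [NormedAddCommGroup X] [NormedSpace ℝ X] [CompleteSpace X] {δ : ℝ}

/-- The primitive vanishing at `0` of a curve on `[0, δ]`, extended constantly to the line. -/
def primitive (hδ : 0 ≤ δ) (γ : C(Icc (0 : ℝ) δ, X)) (t : ℝ) : X :=
  ∫ s in (0 : ℝ)..t, γ (projIcc 0 δ hδ s)

lemma continuous_comp_projIcc (hδ : 0 ≤ δ) (γ : C(Icc (0 : ℝ) δ, X)) :
    Continuous fun s => γ (projIcc 0 δ hδ s) :=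
  γ.continuous.comp continuous_projIcc

lemma hasDerivAt_primitive (hδ : 0 ≤ δ) (γ : C(Icc (0 : ℝ) δ, X)) (t : ℝ) :
    HasDerivAt (primitive hδ γ) (γ (projIcc 0 δ hδ t)) t :=
  (continuous_comp_projIcc hδ γ).integral_hasStrictDerivAt 0 t |>.hasDerivAt

lemma norm_primitive_sub_le (hδ : 0 ≤ δ) (γ : C(Icc (0 : ℝ) δ, X)) (s t : ℝ) :
    ‖primitive hδ γ t - primitive hδ γ s‖ ≤ ‖γ‖ * |t - s| := by
  rw [primitive, primitive, intervalIntegral.integral_interval_sub_left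
    ((continuous_comp_projIcc hδ γ).intervalIntegrable _ _)
    ((continuous_comp_projIcc hδ γ).intervalIntegrable _ _)]
  exact intervalIntegral.norm_integral_le_of_norm_le_const fun x _ => γ.norm_coe_le_norm _

@[simp] lemma primitive_zero (hδ : 0 ≤ δ) (γ : C(Icc (0 : ℝ) δ, X)) : primitive hδ γ 0 = 0 := by
  simp [primitive]

variable (X) in
/-- The Volterra operator `γ ↦ (t ↦ ∫₀ᵗ γ)`. -/
def volterra (hδ : 0 ≤ δ) : C(Icc (0 : ℝ) δ, X) →L[ℝ] C(Icc (0 : ℝ) δ, X) :=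
  LinearMap.mkContinuous
    { toFun := fun γ => ⟨fun t => primitive hδ γ t,
        (continuous_iff_continuousAt.2
          fun t => (hasDerivAt_primitive hδ γ t).continuousAt).comp continuous_subtype_val⟩
      map_add' := fun γ η => by
        ext t
        exact intervalIntegral.integral_add
          ((continuous_comp_projIcc hδ γ).intervalIntegrable _ _)
          ((continuous_comp_projIcc hδ η).intervalIntegrable _ _)
      map_smul' := fun c γ => by
        ext t
        exact intervalIntegral.integral_smul c _ } δ
    (fun γ => by
      rw [ContinuousMap.norm_le _ (by positivity)]
      intro t
      have h := norm_primitive_sub_le hδ γ 0 t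
      rw [primitive_zero, sub_zero, sub_zero, abs_of_nonneg t.2.1] at h
      exact h.trans (by
        rw [mul_comm]; exact mul_le_mul_of_nonneg_right t.2.2 (norm_nonneg γ)))

@[simp] lemma volterra_apply (hδ : 0 ≤ δ) (γ : C(Icc (0 : ℝ) δ, X)) (t : Icc (0 : ℝ) δ) :
    volterra X hδ γ t = primitive hδ γ t := rfl

lemma norm_volterra_le (hδ : 0 ≤ δ) : ‖volterra X hδ‖ ≤ δ :=
  LinearMap.mkContinuous_norm_le _ hδ _

end Volterra

/-! ### Joint smoothness of solution families in time and parameter. -/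

section Joint

variable {X Y Q : Type v} [NormedAddCommGroup X] [NormedSpace ℝ X] [CompleteSpace X]
  [NormedAddCommGroup Y] [NormedSpace ℝ Y] [CompleteSpace Y]
  [NormedAddCommGroup Q] [NormedSpace ℝ Q] {δ : ℝ}

lemma volterra_compLeft (hδ : 0 ≤ δ) (L : X →L[ℝ] Y) (γ : C(Icc (0 : ℝ) δ, X)) :
    volterra Y hδ (L.compLeftContinuous ℝ _ γ) = L.compLeftContinuous ℝ _ (volterra X hδ γ) := by
  ext t
  exact L.intervalIntegral_comp_comm ((continuous_comp_projIcc hδ γ).intervalIntegrable _ _)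

/-- `ξ` is a family of solutions of the equation `x' = W (t, x)` on `[0, δ]` with initial
values `i`. -/
def IsSolutionFamily (hδ : 0 ≤ δ) (W : ℝ × X → X) (hW : ContinuousOn W (strip δ X)) (i : Q → X)
    (ξ : Q → C(Icc (0 : ℝ) δ, X)) : Prop :=
  ∀ q, ξ q = ContinuousMap.const _ (i q) + volterra X hδ (nemytskii (stripMap W hW) (ξ q))

variable {W : ℝ × X → X} {i : Q → X} {ξ : Q → C(Icc (0 : ℝ) δ, X)}

/-- Differentiating the integral equation in the parameter gives the variational equation, again as
an integral equation. -/
lemma IsSolutionFamily.fderiv_eq (hδ : 0 < δ) (hW : ContDiffOn ℝ ∞ W (strip δ X))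
    (hi : ContDiff ℝ ∞ i) (hξ : ContDiff ℝ ∞ ξ)
    (h : IsSolutionFamily hδ.le W hW.continuousOn i ξ) (q w : Q) :
    fderiv ℝ ξ q w = ContinuousMap.const _ (fderiv ℝ i q w) +
      volterra X hδ.le (pointwiseApply (Icc (0 : ℝ) δ) X X
        (nemytskii (stripMap _ (contDiffOn_fiberDeriv hδ hW).continuousOn) (ξ q))
        (fderiv ℝ ξ q w)) := by
  have h1 : HasFDerivAt ξ (fderiv ℝ ξ q) q := (hξ.differentiable (by simp) q).hasFDerivAt
  have h2 : HasFDerivAt i (fderiv ℝ i q) q := (hi.differentiable (by simp) q).hasFDerivAt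
  let c : X →L[ℝ] C(Icc (0 : ℝ) δ, X) := ContinuousLinearMap.const ℝ _
  have h3 := (volterra X hδ.le).hasFDerivAt.comp q
    ((hasFDerivAt_nemytskii (W := stripMap W hW.continuousOn)
      (DW := stripMap _ (contDiffOn_fiberDeriv hδ hW).continuousOn)
      (fun t x => hasFDerivAt_fiberDeriv hW t.2 x) (ξ q)).comp q h1)
  have h4 := (c.hasFDerivAt.comp q h2).add h3
  have h5 : ξ = fun q => c (i q) +
      volterra X hδ.le (nemytskii (stripMap W hW.continuousOn) (ξ q)) := funext h
  have h6 : HasFDerivAt ξ _ q := h4.congr_of_eventuallyEq (Eventually.of_forall fun q => by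
    exact h q)
  have h7 := h1.unique h6
  conv_lhs => rw [h7]
  rfl

/-- The original equation and its variational equation together form one equation of the same kind
on `X × X`, with parameters `Q × Q`. This is what makes the induction in
`IsSolutionFamily.contDiffOn` close. -/
lemma IsSolutionFamily.tangent (hδ : 0 < δ) (hW : ContDiffOn ℝ ∞ W (strip δ X))
    (hi : ContDiff ℝ ∞ i) (hξ : ContDiff ℝ ∞ ξ)
    (h : IsSolutionFamily hδ.le W hW.continuousOn i ξ)
    {W' : ℝ × (X × X) → X × X}
    (hWeq : ∀ p, W' p = (W (p.1, p.2.1), fiberDeriv δ W (p.1, p.2.1) p.2.2))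
    (hW' : ContinuousOn W' (strip δ (X × X))) :
    IsSolutionFamily (Q := Q × Q) hδ.le W' hW' (fun p => (i p.1, fderiv ℝ i p.1 p.2))
      (fun p => (ContinuousLinearMap.inl ℝ X X).compLeftContinuous ℝ _ (ξ p.1) +
        (ContinuousLinearMap.inr ℝ X X).compLeftContinuous ℝ _ (fderiv ℝ ξ p.1 p.2)) := by
  rintro ⟨q, w⟩
  have key : nemytskii (stripMap W' hW')
      ((ContinuousLinearMap.inl ℝ X X).compLeftContinuous ℝ _ (ξ q) +
        (ContinuousLinearMap.inr ℝ X X).compLeftContinuous ℝ _ (fderiv ℝ ξ q w)) =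
      (ContinuousLinearMap.inl ℝ X X).compLeftContinuous ℝ _
        (nemytskii (stripMap W hW.continuousOn) (ξ q)) +
      (ContinuousLinearMap.inr ℝ X X).compLeftContinuous ℝ _
        (pointwiseApply (Icc (0 : ℝ) δ) X X
          (nemytskii (stripMap _ (contDiffOn_fiberDeriv hδ hW).continuousOn) (ξ q))
          (fderiv ℝ ξ q w)) := by
    ext t <;> simp [hWeq]
  simp only
  rw [key, map_add, volterra_compLeft, volterra_compLeft]
  conv_lhs => rw [h q, h.fderiv_eq hδ hW hi hξ q w]
  ext t <;> simp

/-- The increment from `(t, q)` to `(s, q')` is split in three. The first-order error in `q` is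
small in sup norm, hence at time `s`. Moving the linear term from time `s` to `t` costs `O(‖q' - q‖
|s - t|)`, since solutions of the variational equation are Lipschitz in time. What remains is the
time derivative of the single solution `ξ q`. -/
lemma IsSolutionFamily.hasFDerivWithinAt (hδ : 0 < δ) (hW : ContDiffOn ℝ ∞ W (strip δ X))
    (hi : ContDiff ℝ ∞ i) (hξ : ContDiff ℝ ∞ ξ)
    (h : IsSolutionFamily hδ.le W hW.continuousOn i ξ) (p : ℝ × Q) (hp : p ∈ strip δ Q) :
    HasFDerivWithinAt (fun p : ℝ × Q => ξ p.2 (projIcc 0 δ hδ.le p.1))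
      ((ContinuousLinearMap.fst ℝ ℝ Q).smulRight (W (p.1, ξ p.2 (projIcc 0 δ hδ.le p.1))) +
        ((ContinuousMap.evalCLM ℝ (projIcc 0 δ hδ.le p.1)).comp (fderiv ℝ ξ p.2)).comp
          (ContinuousLinearMap.snd ℝ ℝ Q)) (strip δ Q) p := by
  obtain ⟨t, q⟩ := p
  have ht : t ∈ Icc 0 δ := hp.1
  simp only
  have h1 : HasFDerivAt ξ (fderiv ℝ ξ q) q := (hξ.differentiable (by simp) q).hasFDerivAt
  have hproj : ∀ s ∈ Icc 0 δ, ((projIcc 0 δ hδ.le s : Icc (0 : ℝ) δ) : ℝ) = s :=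
    fun s hs => by rw [projIcc_of_mem _ hs]
  -- the time derivative of a single solution
  have hC : HasDerivWithinAt (fun s => ξ q (projIcc 0 δ hδ.le s))
      (W (t, ξ q (projIcc 0 δ hδ.le t))) (Icc 0 δ) t := by
    have h2 := ((hasDerivAt_primitive hδ.le
      (nemytskii (stripMap W hW.continuousOn) (ξ q)) t).const_add (i q)).hasDerivWithinAt
      (s := Icc 0 δ)
    have h3 : ∀ s ∈ Icc 0 δ, ξ q (projIcc 0 δ hδ.le s) =
        i q + primitive hδ.le (nemytskii (stripMap W hW.continuousOn) (ξ q)) s := by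
      intro s hs
      conv_lhs => rw [h q]
      simp [hproj s hs]
    have h4 := h2.congr h3 (h3 t ht)
    simpa [hproj t ht] using h4
  set L := pointwiseApply (Icc (0 : ℝ) δ) X X
        (nemytskii (stripMap _ (contDiffOn_fiberDeriv hδ hW).continuousOn) (ξ q)) with hL
  -- the linear solutions are uniformly Lipschitz in time
  have hB : ∀ w : Q, ∀ s ∈ Icc 0 δ, ‖fderiv ℝ ξ q w (projIcc 0 δ hδ.le s) -
      fderiv ℝ ξ q w (projIcc 0 δ hδ.le t)‖ ≤ ‖L‖ * ‖fderiv ℝ ξ q‖ * ‖w‖ * |s - t| := by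
    intro w s hs
    have h2 := h.fderiv_eq hδ hW hi hξ q w
    rw [← hL] at h2
    have h3 : fderiv ℝ ξ q w (projIcc 0 δ hδ.le s) - fderiv ℝ ξ q w (projIcc 0 δ hδ.le t) =
        primitive hδ.le (L (fderiv ℝ ξ q w)) s - primitive hδ.le (L (fderiv ℝ ξ q w)) t := by
      conv_lhs => rw [h2]
      simp [hproj s hs, hproj t ht]
    rw [h3]
    refine (norm_primitive_sub_le hδ.le _ t s).trans ?_
    refine mul_le_mul_of_nonneg_right ?_ (abs_nonneg _)
    rw [mul_assoc]
    exact (L.le_opNorm _).trans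
      (mul_le_mul_of_nonneg_left ((fderiv ℝ ξ q).le_opNorm w) (norm_nonneg _))
  rw [hasFDerivWithinAt_iff_isLittleO] at *
  have hsnd : Tendsto (fun p : ℝ × Q => p.2) (𝓝[strip δ Q] (t, q)) (𝓝 q) :=
    (continuous_snd.tendsto (t, q)).mono_left nhdsWithin_le_nhds
  have hfst : Tendsto (fun p : ℝ × Q => p.1) (𝓝[strip δ Q] (t, q)) (𝓝[Icc 0 δ] t) := by
    refine tendsto_nhdsWithin_iff.2
      ⟨(continuous_fst.tendsto (t, q)).mono_left nhdsWithin_le_nhds, ?_⟩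
    filter_upwards [self_mem_nhdsWithin] with p hp using hp.1
  have hA := ((hasFDerivAt_iff_isLittleO.1 h1).comp_tendsto hsnd)
  have hC' := ((hasDerivWithinAt_iff_isLittleO.1 hC).comp_tendsto hfst)
  have o1 : (fun p : ℝ × Q => (ξ p.2 - ξ q - fderiv ℝ ξ q (p.2 - q)) (projIcc 0 δ hδ.le p.1))
      =o[𝓝[strip δ Q] (t, q)] fun p => p - (t, q) := by
    refine Asymptotics.IsLittleO.of_norm_left ?_
    refine (Asymptotics.IsBigO.trans_isLittleO (Asymptotics.IsBigO.of_bound 1 ?_) hA).trans_isBigO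
      (Asymptotics.IsBigO.of_bound 1 ?_)
    · refine Eventually.of_forall fun p => ?_
      rw [norm_norm, one_mul]
      exact ContinuousMap.norm_coe_le_norm _ _
    · refine Eventually.of_forall fun p => ?_
      rw [one_mul]
      exact norm_snd_le (p - (t, q))
  have o2 : (fun p : ℝ × Q => fderiv ℝ ξ q (p.2 - q) (projIcc 0 δ hδ.le p.1) -
      fderiv ℝ ξ q (p.2 - q) (projIcc 0 δ hδ.le t)) =o[𝓝[strip δ Q] (t, q)]
        fun p => p - (t, q) := by
    have o3 : (fun p : ℝ × Q => ‖p - (t, q)‖ * ‖p - (t, q)‖) =o[𝓝[strip δ Q] (t, q)]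
        fun p => p - (t, q) := by
      have : Tendsto (fun p : ℝ × Q => ‖p - (t, q)‖) (𝓝[strip δ Q] (t, q)) (𝓝 0) := by
        have : Continuous fun p : ℝ × Q => ‖p - (t, q)‖ := by fun_prop
        simpa using (this.tendsto (t, q)).mono_left nhdsWithin_le_nhds
      simpa using ((Asymptotics.isLittleO_one_iff ℝ).2 this).mul_isBigO
        (Asymptotics.isBigO_refl (fun p : ℝ × Q => ‖p - (t, q)‖) _) |>.trans_isBigO
        (by simpa using (Asymptotics.isBigO_refl (fun p : ℝ × Q => p - (t, q)) _).norm_left)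
    refine Asymptotics.IsBigO.trans_isLittleO
      (Asymptotics.IsBigO.of_bound (‖L‖ * ‖fderiv ℝ ξ q‖) ?_) o3
    filter_upwards [self_mem_nhdsWithin] with p hp
    refine (hB _ _ hp.1).trans ?_
    rw [norm_mul, norm_norm, mul_assoc]
    refine mul_le_mul_of_nonneg_left ?_ (by positivity)
    exact mul_le_mul (norm_snd_le (p - (t, q))) (norm_fst_le (p - (t, q))) (abs_nonneg _)
      (norm_nonneg _)
  have o3 : (fun p : ℝ × Q => ξ q (projIcc 0 δ hδ.le p.1) - ξ q (projIcc 0 δ hδ.le t) -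
      (p.1 - t) • W (t, ξ q (projIcc 0 δ hδ.le t))) =o[𝓝[strip δ Q] (t, q)]
        fun p => p - (t, q) :=
    hC'.trans_isBigO (Asymptotics.IsBigO.of_bound 1 (Eventually.of_forall fun p => by
      rw [one_mul]; exact norm_fst_le (p - (t, q))))
  refine ((o1.add o2).add o3).congr_left fun p => ?_
  simp
  abel

/-- In a direction `(w₁, w₂)` the total derivative is `w₁ • W (t, x)` plus the fiber component of
the tangent family at `(q, w₂)`. Both are `C^n` by induction, the second because the tangent family
is itself a solution family. Finite dimension of `Q` allows testing the derivative on one vector at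
a time. -/
theorem IsSolutionFamily.contDiffOn (n : ℕ) : ∀ {X Q : Type v} [NormedAddCommGroup X]
    [NormedSpace ℝ X] [CompleteSpace X] [NormedAddCommGroup Q] [NormedSpace ℝ Q]
    [FiniteDimensional ℝ Q] {δ : ℝ} (hδ : 0 < δ) {W : ℝ × X → X} {i : Q → X}
    {ξ : Q → C(Icc (0 : ℝ) δ, X)} (hW : ContDiffOn ℝ ∞ W (strip δ X))
    (_ : ContDiff ℝ ∞ i) (_ : ContDiff ℝ ∞ ξ)
    (_ : IsSolutionFamily hδ.le W hW.continuousOn i ξ),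
    ContDiffOn ℝ n (fun p : ℝ × Q => ξ p.2 (projIcc 0 δ hδ.le p.1)) (strip δ Q) := by
  induction n with
  | zero =>
    intro X Q _ _ _ _ _ _ δ hδ W i ξ hW hi hξ h
    refine contDiffOn_zero.2 (Continuous.continuousOn ?_)
    have := hξ.continuous
    have := continuous_projIcc (h := hδ.le)
    fun_prop
  | succ n ih =>
    intro X Q _ _ _ _ _ _ δ hδ W i ξ hW hi hξ h
    have hd := h.hasFDerivWithinAt hδ hW hi hξ
    have hF : ContDiffOn ℝ n (fun p : ℝ × Q => ξ p.2 (projIcc 0 δ hδ.le p.1)) (strip δ Q) :=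
      ih hδ hW hi hξ h
    let W' : ℝ × (X × X) → X × X :=
      fun p => (W (p.1, p.2.1), fiberDeriv δ W (p.1, p.2.1) p.2.2)
    have hm : ContDiff ℝ ∞ fun p : ℝ × (X × X) => (p.1, p.2.1) := by fun_prop
    have hmaps : MapsTo (fun p : ℝ × (X × X) => (p.1, p.2.1)) (strip δ (X × X)) (strip δ X) :=
      fun p hp => ⟨hp.1, mem_univ _⟩
    have hW' : ContDiffOn ℝ ∞ W' (strip δ (X × X)) :=
      (hW.comp hm.contDiffOn hmaps).prodMk
        (((contDiffOn_fiberDeriv hδ hW).comp hm.contDiffOn hmaps).clm_apply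
          (by fun_prop))
    have hdi : ContDiff ℝ ∞ (fderiv ℝ i) := (contDiff_infty_iff_fderiv.1 hi).2
    have hdξ : ContDiff ℝ ∞ (fderiv ℝ ξ) := (contDiff_infty_iff_fderiv.1 hξ).2
    have h' := ih (Q := Q × Q) hδ hW' (by fun_prop) (by
      refine ContDiff.add ?_ ?_
      · exact (ContinuousLinearMap.contDiff _).comp (hξ.comp contDiff_fst)
      · exact (ContinuousLinearMap.contDiff _).comp
          ((hdξ.comp contDiff_fst).clm_apply contDiff_snd))
      (h.tangent hδ hW hi hξ (fun _ => rfl) hW'.continuousOn)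
    refine contDiffOn_succ_of_fderivWithin (fun p hp => (hd p hp).differentiableWithinAt)
      (fun h => absurd h (WithTop.natCast_ne_top n)) ?_
    refine contDiffOn_clm_apply.2 fun w => ?_
    have h1 : ContDiffOn ℝ n (fun p : ℝ × Q => w.1 • W (p.1, ξ p.2 (projIcc 0 δ hδ.le p.1)) +
        fderiv ℝ ξ p.2 w.2 (projIcc 0 δ hδ.le p.1)) (strip δ Q) := by
      refine ContDiffOn.add (ContDiffOn.smul contDiffOn_const ?_) ?_
      · exact (hW.of_le (by exact_mod_cast le_top)).comp (contDiff_fst.contDiffOn.prodMk hF)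
          fun p hp => ⟨hp.1, mem_univ _⟩
      · have h2 : ContDiff ℝ n fun p : ℝ × Q => (p.1, (p.2, w.2)) := by fun_prop
        have h3 := (contDiff_snd.comp_contDiffOn h').comp h2.contDiffOn
          (fun p (hp : p ∈ strip δ Q) => ⟨hp.1, mem_univ _⟩)
        refine h3.congr fun p hp => ?_
        simp
    refine h1.congr fun p hp => ?_
    rw [(hd p hp).fderivWithin (uniqueDiffOn_strip hδ p hp)]
    simp

end Joint

/-! ### The flow of a field defined only for non-negative times. -/

section Flow

variable {X : Type v} [NormedAddCommGroup X] [NormedSpace ℝ X] [CompleteSpace X] {δ : ℝ}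

/-- The equation reads `Γ γ = const q` with `Γ = id - volterra ∘ nemytskii W`. By `δ * M ≤ 1 / 2`
the perturbation is `1/2`-Lipschitz, so `Γ` is a homeomorphism of the whole curve space. Its
derivatives `1 - A` are invertible by the Neumann series, so the inverse is smooth. -/
theorem exists_solutionFamily (hδ : 0 < δ) {W : ℝ × X → X}
    (hW : ContDiffOn ℝ ∞ W (strip δ X)) {M : ℝ} (hM : 0 ≤ M)
    (hWM : ∀ p ∈ strip δ X, ‖fiberDeriv δ W p‖ ≤ M) (hδM : δ * M ≤ 1 / 2) :
    ∃ ξ : X → C(Icc (0 : ℝ) δ, X), ContDiff ℝ ∞ ξ ∧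
      IsSolutionFamily hδ.le W hW.continuousOn id ξ := by
  let C := C(Icc (0 : ℝ) δ, X)
  let D := stripMap _ (contDiffOn_fiberDeriv hδ hW).continuousOn
  let N : C → C := nemytskii (stripMap W hW.continuousOn)
  let A : C → C →L[ℝ] C := fun γ =>
    (volterra X hδ.le).comp (pointwiseApply (Icc (0 : ℝ) δ) X X (nemytskii D γ))
  let Γ : C → C := fun γ => γ - volterra X hδ.le (N γ)
  have hA : ∀ γ, ‖A γ‖ ≤ 1 / 2 := by
    intro γ
    refine (ContinuousLinearMap.opNorm_comp_le _ _).trans (le_trans ?_ hδM)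
    refine mul_le_mul (norm_volterra_le hδ.le) ?_ (norm_nonneg _) hδ.le
    refine (norm_pointwiseApply_le _).trans ?_
    rw [ContinuousMap.norm_le _ hM]
    exact fun t => hWM _ ⟨t.2, mem_univ _⟩
  have hN : ∀ γ, HasFDerivAt (fun γ => volterra X hδ.le (N γ)) (A γ) γ := fun γ =>
    (volterra X hδ.le).hasFDerivAt.comp γ (hasFDerivAt_nemytskii (W := stripMap W hW.continuousOn)
      (DW := D) (fun t x => hasFDerivAt_fiberDeriv hW t.2 x) γ)
  have hΓ : ∀ γ, HasFDerivAt Γ (ContinuousLinearMap.id ℝ C - A γ) γ := fun γ =>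
    (hasFDerivAt_id γ).sub (hN γ)
  have hNs : ContDiff ℝ ∞ N := contDiff_infty.2 fun n => contDiff_nemytskii_stripMap hδ n hW
  have hΓs : ContDiff ℝ ∞ Γ := contDiff_id.sub ((volterra X hδ.le).contDiff.comp hNs)
  have happ : ApproximatesLinearOn Γ
      ((ContinuousLinearEquiv.refl ℝ C : C ≃L[ℝ] C) : C →L[ℝ] C) univ (1 / 2) := by
    intro γ _ η _
    have h1 := Convex.norm_image_sub_le_of_norm_hasFDerivWithin_le (𝕜 := ℝ)
      (fun x (_ : x ∈ univ) => (hN x).hasFDerivWithinAt) (fun x _ => hA x) convex_univ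
      (mem_univ η) (mem_univ γ)
    have h2 : Γ γ - Γ η - (γ - η) = -(volterra X hδ.le (N γ) - volterra X hδ.le (N η)) := by
      simp only [Γ]; abel
    simp only [ContinuousLinearEquiv.coe_refl, ContinuousLinearMap.coe_id', id_eq]
    rw [h2, norm_neg]
    simpa using h1
  have hc : Subsingleton C ∨ (1 / 2 : NNReal) <
      ‖((ContinuousLinearEquiv.refl ℝ C).symm : C →L[ℝ] C)‖₊⁻¹ := by
    rcases subsingleton_or_nontrivial C with h | h
    · exact Or.inl h
    · right
      have : ‖((ContinuousLinearEquiv.refl ℝ C).symm : C →L[ℝ] C)‖₊ = 1 := by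
        ext
        simp
      rw [this, inv_one]
      exact NNReal.half_lt_self one_ne_zero
  let Φ : C ≃ₜ C := happ.toHomeomorph Γ hc
  have hΦ : ∀ γ, Φ γ = Γ γ := fun _ => rfl
  have hsymm : ContDiff ℝ ∞ Φ.symm := by
    rw [contDiff_iff_contDiffAt]
    intro γ
    have hlt : ‖A (Φ.symm γ)‖ < 1 := (hA _).trans_lt (by norm_num)
    let u : (C →L[ℝ] C)ˣ := Units.oneSub (A (Φ.symm γ)) hlt
    exact Φ.toOpenPartialHomeomorph.contDiffAt_symm (f₀' := ContinuousLinearEquiv.unitsEquiv ℝ C u)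
      (mem_univ γ) (hΓ _) hΓs.contDiffAt
  refine ⟨fun q => Φ.symm (ContinuousMap.const _ q), hsymm.comp
    (ContinuousLinearMap.const ℝ (Icc (0 : ℝ) δ) : X →L[ℝ] C).contDiff, fun q => ?_⟩
  have h1 : Γ (Φ.symm (ContinuousMap.const _ q)) = ContinuousMap.const _ q :=
    Φ.apply_symm_apply _
  exact sub_eq_iff_eq_add.1 h1

variable [FiniteDimensional ℝ X]

/-- Existence and smoothness up to the initial time of the local flow of a smooth time-dependent
vector field that is only defined for non-negative times. -/
theorem exists_smooth_flow {ε : ℝ} (hε : 0 < ε) {U : Set X} (hU : IsOpen U) {y₀ : X} (hy₀ : y₀ ∈ U)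
    {Z : ℝ × X → X} (hZ : ContDiffOn ℝ ∞ Z (Ico 0 ε ×ˢ U)) :
    ∃ δ, 0 < δ ∧ δ < ε ∧ ∃ V : Set X, IsOpen V ∧ y₀ ∈ V ∧ V ⊆ U ∧ ∃ x : ℝ × X → X,
      ContDiffOn ℝ ∞ x (Icc 0 δ ×ˢ V) ∧ (∀ q ∈ V, x (0, q) = q) ∧
      (∀ t ∈ Icc 0 δ, ∀ q ∈ V, x (t, q) ∈ U) ∧
      ∀ t ∈ Icc 0 δ, ∀ q ∈ V,
        HasDerivWithinAt (fun s => x (s, q)) (Z (t, x (t, q))) (Icc 0 δ) t := by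
  obtain ⟨r, hr, hrU⟩ : ∃ r > 0, Metric.closedBall y₀ (2 * r) ⊆ U := by
    obtain ⟨r, hr, h⟩ := Metric.nhds_basis_closedBall.mem_iff.1 (hU.mem_nhds hy₀)
    exact ⟨r / 2, by positivity, by rwa [mul_div_cancel₀ _ two_ne_zero]⟩
  -- The cutoff is `1` on the ball of radius `r` and vanishes outside radius `2r`, inside `U`. It
  -- makes the field smooth on the full strip, with bounded fiber derivative.
  let χ : ContDiffBump y₀ := ⟨r, 2 * r, hr, by linarith⟩
  let W : ℝ × X → X := fun p => χ p.2 • Z p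
  set δ₀ := ε / 2 with hδ₀
  have hδ₀pos : 0 < δ₀ := by positivity
  have hIcc : ∀ t ∈ Icc 0 δ₀, t ∈ Ico 0 ε := fun t ht => ⟨ht.1, by linarith [ht.2]⟩
  have hzero : ∀ p : ℝ × X, p.2 ∉ Metric.closedBall y₀ (2 * r) → W p = 0 := by
    intro p hp
    have : χ p.2 = 0 := χ.zero_of_le_dist (le_of_lt (by simpa using hp))
    simp [W, this]
  have hW : ContDiffOn ℝ ∞ W (strip δ₀ X) := by
    rintro ⟨t, y⟩ ⟨ht, -⟩
    by_cases hy : y ∈ U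
    · have h1 : ContDiffWithinAt ℝ ∞ W (Ico 0 ε ×ˢ U) (t, y) :=
        ((χ.contDiff.comp contDiff_snd).contDiffWithinAt).smul (hZ _ ⟨hIcc t ht, hy⟩)
      refine h1.mono_of_mem_nhdsWithin ?_
      filter_upwards [self_mem_nhdsWithin, mem_nhdsWithin_of_mem_nhds
        ((hU.preimage continuous_snd).mem_nhds (show (t, y) ∈ Prod.snd ⁻¹' U from hy))]
        with p hp hp' using ⟨hIcc _ hp.1, hp'⟩
    · have h1 : W =ᶠ[𝓝 (t, y)] fun _ => 0 := by
        have h2 : IsOpen (Prod.snd ⁻¹' (Metric.closedBall y₀ (2 * r))ᶜ : Set (ℝ × X)) :=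
          Metric.isClosed_closedBall.isOpen_compl.preimage continuous_snd
        filter_upwards [h2.mem_nhds (show (t, y) ∈ _ from fun h => hy (hrU h))] with p hp
          using hzero p hp
      exact (contDiffAt_const.congr_of_eventuallyEq h1).contDiffWithinAt
  obtain ⟨M, hM⟩ : ∃ M, ∀ p ∈ Icc 0 δ₀ ×ˢ Metric.closedBall y₀ (2 * r),
      ‖fiberDeriv δ₀ W p‖ ≤ M := by
    refine IsCompact.exists_bound_of_continuousOn
      (isCompact_Icc.prod (isCompact_closedBall y₀ (2 * r))) ?_
    exact (contDiffOn_fiberDeriv hδ₀pos hW).continuousOn.mono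
      (prod_mono_right (subset_univ _))
  set M' := max M 0
  have hM'0 : 0 ≤ M' := le_max_right _ _
  -- This choice forces `δ * M' ≤ 1 / 2`; the summand `1` keeps the denominator positive.
  set δ := min δ₀ (1 / (2 * (M' + 1))) with hδ
  have hδpos : 0 < δ := lt_min hδ₀pos (by positivity)
  have hδδ₀ : δ ≤ δ₀ := min_le_left _ _
  have hWδ : ContDiffOn ℝ ∞ W (strip δ X) :=
    hW.mono (prod_mono_left (Icc_subset_Icc_right hδδ₀))
  have hbound : ∀ p ∈ strip δ X, ‖fiberDeriv δ W p‖ ≤ M' := by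
    rintro ⟨t, y⟩ ⟨ht, -⟩
    have ht0 : t ∈ Icc 0 δ₀ := ⟨ht.1, ht.2.trans hδδ₀⟩
    have h1 := hasFDerivAt_fiberDeriv hWδ ht y
    by_cases hy : y ∈ Metric.closedBall y₀ (2 * r)
    · rw [h1.unique (hasFDerivAt_fiberDeriv hW ht0 y)]
      exact (hM _ ⟨ht0, hy⟩).trans (le_max_left _ _)
    · have h2 : (fun x => W (t, x)) =ᶠ[𝓝 y] fun _ => 0 := by
        filter_upwards [Metric.isClosed_closedBall.isOpen_compl.mem_nhds
          (show y ∈ (Metric.closedBall y₀ (2 * r))ᶜ from hy)] with x hx using hzero _ hx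
      rw [h1.unique ((hasFDerivAt_const (0 : X) y).congr_of_eventuallyEq h2), norm_zero]
      exact hM'0
  have hδM : δ * M' ≤ 1 / 2 := by
    have : δ ≤ 1 / (2 * (M' + 1)) := min_le_right _ _
    calc δ * M' ≤ 1 / (2 * (M' + 1)) * M' := by gcongr
      _ ≤ 1 / 2 := by
        rw [div_mul_eq_mul_div, one_mul, div_le_div_iff₀ (by positivity) (by positivity)]
        linarith
  obtain ⟨ξ, hξ, hsol⟩ := exists_solutionFamily hδpos hWδ hM'0 hbound hδM
  set x : ℝ × X → X := fun p => ξ p.2 (projIcc 0 δ hδpos.le p.1) with hx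
  have hxs : ContDiffOn ℝ ∞ x (strip δ X) :=
    contDiffOn_infty.2 fun n => hsol.contDiffOn n hδpos hWδ contDiff_id hξ
  have hproj : ∀ s ∈ Icc 0 δ, ((projIcc 0 δ hδpos.le s : Icc (0 : ℝ) δ) : ℝ) = s :=
    fun s hs => by rw [projIcc_of_mem _ hs]
  have heq : ∀ q, ∀ s ∈ Icc 0 δ, x (s, q) =
      q + primitive hδpos.le (nemytskii (stripMap W hWδ.continuousOn) (ξ q)) s := by
    intro q s hs
    simp only [hx]
    conv_lhs => rw [hsol q]
    simp [hproj s hs]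
  have hx0 : ∀ q, x (0, q) = q := fun q => by
    rw [heq q 0 ⟨le_rfl, hδpos.le⟩, primitive_zero, add_zero]
  have hxc : Continuous x := by
    have := hξ.continuous
    have := continuous_projIcc (h := hδpos.le)
    simp only [hx]
    fun_prop
  have hnhds : x ⁻¹' Metric.ball y₀ r ∈ 𝓝 ((0 : ℝ), y₀) :=
    hxc.continuousAt.preimage_mem_nhds (by rw [hx0]; exact Metric.ball_mem_nhds _ hr)
  rw [nhds_prod_eq, mem_prod_iff] at hnhds
  obtain ⟨s₁, hs₁, s₂, hs₂, hs⟩ := hnhds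
  obtain ⟨η, hη, hηs⟩ := Metric.mem_nhds_iff.1 hs₁
  obtain ⟨V, hVs, hVo, hyV⟩ := mem_nhds_iff.1 hs₂
  have hδ' : 0 < min δ (η / 2) := lt_min hδpos (by positivity)
  -- After shrinking time and initial values, solutions stay where the cutoff is `1`, so they solve
  -- the original equation.
  have hin : ∀ t ∈ Icc 0 (min δ (η / 2)), ∀ q ∈ V ∩ U, x (t, q) ∈ Metric.ball y₀ r := by
    intro t ht q hq
    refine hs ⟨hηs ?_, hVs hq.1⟩
    rw [mem_ball_zero_iff, Real.norm_of_nonneg ht.1]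
    linarith [ht.2.trans (min_le_right _ _)]
  have hballU : Metric.ball y₀ r ⊆ U := fun y hy => hrU (by
    rw [Metric.mem_ball] at hy; rw [Metric.mem_closedBall]; linarith)
  refine ⟨min δ (η / 2), hδ', lt_of_le_of_lt (min_le_left _ _) (by linarith), V ∩ U,
    hVo.inter hU, ⟨hyV, hy₀⟩, inter_subset_right, x,
    hxs.mono (prod_mono (Icc_subset_Icc_right (min_le_left _ _)) (subset_univ _)),
    fun q _ => hx0 q, fun t ht q hq => hballU (hin t ht q hq), fun t ht q hq => ?_⟩
  have ht' : t ∈ Icc 0 δ := ⟨ht.1, ht.2.trans (min_le_left _ _)⟩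
  have h2 := ((hasDerivAt_primitive hδpos.le
    (nemytskii (stripMap W hWδ.continuousOn) (ξ q)) t).const_add q).hasDerivWithinAt (s := Icc 0 δ)
  have h3 := (h2.congr (heq q) (heq q t ht')).mono (Icc_subset_Icc_right (min_le_left _ (η / 2)))
  have h4 : nemytskii (stripMap W hWδ.continuousOn) (ξ q) (projIcc 0 δ hδpos.le t) =
      Z (t, x (t, q)) := by
    have : χ (x (t, q)) = 1 :=
      χ.one_of_mem_closedBall (Metric.ball_subset_closedBall (hin t ht q hq))
    simp only [nemytskii_apply, stripMap_apply, hproj t ht']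
    change χ (x (t, q)) • Z (t, x (t, q)) = _
    rw [this, one_smul]
  rwa [h4] at h3

end Flow

/-! ### Smoothness of inverses on sets with unique derivatives. -/

section Inverse

variable {X Y : Type*} [NormedAddCommGroup X] [NormedSpace ℝ X] [CompleteSpace X]
  [NormedAddCommGroup Y] [NormedSpace ℝ Y]

/-- A continuous right inverse of a smooth map with invertible derivatives is smooth. -/
theorem contDiffOn_of_rightInverse {f : X → Y} {g : Y → X} {s : Set X} {t : Set Y}
    (hs : UniqueDiffOn ℝ s) (ht : UniqueDiffOn ℝ t) (hf : ContDiffOn ℝ ∞ f s)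
    (hg : ContinuousOn g t) (hgt : MapsTo g t s) (hfg : ∀ y ∈ t, f (g y) = y)
    (hinv : ∀ x ∈ s, (fderivWithin ℝ f s x).IsInvertible) : ContDiffOn ℝ ∞ g t := by
  have hd : ∀ y ∈ t, HasFDerivWithinAt g (fderivWithin ℝ f s (g y)).inverse t y := by
    intro y hy
    obtain ⟨A, hA⟩ := hinv _ (hgt hy)
    have h1 : HasFDerivWithinAt f (A : X →L[ℝ] Y) s (g y) := by
      rw [hA]
      exact (hf.differentiableOn (by simp) _ (hgt hy)).hasFDerivWithinAt
    have h2 := h1.of_local_left_inverse (g := g) (a := y) (s := t)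
      ((hg y hy).tendsto_nhdsWithin hgt) hy
      (eventually_nhdsWithin_of_forall hfg)
    rwa [← hA, ContinuousLinearMap.inverse_equiv]
  have hD : ContDiffOn ℝ ∞ (fderivWithin ℝ f s) s :=
    ((contDiffOn_infty_iff_fderivWithin hs).1 hf).2
  rw [contDiffOn_infty]
  intro n
  induction n with
  | zero => exact contDiffOn_zero.2 hg
  | succ n ih =>
    refine contDiffOn_succ_of_fderivWithin (fun y hy => (hd y hy).differentiableWithinAt)
      (fun h => absurd h (WithTop.natCast_ne_top n)) ?_
    -- Bootstrap: the derivative of `g` is the inverse of the derivative of `f` at `g y`, hence as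
    -- regular as `g` itself.
    have h1 : ContDiffOn ℝ n (fun y => (fderivWithin ℝ f s (g y)).inverse) t := by
      intro y hy
      obtain ⟨A, hA⟩ := hinv _ (hgt hy)
      have h2 : ContDiffAt ℝ n (ContinuousLinearMap.inverse : (X →L[ℝ] Y) → _)
          (fderivWithin ℝ f s (g y)) := by
        rw [← hA]; exact contDiffAt_map_inverse A
      exact h2.comp_contDiffWithinAt y
        (((hD.of_le (by exact_mod_cast le_top)).comp ih hgt) y hy)
    exact h1.congr fun y hy => (hd y hy).fderivWithin (ht y hy)

end Inverse

/-! ### The inverse function theorem on half spaces. -/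

section HalfSpace

lemma uniqueDiffOn_Ico_prod {Q : Type*} [NormedAddCommGroup Q] [NormedSpace ℝ Q] {δ : ℝ}
    {V : Set Q} (hV : IsOpen V) :
    UniqueDiffOn ℝ (Ico 0 δ ×ˢ V) :=
  (uniqueDiffOn_Ico 0 δ).prod hV.uniqueDiffOn

variable {Q Y : Type*} [NormedAddCommGroup Q] [NormedSpace ℝ Q] [CompleteSpace Q]
  [NormedAddCommGroup Y] [NormedSpace ℝ Y]

/-- `G` is continued to negative times affinely, with the normal derivative frozen at `q₀`. The
retraction `(t, q) ↦ (max t 0, q)` is 1-Lipschitz onto the half space, where the mean value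
inequality applies on a convex set, and the leftover `min t 0` parts cancel exactly. Strict
differentiability at this single point is all that is needed for a local homeomorphism. -/
lemma hasStrictFDerivAt_halfSpace_extension {G : ℝ × Q → Y} {δ : ℝ} (hδ : 0 < δ) {V : Set Q}
    (hV : IsOpen V) {q₀ : Q} (hq₀ : q₀ ∈ V) (hG : ContDiffOn ℝ 1 G (Ico 0 δ ×ˢ V)) :
    HasStrictFDerivAt (fun p : ℝ × Q => G (max p.1 0, p.2) +
        min p.1 0 • fderivWithin ℝ G (Ico 0 δ ×ˢ V) (0, q₀) (1, 0))
      (fderivWithin ℝ G (Ico 0 δ ×ˢ V) (0, q₀)) (0, q₀) := by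
  set D := Ico 0 δ ×ˢ V with hD
  set A := fderivWithin ℝ G D (0, q₀) with hA
  have h0 : ((0 : ℝ), q₀) ∈ D := ⟨⟨le_rfl, hδ⟩, hq₀⟩
  rw [hasStrictFDerivAt_iff_isLittleO, Asymptotics.isLittleO_iff]
  intro c hc
  have hcont : ContinuousWithinAt (fderivWithin ℝ G D) D (0, q₀) :=
    hG.continuousOn_fderivWithin (uniqueDiffOn_Ico_prod hV) le_rfl _ h0
  have h1 : ∀ᶠ p in 𝓝[D] ((0 : ℝ), q₀), ‖fderivWithin ℝ G D p - A‖ ≤ c := by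
    have := hcont.eventually (Metric.closedBall_mem_nhds A hc)
    filter_upwards [this] with p hp
    simpa [dist_eq_norm] using hp
  obtain ⟨ρ, hρ, hρ'⟩ := Metric.mem_nhdsWithin_iff.1 h1
  have h2 : Iio δ ×ˢ V ∈ 𝓝 ((0 : ℝ), q₀) := prod_mem_nhds (Iio_mem_nhds hδ) (hV.mem_nhds hq₀)
  obtain ⟨ρ₂, hρ₂, hρ₂'⟩ := Metric.mem_nhds_iff.1 h2
  set ρ' := min ρ ρ₂
  have hρ'pos : 0 < ρ' := lt_min hρ hρ₂
  set S : Set (ℝ × Q) := Metric.ball (0, q₀) ρ' ∩ {p | 0 ≤ p.1}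
  have hSD : S ⊆ D := fun p hp =>
    have := hρ₂' (Metric.ball_subset_ball (min_le_right _ _) hp.1)
    ⟨⟨hp.2, this.1⟩, this.2⟩
  have hSconv : Convex ℝ S := (convex_ball _ _).inter
    (convex_halfSpace_ge (IsLinearMap.mk (fun _ _ => rfl) (fun _ _ => rfl)) 0)
  have hπ : ∀ p ∈ Metric.ball ((0 : ℝ), q₀) ρ', ((max p.1 0, p.2) : ℝ × Q) ∈ S := by
    intro p hp
    refine ⟨?_, show (0 : ℝ) ≤ max p.1 0 from le_max_right _ _⟩
    rw [Metric.mem_ball, Prod.dist_eq] at hp ⊢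
    refine lt_of_le_of_lt (max_le_max ?_ le_rfl) hp
    simp only [dist_zero_right, Real.norm_eq_abs]
    rw [abs_of_nonneg (le_max_right _ _)]
    exact max_le (le_abs_self _) (abs_nonneg _)
  have hball : Metric.ball ((0 : ℝ), q₀) ρ' ×ˢ Metric.ball ((0 : ℝ), q₀) ρ' ∈
      𝓝 (((0 : ℝ), q₀), ((0 : ℝ), q₀)) :=
    prod_mem_nhds (Metric.ball_mem_nhds _ hρ'pos) (Metric.ball_mem_nhds _ hρ'pos)
  filter_upwards [hball] with ⟨p, p'⟩ ⟨hp, hp'⟩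
  have h3 := Convex.norm_image_sub_le_of_norm_hasFDerivWithin_le' (𝕜 := ℝ) (f := G) (C := c)
    (φ := A) (f' := fderivWithin ℝ G D) (s := S)
    (fun x hx => ((hG.differentiableOn one_ne_zero _ (hSD hx)).hasFDerivWithinAt).mono hSD)
    (fun x hx => hρ' ⟨Metric.ball_subset_ball (min_le_left _ _) hx.1, hSD hx⟩)
    hSconv (hπ p' hp') (hπ p hp)
  have h4 : ∀ p : ℝ × Q, p = (max p.1 0, p.2) + min p.1 0 • ((1 : ℝ), (0 : Q)) := by
    intro p
    ext
    · simp [max_add_min]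
    · simp
  have h5 : ‖((max p.1 0, p.2) : ℝ × Q) - (max p'.1 0, p'.2)‖ ≤ ‖p - p'‖ := by
    rw [← dist_eq_norm, ← dist_eq_norm, Prod.dist_eq, Prod.dist_eq]
    refine max_le_max ?_ le_rfl
    simp only [Real.dist_eq]
    exact abs_max_sub_max_le_abs _ _ _
  refine le_trans (le_of_eq ?_) (h3.trans (mul_le_mul_of_nonneg_left h5 hc.le))
  congr 1
  have h6 : A (p - p') = A ((max p.1 0, p.2) - (max p'.1 0, p'.2)) +
      (min p.1 0 • A (1, 0) - min p'.1 0 • A (1, 0)) := by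
    conv_lhs => rw [h4 p, h4 p']
    rw [← map_smul, ← map_smul, ← map_sub, ← map_add]
    congr 1
    abel
  simp only [h6]
  abel

/-- The inverse function theorem for maps between half spaces which preserve the boundary. -/
theorem exists_halfSpace_inverse {G : ℝ × Q → Y} {δ : ℝ} (hδ : 0 < δ) {V : Set Q}
    (hV : IsOpen V) {q₀ : Q} (hq₀ : q₀ ∈ V) (hG : ContDiffOn ℝ ∞ G (Ico 0 δ ×ˢ V))
    {ℓ : Y →L[ℝ] ℝ} (hℓ : ℓ ≠ 0) (hpos : ∀ p ∈ Ico 0 δ ×ˢ V, 0 ≤ ℓ (G p))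
    (hzero : ∀ q ∈ V, ℓ (G (0, q)) = 0)
    (hinv : (fderivWithin ℝ G (Ico 0 δ ×ˢ V) (0, q₀)).IsInvertible) :
    ∃ Θ : OpenPartialHomeomorph (ℝ × Q) Y, (0, q₀) ∈ Θ.source ∧ Θ.source ⊆ Iio δ ×ˢ V ∧
      (∀ p ∈ Θ.source, 0 ≤ p.1 → Θ p = G p) ∧
      (∀ p ∈ Θ.source, (0 ≤ ℓ (Θ p) ↔ 0 ≤ p.1)) ∧
      (∀ p ∈ Θ.source, (0 < ℓ (Θ p) ↔ 0 < p.1)) ∧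
      (∀ p ∈ Θ.source, 0 ≤ p.1 → (fderivWithin ℝ G (Ico 0 δ ×ˢ V) p).IsInvertible) ∧
      ContDiffOn ℝ ∞ Θ.symm (Θ.target ∩ {y | 0 ≤ ℓ y}) := by
  set D := Ico 0 δ ×ˢ V with hD
  set A := fderivWithin ℝ G D (0, q₀) with hA
  have h0 : ((0 : ℝ), q₀) ∈ D := ⟨⟨le_rfl, hδ⟩, hq₀⟩
  have hUD : UniqueDiffOn ℝ D := uniqueDiffOn_Ico_prod hV
  obtain ⟨A', hA'⟩ := hinv
  have hd : HasFDerivWithinAt G A D (0, q₀) :=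
    (hG.differentiableOn (by simp) _ h0).hasFDerivWithinAt
  have hstrict := hasStrictFDerivAt_halfSpace_extension hδ hV hq₀ (hG.of_le (by simp))
  rw [← hD, ← hA, ← hA'] at hstrict
  set Gt : ℝ × Q → Y := fun p => G (max p.1 0, p.2) + min p.1 0 • A' (1, 0) with hGt
  -- the normal derivative is positive
  have hc : 0 < ℓ (A' (1, 0)) := by
    have h1 : ∀ w, ℓ (A' (0, w)) = 0 := by
      intro w
      have h2 : HasFDerivAt (fun q => ℓ (G (0, q)))
          (ℓ.comp (A.comp (ContinuousLinearMap.inr ℝ ℝ Q))) q₀ := by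
        refine ℓ.hasFDerivAt.comp q₀ ?_
        refine HasFDerivWithinAt.hasFDerivAt (s := V) ?_ (hV.mem_nhds hq₀)
        exact hd.comp q₀ (hasFDerivAt_prodMk_right (0 : ℝ) q₀).hasFDerivWithinAt
          fun q hq => ⟨⟨le_rfl, hδ⟩, hq⟩
      have h3 : (fun q => ℓ (G (0, q))) =ᶠ[𝓝 q₀] fun _ => 0 := by
        filter_upwards [hV.mem_nhds hq₀] with q hq using hzero q hq
      have h4 := h2.unique ((hasFDerivAt_const (0 : ℝ) q₀).congr_of_eventuallyEq h3)
      have h5 := congrArg (fun L : Q →L[ℝ] ℝ => L w) h4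
      simpa [← hA'] using h5
    have h2 : 0 ≤ ℓ (A' (1, 0)) := by
      have h3 : HasDerivWithinAt (fun t : ℝ => ℓ (G (t, q₀))) (ℓ (A' (1, 0))) (Ici 0) 0 := by
        have h4 : HasDerivWithinAt (fun t : ℝ => ℓ (G (t, q₀))) (ℓ (A (1, 0))) (Ico 0 δ) 0 :=
          ℓ.hasFDerivAt.comp_hasDerivWithinAt (0 : ℝ)
            (HasFDerivWithinAt.comp_hasDerivWithinAt (t := D) (0 : ℝ) hd
              ((hasDerivAt_id (0 : ℝ)).prodMk (hasDerivAt_const _ q₀)).hasDerivWithinAt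
              fun t ht => ⟨ht, hq₀⟩)
        rw [← hA'] at h4
        exact h4.mono_of_mem_nhdsWithin (Ico_mem_nhdsGE hδ)
      refine ge_of_tendsto ((hasDerivWithinAt_iff_tendsto_slope' self_notMem_Ioi).1
        (h3.mono Ioi_subset_Ici_self)) ?_
      have : Ico 0 δ ∈ 𝓝[Ioi 0] (0 : ℝ) :=
        nhdsWithin_mono _ Ioi_subset_Ici_self (Ico_mem_nhdsGE hδ)
      filter_upwards [this] with t ht
      rw [slope_def_field, hzero _ hq₀, sub_zero, sub_zero]
      exact div_nonneg (hpos _ ⟨ht, hq₀⟩) ht.1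
    -- Were the normal derivative zero, `ℓ` would vanish on the range of `A'`, which is everything.
    refine lt_of_le_of_ne h2 fun h3 => hℓ ?_
    ext y
    obtain ⟨⟨s, w⟩, rfl⟩ := A'.surjective y
    have h4 : ((s, w) : ℝ × Q) = s • (1, 0) + (0, w) := by ext <;> simp
    rw [h4, map_add, map_add, map_smul, map_smul, h1, ← h3]
    simp
  -- points where the derivative is invertible
  have hopen : ∀ᶠ p in 𝓝 ((0 : ℝ), q₀), p ∈ D → (fderivWithin ℝ G D p).IsInvertible := by
    have hcont : ContinuousWithinAt (fderivWithin ℝ G D) D (0, q₀) :=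
      hG.continuousOn_fderivWithin hUD (by simp) _ h0
    have h1 : range ((↑) : ((ℝ × Q) ≃L[ℝ] Y) → (ℝ × Q →L[ℝ] Y)) ∈ 𝓝 A := by
      rw [← hA']
      exact ContinuousLinearEquiv.nhds A'
    exact eventually_nhdsWithin_iff.1 (hcont.eventually h1)
  have hmem : Iio δ ×ˢ V ∈ 𝓝 ((0 : ℝ), q₀) := prod_mem_nhds (Iio_mem_nhds hδ) (hV.mem_nhds hq₀)
  obtain ⟨S, hSsub, hSo, hS0⟩ := mem_nhds_iff.1 (Filter.inter_mem hopen hmem)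
  let Θ := (hstrict.toOpenPartialHomeomorph Gt).restrOpen S hSo
  have hΘsource : Θ.source = (hstrict.toOpenPartialHomeomorph Gt).source ∩ S := rfl
  have hΘapply : ∀ p, Θ p = Gt p := fun _ => rfl
  have hsrc : Θ.source ⊆ Iio δ ×ˢ V := fun p hp => (hSsub hp.2).2
  have hΘG : ∀ p ∈ Θ.source, 0 ≤ p.1 → Θ p = G p := by
    intro p _ hp0
    rw [hΘapply]
    simp [hGt, hp0]
  have hmemD : ∀ p ∈ Θ.source, 0 ≤ p.1 → p ∈ D := fun p hp hp0 =>
    ⟨⟨hp0, (hsrc hp).1⟩, (hsrc hp).2⟩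
  -- For `t < 0` the value is `G (0, q) + t • A' (1, 0)`; `ℓ` kills the first term and is positive
  -- on `A' (1, 0)`.
  have hneg : ∀ p ∈ Θ.source, p.1 < 0 → ℓ (Θ p) < 0 := by
    intro p hp hp0
    rw [hΘapply]
    simp only [hGt, max_eq_right hp0.le, min_eq_left hp0.le, map_add, map_smul,
      hzero _ (hsrc hp).2, zero_add, smul_eq_mul]
    exact mul_neg_of_neg_of_pos hp0 hc
  have hder : ∀ p ∈ Θ.source, 0 ≤ p.1 → (fderivWithin ℝ G D p).IsInvertible := fun p hp hp0 =>
    (hSsub hp.2).1 (hmemD p hp hp0)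
  have hposp : ∀ p ∈ Θ.source, 0 < p.1 → 0 < ℓ (Θ p) := by
    intro p hp hp0
    rw [hΘG p hp hp0.le]
    have hDn : D ∈ 𝓝 p := prod_mem_nhds (Ico_mem_nhds hp0 (hsrc hp).1) (hV.mem_nhds (hsrc hp).2)
    have hdp : HasFDerivAt G (fderivWithin ℝ G D p) p :=
      ((hG.differentiableOn (by simp) _ (hmemD p hp hp0.le)).hasFDerivWithinAt).hasFDerivAt hDn
    refine lt_of_le_of_ne (hpos _ (hmemD p hp hp0.le)) fun h => ?_
    -- An interior zero of the non-negative function `ℓ ∘ G` is a minimum, so `ℓ` would vanish on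
    -- the range of an invertible derivative.
    have hmin : IsLocalMin (fun p => ℓ (G p)) p := by
      filter_upwards [hDn] with p' hp'
      rw [← h]
      exact hpos p' hp'
    have h1 := hmin.hasFDerivAt_eq_zero (ℓ.hasFDerivAt.comp p hdp)
    obtain ⟨B, hB⟩ := hder p hp hp0.le
    refine hℓ (ContinuousLinearMap.ext fun y => ?_)
    have h2 := congrArg (fun L : ℝ × Q →L[ℝ] ℝ => L (B.symm y)) h1
    simpa [← hB] using h2
  have hz : ∀ p ∈ Θ.source, p.1 = 0 → ℓ (Θ p) = 0 := by
    intro p hp hp0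
    rw [hΘG p hp hp0.ge]
    obtain ⟨t, q⟩ := p
    obtain rfl : t = 0 := hp0
    exact hzero _ (hsrc hp).2
  have hnn : ∀ p ∈ Θ.source, (0 ≤ ℓ (Θ p) ↔ 0 ≤ p.1) := by
    intro p hp
    rcases lt_trichotomy p.1 0 with h | h | h
    · exact iff_of_false (hneg p hp h).not_ge h.not_ge
    · exact iff_of_true (hz p hp h).ge h.ge
    · exact iff_of_true (hposp p hp h).le h.le
  have hpp : ∀ p ∈ Θ.source, (0 < ℓ (Θ p) ↔ 0 < p.1) := by
    intro p hp
    rcases lt_trichotomy p.1 0 with h | h | h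
    · exact iff_of_false (hneg p hp h).not_gt h.not_gt
    · exact iff_of_false (hz p hp h).le.not_gt h.le.not_gt
    · exact iff_of_true (hposp p hp h) h
  refine ⟨Θ, ⟨hstrict.mem_toOpenPartialHomeomorph_source, hS0⟩, hsrc, hΘG, hnn, hpp, hder, ?_⟩
  have hsub : Θ.source ∩ {p | 0 ≤ p.1} = Θ.source ∩ D := by
    ext p
    exact ⟨fun hp => ⟨hp.1, hmemD p hp.1 hp.2⟩, fun hp => ⟨hp.1, hp.2.1.1⟩⟩
  have hUDs : UniqueDiffOn ℝ (Θ.source ∩ {p | 0 ≤ p.1}) := by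
    rw [hsub, inter_comm]
    exact hUD.inter Θ.open_source
  have hUDt : UniqueDiffOn ℝ (Θ.target ∩ {y | 0 ≤ ℓ y}) := by
    rw [inter_comm]
    refine UniqueDiffOn.inter (uniqueDiffOn_convex
      (convex_halfSpace_ge ℓ.toLinearMap.isLinear 0) ?_) Θ.open_target
    refine ⟨A' (1, 0), mem_interior.2 ⟨{y | 0 < ℓ y},
      fun y (hy : 0 < ℓ y) => show 0 ≤ ℓ y from hy.le,
      isOpen_lt continuous_const ℓ.continuous, hc⟩⟩
  refine contDiffOn_of_rightInverse (f := G) hUDs hUDt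
    (hG.mono (by rw [hsub]; exact inter_subset_right)) (Θ.continuousOn_symm.mono inter_subset_left)
    ?_ ?_ ?_
  · intro y hy
    have := Θ.map_target hy.1
    refine ⟨this, ?_⟩
    rw [mem_ofPred_eq, ← hnn _ this, Θ.right_inv hy.1]
    exact hy.2
  · intro y hy
    have h1 := Θ.map_target hy.1
    have h2 : 0 ≤ (Θ.symm y).1 := by
      rw [← hnn _ h1, Θ.right_inv hy.1]
      exact hy.2
    rw [← hΘG _ h1 h2, Θ.right_inv hy.1]
  · intro p hp
    have h1 : fderivWithin ℝ G (Θ.source ∩ {p | 0 ≤ p.1}) p = fderivWithin ℝ G D p := by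
      rw [hsub, inter_comm]
      exact fderivWithin_inter (Θ.open_source.mem_nhds hp.1)
    rw [h1]
    exact hder p hp.1 hp.2

end HalfSpace

/-! ### Linear algebra of `α ∧ τ ^ m` in dimension `2 m + 1`. -/

section Wedge

variable {V : Type*} [AddCommGroup V] [Module ℝ V] {m : ℕ}

lemma exists_pairing_index (j : Fin (2 * m + 1)) : j = 0 ∨
    (∃ i : Fin m, j = ⟨2 * i + 1, by omega⟩) ∨ ∃ i : Fin m, j = ⟨2 * i + 2, by omega⟩ := by
  obtain ⟨j, hj⟩ := j
  rcases Nat.eq_zero_or_pos j with h | h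
  · exact Or.inl (Fin.ext h)
  · right
    rcases Nat.even_or_odd j with ⟨k, hk⟩ | ⟨k, hk⟩
    · exact Or.inr ⟨⟨k - 1, by omega⟩, Fin.ext (by simp; omega)⟩
    · exact Or.inl ⟨⟨k, by omega⟩, Fin.ext (by simp; omega)⟩

/-- The multilinear function `α (v 0) * ∏ B (v (2 i + 1)) (v (2 i + 2))`. -/
def pairingProd (m : ℕ) (α : V →ₗ[ℝ] ℝ) (B : V →ₗ[ℝ] V →ₗ[ℝ] ℝ) (v : Fin (2 * m + 1) → V) : ℝ :=
  α (v 0) * ∏ i : Fin m, B (v ⟨2 * i + 1, by omega⟩) (v ⟨2 * i + 2, by omega⟩)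

/-- Every index occurs in exactly one factor, by `exists_pairing_index`, so freezing the others
leaves a linear function. This is what makes `pairingProd` multilinear. -/
lemma exists_linear_pairingProd (α : V →ₗ[ℝ] ℝ) (B : V →ₗ[ℝ] V →ₗ[ℝ] ℝ)
    (v : Fin (2 * m + 1) → V) (j : Fin (2 * m + 1)) :
    ∃ L : V →ₗ[ℝ] ℝ, ∀ x, pairingProd m α B (Function.update v j x) = L x := by
  classical
  rcases exists_pairing_index j with rfl | ⟨i, rfl⟩ | ⟨i, rfl⟩
  · refine ⟨(∏ i : Fin m, B (v ⟨2 * i + 1, by omega⟩) (v ⟨2 * i + 2, by omega⟩)) • α, fun x => ?_⟩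
    have h (k : ℕ) (hk : k + 1 < 2 * m + 1) :
        Function.update v 0 x ⟨k + 1, hk⟩ = v ⟨k + 1, hk⟩ :=
      Function.update_of_ne (fun h => by simpa using congrArg Fin.val h) _ _
    simp [pairingProd, mul_comm]
  · refine ⟨(α (v 0) * ∏ k ∈ Finset.univ.erase i,
      B (v ⟨2 * k + 1, by omega⟩) (v ⟨2 * k + 2, by omega⟩)) • (B.flip (v ⟨2 * i + 2, by omega⟩)),
      fun x => ?_⟩
    have h (k : ℕ) (hk : k < 2 * m + 1) (hne : k ≠ 2 * i + 1) :
        Function.update v ⟨2 * i + 1, by omega⟩ x ⟨k, hk⟩ = v ⟨k, hk⟩ :=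
      Function.update_of_ne (fun h => hne (congrArg Fin.val h)) _ _
    have h0 : Function.update v ⟨2 * i + 1, by omega⟩ x 0 = v 0 := h 0 (by omega) (by omega)
    rw [pairingProd, ← Finset.mul_prod_erase _ _ (Finset.mem_univ i), h0, Function.update_self,
      h _ _ (by omega), Finset.prod_congr rfl fun k hk => by
        have : (k : ℕ) ≠ i := fun h => (Finset.mem_erase.1 hk).1 (Fin.ext h)
        rw [h _ _ (by omega), h _ _ (by omega)]]
    simp
    ring
  · refine ⟨(α (v 0) * ∏ k ∈ Finset.univ.erase i,
      B (v ⟨2 * k + 1, by omega⟩) (v ⟨2 * k + 2, by omega⟩)) • (B (v ⟨2 * i + 1, by omega⟩)),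
      fun x => ?_⟩
    have h (k : ℕ) (hk : k < 2 * m + 1) (hne : k ≠ 2 * i + 2) :
        Function.update v ⟨2 * i + 2, by omega⟩ x ⟨k, hk⟩ = v ⟨k, hk⟩ :=
      Function.update_of_ne (fun h => hne (congrArg Fin.val h)) _ _
    have h0 : Function.update v ⟨2 * i + 2, by omega⟩ x 0 = v 0 := h 0 (by omega) (by omega)
    rw [pairingProd, ← Finset.mul_prod_erase _ _ (Finset.mem_univ i), h0, Function.update_self,
      h _ _ (by omega), Finset.prod_congr rfl fun k hk => by
        have : (k : ℕ) ≠ i := fun h => (Finset.mem_erase.1 hk).1 (Fin.ext h)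
        rw [h _ _ (by omega), h _ _ (by omega)]]
    simp
    ring

/-- `pairingProd` as a multilinear map. -/
def pairingMultilinear (m : ℕ) (α : V →ₗ[ℝ] ℝ) (B : V →ₗ[ℝ] V →ₗ[ℝ] ℝ) :
    MultilinearMap ℝ (fun _ : Fin (2 * m + 1) => V) ℝ :=
  MultilinearMap.mk' (pairingProd m α B)
    (fun v j x y => by
      obtain ⟨L, hL⟩ := exists_linear_pairingProd α B v j
      simp only [hL, map_add])
    (fun v j c x => by
      obtain ⟨L, hL⟩ := exists_linear_pairingProd α B v j
      simp only [hL, map_smul])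

/-- If the vector in position `0` is not `v l`, the factor `α` vanishes. If it is, all the paired
vectors lie in the kernel of `α`, and the pair containing `z` contributes `±g * α w = 0`; and if `z`
itself sits in position `0`, then `α z = 0`. -/
lemma pairingProd_eq_zero (α : V →ₗ[ℝ] ℝ) (B : V →ₗ[ℝ] V →ₗ[ℝ] ℝ) (hB : ∀ x, B x x = 0)
    {z : V} {g : ℝ} (hz : α z = 0) (hzB : ∀ w, B z w = g * α w) (v : Fin (2 * m + 1) → V)
    (k : Fin (2 * m + 1)) (hk : v k = z) (l : Fin (2 * m + 1)) (hl : ∀ j, j ≠ l → α (v j) = 0)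
    (σ : Equiv.Perm (Fin (2 * m + 1))) : pairingProd m α B (fun i => v (σ i)) = 0 := by
  have hanti : ∀ x y, B x y = -B y x := by
    intro x y
    have := hB (x + y)
    simp only [map_add, LinearMap.add_apply, hB, zero_add, add_zero] at this
    linarith
  by_cases h0 : σ 0 = l
  · have hα : ∀ j, j ≠ 0 → α (v (σ j)) = 0 := fun j hj =>
      hl _ fun h => hj (σ.injective (h.trans h0.symm))
    obtain ⟨j, rfl⟩ := σ.surjective k
    rcases exists_pairing_index j with rfl | ⟨i, rfl⟩ | ⟨i, rfl⟩
    · simp [pairingProd, hk, hz]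
    · refine mul_eq_zero_of_right _ (Finset.prod_eq_zero (Finset.mem_univ i) ?_)
      beta_reduce
      rw [hk, hzB, hα _ (fun h => by simpa using congrArg Fin.val h), mul_zero]
    · refine mul_eq_zero_of_right _ (Finset.prod_eq_zero (Finset.mem_univ i) ?_)
      beta_reduce
      rw [hk, hanti, hzB, hα _ (fun h => by simpa using congrArg Fin.val h), mul_zero, neg_zero]
  · simp [pairingProd, hl _ h0]

/-- Extend `z` and a vector `c` with `α c = 1` to a basis, then subtract from every other basis
vector its multiple `α (b j) • c`. The map `A` does this at once; it fixes `c` and `z`, and is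
injective because a vector in its kernel is a multiple of `c`. -/
lemma exists_adapted_basis [FiniteDimensional ℝ V] (hV : Module.finrank ℝ V = 2 * m + 1)
    (α : V →ₗ[ℝ] ℝ) (hα : α ≠ 0) {z : V} (hz : z ≠ 0) (hαz : α z = 0) :
    ∃ (b : Module.Basis (Fin (2 * m + 1)) ℝ V) (k l : Fin (2 * m + 1)), b k = z ∧
      ∀ j, j ≠ l → α (b j) = 0 := by
  obtain ⟨c, hc⟩ : ∃ c, α c = 1 := by
    obtain ⟨c, hc⟩ : ∃ c, α c ≠ 0 := by
      by_contra! h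
      exact hα (LinearMap.ext h)
    exact ⟨(α c)⁻¹ • c, by simp [hc]⟩
  have hlin : LinearIndependent ℝ ![z, c] := by
    rw [LinearIndependent.pair_iff]
    intro s t hst
    have h1 := congrArg α hst
    simp only [map_add, map_smul, hαz, hc, smul_eq_mul, mul_zero, zero_add, mul_one,
      map_zero] at h1
    rw [h1, zero_smul, add_zero] at hst
    exact ⟨(smul_eq_zero.1 hst).resolve_right hz, h1⟩
  let b₀ := Module.Basis.sumExtend hlin
  have : Finite (Fin 2 ⊕ Module.Basis.sumExtendIndex hlin) := Module.Finite.finite_basis b₀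
  let _ : Fintype (Fin 2 ⊕ Module.Basis.sumExtendIndex hlin) := Fintype.ofFinite _
  have hcard : Fintype.card (Fin 2 ⊕ Module.Basis.sumExtendIndex hlin) = 2 * m + 1 := by
    rw [← Module.finrank_eq_card_basis b₀, hV]
  let b₁ := b₀.reindex (Fintype.equivFinOfCardEq hcard)
  obtain ⟨k, hk⟩ : ∃ k, b₁ k = z := ⟨Fintype.equivFinOfCardEq hcard (Sum.inl 0), by
    simp [b₁, b₀, Module.Basis.sumExtend]; rfl⟩
  obtain ⟨l, hl⟩ : ∃ l, b₁ l = c := ⟨Fintype.equivFinOfCardEq hcard (Sum.inl 1), by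
    simp [b₁, b₀, Module.Basis.sumExtend]; rfl⟩
  have hkl : k ≠ l := by
    rintro rfl
    rw [hk] at hl
    rw [hl, hc] at hαz
    exact one_ne_zero hαz
  let A : V →ₗ[ℝ] V := LinearMap.id - α.smulRight c + (b₁.coord l).smulRight c
  have hA : ∀ x, A x = x - α x • c + b₁.coord l x • c := fun x => rfl
  have hAc : A c = c := by
    rw [hA, hc, ← hl, Module.Basis.coord_apply, Module.Basis.repr_self]
    simp
  have hinj : Function.Injective A := by
    rw [← LinearMap.ker_eq_bot, LinearMap.ker_eq_bot']
    intro x hx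
    have h1 : x = (α x - b₁.coord l x) • c := by
      rw [hA] at hx
      rw [sub_smul, ← sub_eq_zero, ← hx]
      abel
    rw [h1, map_smul, hAc] at hx
    rw [h1, hx]
  let e := LinearEquiv.ofInjectiveEndo A hinj
  refine ⟨b₁.map e, k, l, ?_, fun j hj => ?_⟩
  · rw [Module.Basis.map_apply, hk]
    change A z = z
    rw [hA, hαz, ← hk, Module.Basis.coord_apply, Module.Basis.repr_self,
      Finsupp.single_eq_of_ne hkl.symm]
    simp
  · rw [Module.Basis.map_apply]
    change α (A (b₁ j)) = 0
    rw [hA, Module.Basis.coord_apply, Module.Basis.repr_self, Finsupp.single_eq_of_ne hj.symm]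
    simp [hc]

variable [TopologicalSpace V]

lemma update_pair_zero (x y a : V) : Function.update ![x, y] 0 a = ![a, y] := by
  ext i; fin_cases i <;> simp

lemma update_pair_one (x y a : V) : Function.update ![x, y] 1 a = ![x, a] := by
  ext i; fin_cases i <;> simp

lemma update_single (x a : V) : Function.update ![x] 0 a = ![a] := by
  ext i; fin_cases i; simp

/-- The bilinear map given by an alternating form of degree two. -/
def bilinOfAlternating (τ : V [⋀^Fin 2]→L[ℝ] ℝ) : V →ₗ[ℝ] V →ₗ[ℝ] ℝ :=
  LinearMap.mk₂ ℝ (fun x y => τ ![x, y])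
    (fun x x' y => by
      have h := τ.map_update_add ![x, y] 0 x x'
      rwa [update_pair_zero, update_pair_zero, update_pair_zero] at h)
    (fun c x y => by
      have h := τ.map_update_smul ![x, y] 0 c x
      rwa [update_pair_zero, update_pair_zero] at h)
    (fun x y y' => by
      have h := τ.map_update_add ![x, y] 1 y y'
      rwa [update_pair_one, update_pair_one, update_pair_one] at h)
    (fun c x y => by
      have h := τ.map_update_smul ![x, y] 1 c y
      rwa [update_pair_one, update_pair_one] at h)

/-- The linear map given by an alternating form of degree one. -/
def linOfAlternating (α : V [⋀^Fin 1]→L[ℝ] ℝ) : V →ₗ[ℝ] ℝ where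
  toFun x := α ![x]
  map_add' x x' := by
    have h := α.map_update_add ![x] 0 x x'
    rwa [update_single, update_single, update_single] at h
  map_smul' c x := by
    have h := α.map_update_smul ![x] 0 c x
    rwa [update_single, update_single] at h

lemma wedgePow_eq (α : V [⋀^Fin 1]→L[ℝ] ℝ) (τ : V [⋀^Fin 2]→L[ℝ] ℝ)
    (v : Fin (2 * m + 1) → V) : wedgePow m α τ v = ((2 : ℝ) ^ m)⁻¹ *
      MultilinearMap.alternatization
        (pairingMultilinear m (linOfAlternating α) (bilinOfAlternating τ)) v := by
  rw [MultilinearMap.alternatization_apply, wedgePow]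
  congr 1
  refine Finset.sum_congr rfl fun σ _ => ?_
  rw [Units.smul_def, zsmul_eq_mul]
  rfl

variable [FiniteDimensional ℝ V]

/-- A covector `α` with `α ∧ τ ^ m ≠ 0` is nonzero, and `τ` is nondegenerate on its kernel. -/
theorem eq_zero_of_wedgePow_ne_zero (hV : Module.finrank ℝ V = 2 * m + 1)
    {α : V [⋀^Fin 1]→L[ℝ] ℝ} {τ : V [⋀^Fin 2]→L[ℝ] ℝ} {v : Fin (2 * m + 1) → V}
    (hv : wedgePow m α τ v ≠ 0) {z : V} {g : ℝ} (hz : α ![z] = 0)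
    (hzτ : ∀ w, τ ![z, w] = g * α ![w]) : z = 0 := by
  by_contra hz0
  have hα : linOfAlternating α ≠ 0 := by
    intro h
    refine hv (mul_eq_zero_of_right _ (Finset.sum_eq_zero fun σ _ => ?_))
    have : α ![v (σ 0)] = 0 := congrArg (fun L : V →ₗ[ℝ] ℝ => L (v (σ 0))) h
    rw [this]
    simp
  obtain ⟨b, k, l, hk, hl⟩ := exists_adapted_basis hV (linOfAlternating α) hα hz0 hz
  refine hv ?_
  -- The form has top degree, hence is a multiple of the determinant of the adapted basis. It
  -- suffices that its value on that basis is zero, which holds term by term.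
  rw [wedgePow_eq, (MultilinearMap.alternatization (pairingMultilinear m (linOfAlternating α)
    (bilinOfAlternating τ))).eq_smul_basis_det b]
  have : MultilinearMap.alternatization
        (pairingMultilinear m (linOfAlternating α) (bilinOfAlternating τ)) b = 0 := by
    rw [MultilinearMap.alternatization_apply]
    refine Finset.sum_eq_zero fun σ _ => ?_
    have : (pairingMultilinear m (linOfAlternating α) (bilinOfAlternating τ)).domDomCongr σ b = 0 :=
      pairingProd_eq_zero _ _
        (fun x => τ.map_eq_zero_of_eq ![x, x] (i := 0) (j := 1) rfl (by simp)) hz hzτ b k hk l hl σ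
    rw [this, smul_zero]
  rw [this]
  simp

lemma exists_ne_zero_of_wedgePow_ne_zero {α : V [⋀^Fin 1]→L[ℝ] ℝ} {τ : V [⋀^Fin 2]→L[ℝ] ℝ}
    {v : Fin (2 * m + 1) → V} (hv : wedgePow m α τ v ≠ 0) : ∃ w, α ![w] ≠ 0 := by
  by_contra! h
  refine hv (mul_eq_zero_of_right _ (Finset.sum_eq_zero fun σ _ => ?_))
  rw [h]
  simp

end Wedge

/-! ### Pullbacks of covector fields and the exterior derivative. -/

section PullbackDerivative

variable {A Y : Type*} [NormedAddCommGroup A] [NormedSpace ℝ A]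
  [NormedAddCommGroup Y] [NormedSpace ℝ Y]

/-- The derivative of the pullback of a covector field. -/
lemma hasFDerivAt_pullback {W : A → Y} {β : Y → Y →L[ℝ] ℝ} {u : A}
    (hW : ContDiffAt ℝ 2 W u) (hβ : DifferentiableAt ℝ β (W u)) :
    DifferentiableAt ℝ (fun p => (β (W p)).comp (fderiv ℝ W p)) u ∧ ∀ v w,
    fderiv ℝ (fun p => (β (W p)).comp (fderiv ℝ W p)) u v w =
      β (W u) (fderiv ℝ (fderiv ℝ W) u v w) +
        fderiv ℝ β (W u) (fderiv ℝ W u v) (fderiv ℝ W u w) := by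
  have h1 : HasFDerivAt (fderiv ℝ W) (fderiv ℝ (fderiv ℝ W) u) u :=
    ((hW.fderiv_right (m := 1) (by norm_num)).differentiableAt one_ne_zero).hasFDerivAt
  have h2 : HasFDerivAt (fun p => β (W p)) ((fderiv ℝ β (W u)).comp (fderiv ℝ W u)) u :=
    hβ.hasFDerivAt.comp u (hW.differentiableAt two_ne_zero).hasFDerivAt
  have h3 := h2.clm_comp h1
  refine ⟨h3.differentiableAt, fun v w => ?_⟩
  rw [h3.fderiv]
  simp

/-- Pullback commutes with the exterior derivative. -/
lemma fderiv_pullback_sub {W : A → Y} {β : Y → Y →L[ℝ] ℝ} {u : A}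
    (hW : ContDiffAt ℝ 2 W u) (hβ : DifferentiableAt ℝ β (W u)) (v w : A) :
    fderiv ℝ (fun p => (β (W p)).comp (fderiv ℝ W p)) u v w -
      fderiv ℝ (fun p => (β (W p)).comp (fderiv ℝ W p)) u w v =
    fderiv ℝ β (W u) (fderiv ℝ W u v) (fderiv ℝ W u w) -
      fderiv ℝ β (W u) (fderiv ℝ W u w) (fderiv ℝ W u v) := by
  have h := hW.isSymmSndFDerivAt (by rw [minSmoothness_of_isRCLikeNormedField]) v w
  rw [(hasFDerivAt_pullback hW hβ).2, (hasFDerivAt_pullback hW hβ).2, h]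
  ring

/-- If a direction `e` is in the kernel of the pullback of a covector field, then the derivative
of the pullback in the direction `e` is the contraction of the exterior derivative. -/
lemma fderiv_pullback_of_eventually_eq_zero {W : A → Y} {β : Y → Y →L[ℝ] ℝ} {u : A}
    (hW : ContDiffAt ℝ 2 W u) (hβ : DifferentiableAt ℝ β (W u)) {e : A}
    (he : ∀ᶠ p in 𝓝 u, β (W p) (fderiv ℝ W p e) = 0) (w : A) :
    fderiv ℝ (fun p => (β (W p)).comp (fderiv ℝ W p)) u e w =
    fderiv ℝ β (W u) (fderiv ℝ W u e) (fderiv ℝ W u w) -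
      fderiv ℝ β (W u) (fderiv ℝ W u w) (fderiv ℝ W u e) := by
  rw [← fderiv_pullback_sub hW hβ]
  have h1 := (hasFDerivAt_pullback hW hβ).1.hasFDerivAt
  have h2 : HasFDerivAt (fun p => ((β (W p)).comp (fderiv ℝ W p)) e)
      ((fderiv ℝ (fun p => (β (W p)).comp (fderiv ℝ W p)) u).flip e) u := by
    simpa using h1.clm_apply (hasFDerivAt_const e u)
  -- The pullback evaluated on the constant vector `e` vanishes near `u`, so one of the two terms of
  -- its exterior derivative drops out.
  have h3 : HasFDerivAt (fun p => ((β (W p)).comp (fderiv ℝ W p)) e) (0 : A →L[ℝ] ℝ) u :=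
    (hasFDerivAt_const (0 : ℝ) u).congr_of_eventuallyEq he
  have h4 := congrArg (fun L => L w) (h2.unique h3)
  simp only [ContinuousLinearMap.flip_apply, zero_apply] at h4
  rw [h4, sub_zero]

end PullbackDerivative

/-! ### The contact condition as invertibility of an operator. -/

section ContactOp

variable {X : Type*} [NormedAddCommGroup X] [NormedSpace ℝ X]

/-- The operator `(z, g) ↦ (ι_z d - g a, a z)` attached to a covector `a` and to the derivative `d`
of a field of covectors. -/
def contactOp (a : X →L[ℝ] ℝ) (d : X →L[ℝ] X →L[ℝ] ℝ) : (X × ℝ) →L[ℝ] (X →L[ℝ] ℝ) × ℝ :=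
  ((d - d.flip).comp (ContinuousLinearMap.fst ℝ X ℝ) -
    (ContinuousLinearMap.snd ℝ X ℝ).smulRight a).prod (a.comp (ContinuousLinearMap.fst ℝ X ℝ))

lemma contactOp_apply (a : X →L[ℝ] ℝ) (d : X →L[ℝ] X →L[ℝ] ℝ) (z : X) (g : ℝ) :
    contactOp a d (z, g) = (d z - d.flip z - g • a, a z) := by
  simp [contactOp]

lemma contactOp_eq_iff {a : X →L[ℝ] ℝ} {d : X →L[ℝ] X →L[ℝ] ℝ} {z : X} {g : ℝ}
    {L : X →L[ℝ] ℝ} {c : ℝ} :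
    contactOp a d (z, g) = (L, c) ↔ (∀ w, d z w - d w z - g * a w = L w) ∧ a z = c := by
  rw [contactOp_apply, Prod.mk.injEq]
  refine and_congr_left fun _ => ⟨fun h w => ?_, fun h => ?_⟩
  · simpa using congrArg (fun T => T w) h
  · ext w
    simpa using h w

lemma contDiffOn_contactOp [FiniteDimensional ℝ X] {P : Type*} [NormedAddCommGroup P]
    [NormedSpace ℝ P] {a : P → X →L[ℝ] ℝ} {d : P → X →L[ℝ] X →L[ℝ] ℝ} {s : Set P}
    {n : WithTop ℕ∞} (ha : ContDiffOn ℝ n a s) (hd : ContDiffOn ℝ n d s) :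
    ContDiffOn ℝ n (fun p => contactOp (a p) (d p)) s := by
  rw [contDiffOn_clm_apply]
  rintro ⟨z, g⟩
  simp only [contactOp_apply]
  have hf : ContDiffOn ℝ n (fun p => (d p).flip) s := by
    rw [contDiffOn_clm_apply]
    intro z
    rw [contDiffOn_clm_apply]
    exact fun w => (hd.clm_apply contDiffOn_const).clm_apply contDiffOn_const
  exact (((hd.clm_apply contDiffOn_const).sub (hf.clm_apply contDiffOn_const)).sub
    ((contDiffOn_const (c := g)).smul ha)).prodMk (ha.clm_apply contDiffOn_const)

lemma exists_apply_eq_one_of_contactOp {a : X →L[ℝ] ℝ} {d : X →L[ℝ] X →L[ℝ] ℝ}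
    (h : (contactOp a d).IsInvertible) : ∃ z, a z = 1 := by
  obtain ⟨e, he⟩ := h
  obtain ⟨⟨z, g⟩, hz⟩ := e.surjective (0, 1)
  have h1 : contactOp a d (z, g) = (0, 1) := by
    rw [← he]; exact hz
  exact ⟨z, (contactOp_eq_iff.1 h1).2⟩

/-- The pair `(z, g)` lies in the kernel of the operator. This is how the contact condition forces a
vector field to vanish. -/
lemma eq_zero_of_contactOp {a : X →L[ℝ] ℝ} {d : X →L[ℝ] X →L[ℝ] ℝ}
    (h : (contactOp a d).IsInvertible) {z : X} {g : ℝ} (hz : a z = 0)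
    (hzd : ∀ w, d z w - d w z = g * a w) : z = 0 := by
  obtain ⟨e, he⟩ := h
  have h1 : contactOp a d (z, g) = (0, 0) :=
    contactOp_eq_iff.2 ⟨fun w => by simp [hzd], hz⟩
  rw [← he] at h1
  have h2 : ((z, g) : X × ℝ) = 0 := e.injective (h1.trans (map_zero e).symm)
  exact congrArg Prod.fst h2

/-- Source and target both have dimension `dim X + 1`, so injectivity suffices: the hypothesis kills
`z`, and then `g • a = 0` with `a ≠ 0` kills `g`. -/
lemma isInvertible_contactOp [FiniteDimensional ℝ X] {a : X →L[ℝ] ℝ} {d : X →L[ℝ] X →L[ℝ] ℝ}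
    (ha : ∃ w, a w ≠ 0)
    (h : ∀ (z : X) (g : ℝ), a z = 0 → (∀ w, d z w - d w z = g * a w) → z = 0) :
    (contactOp a d).IsInvertible := by
  have hinj : Function.Injective (contactOp a d : (X × ℝ) →ₗ[ℝ] (X →L[ℝ] ℝ) × ℝ) := by
    rw [← LinearMap.ker_eq_bot, LinearMap.ker_eq_bot']
    rintro ⟨z, g⟩ hzg
    have h1 : contactOp a d (z, g) = (0, 0) := hzg
    obtain ⟨h2, h3⟩ := contactOp_eq_iff.1 h1
    have h4 : z = 0 := h z g h3 fun w => by
      have := h2 w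
      simp only [zero_apply] at this
      linarith
    obtain ⟨w, hw⟩ := ha
    have h5 := h2 w
    simp only [h4, map_zero, zero_apply, sub_self, zero_sub, neg_eq_zero,
      mul_eq_zero, hw, or_false] at h5
    rw [h4, h5]
    rfl
  have hdim : Module.finrank ℝ (X × ℝ) = Module.finrank ℝ ((X →L[ℝ] ℝ) × ℝ) := by
    rw [Module.finrank_prod, Module.finrank_prod]
    congr 1
    rw [← (LinearMap.toContinuousLinearMap (𝕜 := ℝ) (E := X) (F' := ℝ)).finrank_eq]
    exact (Subspace.dual_finrank_eq (K := ℝ) (V := X)).symm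
  let e := (LinearEquiv.ofInjectiveOfFinrankEq _ hinj hdim).toContinuousLinearEquiv
  exact ⟨e, ContinuousLinearMap.ext fun _ => rfl⟩

lemma isOpen_isInvertible {Y Y' : Type*} [NormedAddCommGroup Y] [NormedSpace ℝ Y]
    [CompleteSpace Y] [NormedAddCommGroup Y'] [NormedSpace ℝ Y'] {A : Y →L[ℝ] Y'}
    (hA : A.IsInvertible) : ∀ᶠ B in 𝓝 A, B.IsInvertible := by
  obtain ⟨e, rfl⟩ := hA
  exact e.nhds

end ContactOp

/-! ### Local rigidity of families of contactomorphisms. -/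

section Rigidity

lemma two_le_infty : (2 : WithTop ℕ∞) ≤ ∞ := by
  exact WithTop.coe_le_coe.2 (le_top : (2 : ℕ∞) ≤ ⊤)

lemma Ico_prod_mem_nhds {X : Type*} [TopologicalSpace X] {δ : ℝ} {V : Set X} (hV : IsOpen V)
    {p : ℝ × X} (hp : p ∈ Ico 0 δ ×ˢ V) (h0 : 0 < p.1) : Ico 0 δ ×ˢ V ∈ 𝓝 p :=
  prod_mem_nhds (Ico_mem_nhds h0 hp.1.2) (hV.mem_nhds hp.2)

/-- Used for every shrinking of a collar domain: a condition valid near `(0, y₀)` within the domain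
holds on a smaller domain of the same product form. -/
lemma exists_Ico_prod_subset {X : Type*} [TopologicalSpace X] {δ : ℝ} (hδ : 0 < δ) {V : Set X}
    (hV : IsOpen V) {y₀ : X} (hy₀ : y₀ ∈ V) {P : ℝ × X → Prop}
    (hP : ∀ᶠ p in 𝓝[Ico 0 δ ×ˢ V] (0, y₀), P p) : ∃ δ', 0 < δ' ∧ δ' ≤ δ ∧ ∃ V', IsOpen V' ∧
      y₀ ∈ V' ∧ V' ⊆ V ∧ ∀ p ∈ Ico 0 δ' ×ˢ V', P p := by
  rw [eventually_nhdsWithin_iff, nhds_prod_eq, eventually_prod_iff] at hP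
  obtain ⟨pa, ha, pb, hb, h⟩ := hP
  obtain ⟨ρ, hρ, hρ'⟩ := Metric.eventually_nhds_iff.1 ha
  obtain ⟨W, hW, hWo, hyW⟩ := eventually_nhds_iff.1 hb
  refine ⟨min δ ρ, lt_min hδ hρ, min_le_left _ _, V ∩ W, hV.inter hWo, ⟨hy₀, hyW⟩,
    inter_subset_left, fun p hp => ?_⟩
  refine h (hρ' ?_) (hW _ hp.2.2) ⟨⟨hp.1.1, hp.1.2.trans_le (min_le_left _ _)⟩, hp.2.1⟩
  rw [Real.dist_eq, sub_zero, abs_of_nonneg hp.1.1]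
  exact hp.1.2.trans_le (min_le_right _ _)

variable {X : Type*} [NormedAddCommGroup X] [NormedSpace ℝ X] [FiniteDimensional ℝ X]

/-- Local rigidity of one-parameter families of contactomorphisms of the form `(r, y) ↦ θ (r, y)`
for which `θ^* a` is a multiple of `a`. -/
theorem eq_snd_of_pullback_contact {a : X → X →L[ℝ] ℝ} {U : Set X} (hU : IsOpen U)
    (ha : ContDiffOn ℝ ∞ a U) {y₀ : X} {δ : ℝ} (hδ : 0 < δ) {V : Set X} (hV : IsOpen V)
    (hy₀ : y₀ ∈ V) (hc : (contactOp (a y₀) (fderiv ℝ a y₀)).IsInvertible) {θ : ℝ × X → X}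
    (hθ : ContDiffOn ℝ ∞ θ (Ico 0 δ ×ˢ V)) (hθU : MapsTo θ (Ico 0 δ ×ˢ V) U)
    (hθ0 : ∀ y ∈ V, θ (0, y) = y) {f : ℝ × X → ℝ}
    (hf : ∀ p ∈ Ico 0 δ ×ˢ V, 0 < p.1 → ∀ v, a (θ p) (fderiv ℝ θ p v) = f p * a p.2 v.2) :
    ∃ δ', 0 < δ' ∧ δ' ≤ δ ∧ ∃ V', IsOpen V' ∧ y₀ ∈ V' ∧ V' ⊆ V ∧
      ∀ p ∈ Ico 0 δ' ×ˢ V', θ p = p.2 ∧ (0 < p.1 → f p = 1) := by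
  have := FiniteDimensional.complete ℝ X
  set D := Ico 0 δ ×ˢ V with hD
  have h0 : ((0 : ℝ), y₀) ∈ D := ⟨⟨le_rfl, hδ⟩, hy₀⟩
  have hUD : UniqueDiffOn ℝ D := uniqueDiffOn_Ico_prod hV
  have hVU : V ⊆ U := fun y hy => by
    have := hθU (show ((0 : ℝ), y) ∈ D from ⟨⟨le_rfl, hδ⟩, hy⟩)
    rwa [hθ0 y hy] at this
  have hdθ : ContinuousOn (fderivWithin ℝ θ D) D := hθ.continuousOn_fderivWithin hUD (by simp)
  have hda : ContDiffOn ℝ ∞ (fderiv ℝ a) U := ((contDiffOn_infty_iff_fderiv_of_isOpen hU).1 ha).2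
  obtain ⟨w₀, hw₀⟩ := exists_apply_eq_one_of_contactOp hc
  -- the derivative along `V` is invertible near the base point
  have hθinr : (fderivWithin ℝ θ D (0, y₀)).comp (ContinuousLinearMap.inr ℝ ℝ X) =
      ContinuousLinearMap.id ℝ X := by
    have h1 : HasFDerivWithinAt θ (fderivWithin ℝ θ D (0, y₀)) D (0, y₀) :=
      (hθ.differentiableOn (by simp) _ h0).hasFDerivWithinAt
    have h2 : HasFDerivAt (fun y => θ (0, y)) ((fderivWithin ℝ θ D (0, y₀)).comp
        (ContinuousLinearMap.inr ℝ ℝ X)) y₀ := by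
      have h3 : HasFDerivWithinAt (fun y : X => ((0 : ℝ), y))
          (ContinuousLinearMap.inr ℝ ℝ X) V y₀ :=
        (hasFDerivAt_prodMk_right 0 y₀).hasFDerivWithinAt
      exact (h1.comp y₀ h3 fun y hy => ⟨⟨le_rfl, hδ⟩, hy⟩).hasFDerivAt (hV.mem_nhds hy₀)
    have h4 : HasFDerivAt (fun y => θ (0, y)) (ContinuousLinearMap.id ℝ X) y₀ :=
      (hasFDerivAt_id y₀).congr_of_eventuallyEq (by
        filter_upwards [hV.mem_nhds hy₀] with y hy
        exact hθ0 y hy)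
    exact h2.unique h4
  have hE1 : ∀ᶠ p in 𝓝[D] ((0 : ℝ), y₀),
      ((fderivWithin ℝ θ D p).comp (ContinuousLinearMap.inr ℝ ℝ X)).IsInvertible := by
    have h1 : ContinuousWithinAt
        (fun p => (fderivWithin ℝ θ D p).comp (ContinuousLinearMap.inr ℝ ℝ X)) D (0, y₀) :=
      (hdθ _ h0).clm_comp continuousWithinAt_const
    refine h1.eventually (isOpen_isInvertible ?_)
    beta_reduce
    rw [hθinr]
    exact ⟨ContinuousLinearEquiv.refl ℝ X, rfl⟩
  have hE2 : ∀ᶠ p in 𝓝[D] ((0 : ℝ), y₀),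
      (contactOp (a (θ p)) (fderiv ℝ a (θ p))).IsInvertible := by
    have h1 : ContinuousOn (fun p => contactOp (a (θ p)) (fderiv ℝ a (θ p))) D :=
      (contDiffOn_contactOp ha hda).continuousOn.comp hθ.continuousOn hθU
    refine (h1 _ h0).eventually (isOpen_isInvertible ?_)
    beta_reduce
    rwa [hθ0 _ hy₀]
  have hE3 : ∀ᶠ p in 𝓝[D] ((0 : ℝ), y₀), a p.2 w₀ ≠ 0 := by
    have h1 : ContinuousOn (fun p : ℝ × X => a p.2 w₀) D :=
      (ha.continuousOn.comp continuousOn_snd fun p hp => hVU hp.2).clm_apply continuousOn_const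
    refine (h1 _ h0).eventually (isOpen_ne.mem_nhds ?_)
    change a y₀ w₀ ≠ 0
    rw [hw₀]
    exact one_ne_zero
  obtain ⟨δ', hδ', hδδ', V', hV', hy₀', hVV', hE⟩ :=
    exists_Ico_prod_subset hδ hV hy₀ (hE1.and (hE2.and hE3))
  have hsub : Ico 0 δ' ×ˢ V' ⊆ D := prod_mono (Ico_subset_Ico_right hδδ') hVV'
  refine ⟨δ', hδ', hδδ', V', hV', hy₀', hVV', ?_⟩
  -- the time derivative of `θ` vanishes
  have hkey : ∀ p ∈ Ico 0 δ' ×ˢ V', 0 < p.1 → fderiv ℝ θ p (1, 0) = 0 := by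
    intro p hp hp0
    obtain ⟨e1, e2, e3⟩ := hE p hp
    have hpD := hsub hp
    have hDn : D ∈ 𝓝 p := Ico_prod_mem_nhds hV hpD hp0
    have hθp : ContDiffAt ℝ 2 θ p := (hθ.contDiffAt hDn).of_le two_le_infty
    have hap : DifferentiableAt ℝ a (θ p) :=
      ((ha.contDiffAt (hU.mem_nhds (hθU hpD))).differentiableAt (by simp))
    rw [fderivWithin_of_mem_nhds hDn] at e1
    have hnear : ∀ᶠ u in 𝓝 p, u ∈ D ∧ 0 < u.1 :=
      Filter.Eventually.and hDn (continuousAt_fst.eventually (lt_mem_nhds hp0))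
    have hψ0 : ∀ᶠ u in 𝓝 p, a (θ u) (fderiv ℝ θ u (1, 0)) = 0 := by
      filter_upwards [hnear] with u hu
      simpa using hf u hu.1 hu.2 (1, 0)
    have hψ := fderiv_pullback_of_eventually_eq_zero hθp hap hψ0
    set κ := fun u => (a (θ u)).comp (fderiv ℝ θ u) with hκ
    have hκd : HasFDerivAt κ (fderiv ℝ κ p) p := (hasFDerivAt_pullback hθp hap).1.hasFDerivAt
    -- the pullback stays proportional
    have hprop : ∀ w, fderiv ℝ κ p (1, 0) (0, w) * a p.2 w₀ =
        fderiv ℝ κ p (1, 0) (0, w₀) * a p.2 w := by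
      intro w
      have h1 : HasDerivAt (fun r => κ (r, p.2)) (fderiv ℝ κ p (1, 0)) p.1 := by
        have h2 : HasDerivAt (fun r : ℝ => (r, p.2)) ((1 : ℝ), (0 : X)) p.1 :=
          (hasDerivAt_id p.1).prodMk (hasDerivAt_const _ _)
        exact hκd.comp_hasDerivAt p.1 h2
      have h3 : ∀ w, HasDerivAt (fun r => κ (r, p.2) (0, w)) (fderiv ℝ κ p (1, 0) (0, w)) p.1 := by
        intro w
        simpa using h1.clm_apply (hasDerivAt_const p.1 ((0 : ℝ), w))
      have h4 : HasDerivAt (fun r => κ (r, p.2) (0, w) * a p.2 w₀ - κ (r, p.2) (0, w₀) * a p.2 w)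
          (fderiv ℝ κ p (1, 0) (0, w) * a p.2 w₀ - fderiv ℝ κ p (1, 0) (0, w₀) * a p.2 w) p.1 :=
        ((h3 w).mul_const _).sub ((h3 w₀).mul_const _)
      have h5 : HasDerivAt (fun r => κ (r, p.2) (0, w) * a p.2 w₀ - κ (r, p.2) (0, w₀) * a p.2 w)
          0 p.1 := by
        refine (hasDerivAt_const p.1 (0 : ℝ)).congr_of_eventuallyEq ?_
        have h6 : ∀ᶠ r in 𝓝 p.1, (r, p.2) ∈ D ∧ 0 < r :=
          (Continuous.prodMk continuous_id continuous_const).continuousAt.eventually hnear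
        filter_upwards [h6] with r hr
        simp only [hκ, ContinuousLinearMap.comp_apply]
        rw [hf _ hr.1 hr.2, hf _ hr.1 hr.2]
        ring
      exact sub_eq_zero.1 (h4.unique h5)
    -- If `f p = 0`, then `a (θ p)` would vanish on the range of the slice derivative, which is
    -- everything.
    have hf0 : f p ≠ 0 := by
      intro h
      obtain ⟨z, hz⟩ := exists_apply_eq_one_of_contactOp e2
      obtain ⟨A, hA⟩ := e1
      obtain ⟨w, rfl⟩ := A.surjective z
      have h1 : A w = fderiv ℝ θ p (0, w) := congrArg (fun L => L w) hA
      rw [h1, hf p hpD hp0, h, zero_mul] at hz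
      exact zero_ne_one hz
    -- Every vector is `dθ (0, w)`, and `a` takes on it the value `f p * a p.2 w`. By
    -- proportionality its contraction with `∂θ/∂r` is `a p.2 w` times the ratio at `w₀`; dividing
    -- by `f p` gives the factor `g`.
    refine eq_zero_of_contactOp e2 (g := fderiv ℝ κ p (1, 0) (0, w₀) / (a p.2 w₀ * f p))
      hψ0.self_of_nhds fun w' => ?_
    obtain ⟨A, hA⟩ := e1
    obtain ⟨w, rfl⟩ := A.surjective w'
    have h1 : A w = fderiv ℝ θ p (0, w) := congrArg (fun L => L w) hA
    rw [h1, ← hψ, hf p hpD hp0, div_mul_eq_mul_div, eq_div_iff (mul_ne_zero e3 hf0), ← mul_assoc,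
      hprop]
    ring
  have hconst : ∀ p ∈ Ico 0 δ' ×ˢ V', θ p = p.2 := by
    rintro ⟨r, y⟩ ⟨hr, hy⟩
    have h1 : ∀ t ∈ Icc 0 r, (fun t => θ (t, y)) t = (fun t => θ (t, y)) 0 := by
      have hin : ∀ t ∈ Icc 0 r, (t, y) ∈ Ico 0 δ' ×ˢ V' := fun t ht =>
        ⟨⟨ht.1, ht.2.trans_lt hr.2⟩, hy⟩
      have hcont : ContinuousOn (fun t => θ (t, y)) (Icc 0 r) :=
        hθ.continuousOn.comp (by fun_prop) fun t ht => hsub (hin t ht)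
      have hder : ∀ t ∈ Ioo 0 r, HasDerivAt (fun t => θ (t, y)) 0 t := by
        intro t ht
        have hp := hin t (Ioo_subset_Icc_self ht)
        have h2 : HasFDerivAt θ (fderiv ℝ θ (t, y)) (t, y) :=
          ((hθ.contDiffAt (Ico_prod_mem_nhds hV (hsub hp) ht.1)).differentiableAt
            (by simp)).hasFDerivAt
        have h3 : HasDerivAt (fun r : ℝ => (r, y)) ((1 : ℝ), (0 : X)) t :=
          (hasDerivAt_id t).prodMk (hasDerivAt_const _ _)
        have h4 := h2.comp_hasDerivAt t h3
        rwa [hkey _ hp ht.1] at h4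
      intro t ht
      by_contra hne
      -- A norming functional reduces the claim to the scalar mean value theorem, which needs only
      -- continuity at `t = 0`.
      obtain ⟨g, -, hg⟩ := exists_dual_vector'' ℝ (θ (t, y) - θ (0, y))
      have hcg : ContinuousOn (fun t => g (θ (t, y))) (Icc 0 t) :=
        g.continuous.comp_continuousOn (hcont.mono (Icc_subset_Icc_right ht.2))
      have htpos : 0 < t := lt_of_le_of_ne ht.1 fun h => hne (by rw [← h])
      obtain ⟨c, hc, hc'⟩ := exists_hasDerivAt_eq_slope (fun t => g (θ (t, y))) (fun _ => 0) htpos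
        hcg fun x hx => by
          rw [← map_zero g]
          exact g.hasFDerivAt.comp_hasDerivAt x (hder x ⟨hx.1, hx.2.trans_le ht.2⟩)
      rw [sub_zero, eq_div_iff htpos.ne', zero_mul] at hc'
      rw [map_sub, ← hc'] at hg
      have : ‖θ (t, y) - θ (0, y)‖ = 0 := by exact_mod_cast hg.symm
      exact hne (sub_eq_zero.1 (norm_eq_zero.1 this))
    have h2 := h1 r ⟨hr.1, le_rfl⟩
    simp only at h2
    rw [h2, hθ0 y (hVV' hy)]
  intro p hp
  refine ⟨hconst p hp, fun hp0 => ?_⟩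
  have h1 : θ =ᶠ[𝓝 p] Prod.snd := by
    filter_upwards [Ico_prod_mem_nhds hV' hp hp0] with q hq
    exact hconst q hq
  have h2 := hf p (hsub hp) hp0 (0, w₀)
  rw [h1.fderiv_eq, hconst p hp, fderiv_snd] at h2
  simp only [ContinuousLinearMap.coe_snd'] at h2
  exact (mul_right_cancel₀ (hE p hp).2.2 (by rw [one_mul]; exact h2)).symm

end Rigidity

/-! ### The characteristic field and its flow. -/

section ContactFlow

variable {X : Type*} [NormedAddCommGroup X] [NormedSpace ℝ X] [FiniteDimensional ℝ X]

/-- The characteristic direction of a covector field on `[0, ε) × U` inducing contact forms on the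
slices: there is a smooth vector field `(1, Z)` in the kernel of `β` whose contraction with `dβ` is
a multiple of `β` on the slices. -/
lemma exists_characteristic_field {β : ℝ × X → ℝ × X →L[ℝ] ℝ} {ε : ℝ} (hε : 0 < ε) {U : Set X}
    (hU : IsOpen U) {y₀ : X} (hy₀ : y₀ ∈ U) (hβ : ContDiffOn ℝ ∞ β (Ico 0 ε ×ˢ U))
    (hc : (contactOp ((β (0, y₀)).comp (ContinuousLinearMap.inr ℝ ℝ X))
      (fderiv ℝ (fun y => (β (0, y)).comp (ContinuousLinearMap.inr ℝ ℝ X)) y₀)).IsInvertible) :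
    ∃ δ, 0 < δ ∧ δ ≤ ε ∧ ∃ V, IsOpen V ∧ y₀ ∈ V ∧ V ⊆ U ∧ ∃ (Z : ℝ × X → X) (g : ℝ × X → ℝ),
      ContDiffOn ℝ ∞ Z (Ico 0 δ ×ˢ V) ∧ ContDiffOn ℝ ∞ g (Ico 0 δ ×ˢ V) ∧
      ∀ p ∈ Ico 0 δ ×ˢ V, β p (1, Z p) = 0 ∧ ∀ w : X,
        fderivWithin ℝ β (Ico 0 ε ×ˢ U) p (1, Z p) (0, w) -
          fderivWithin ℝ β (Ico 0 ε ×ˢ U) p (0, w) (1, Z p) = g p * β p (0, w) := by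
  have := FiniteDimensional.complete ℝ X
  set D := Ico 0 ε ×ˢ U with hD
  have h0 : ((0 : ℝ), y₀) ∈ D := ⟨⟨le_rfl, hε⟩, hy₀⟩
  have hUD : UniqueDiffOn ℝ D := uniqueDiffOn_Ico_prod hU
  set inr := ContinuousLinearMap.inr ℝ ℝ X with hinr
  set b : ℝ × X → X →L[ℝ] ℝ := fun p => (β p).comp inr with hb
  have hbs : ContDiffOn ℝ ∞ b D := hβ.clm_comp contDiffOn_const
  have hβ' : ContDiffOn ℝ ∞ (fderivWithin ℝ β D) D :=
    ((contDiffOn_infty_iff_fderivWithin hUD).1 hβ).2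
  have hb' : ContDiffOn ℝ ∞ (fderivWithin ℝ b D) D :=
    ((contDiffOn_infty_iff_fderivWithin hUD).1 hbs).2
  have hbβ : ∀ p ∈ D, ∀ v w, fderivWithin ℝ b D p v w = fderivWithin ℝ β D p v (0, w) := by
    intro p hp v w
    have h1 : HasFDerivWithinAt β (fderivWithin ℝ β D p) D p :=
      (hβ.differentiableOn (by simp) _ hp).hasFDerivWithinAt
    have h2 := h1.clm_comp (hasFDerivWithinAt_const inr p D)
    rw [h2.fderivWithin (hUD p hp)]
    simp [hinr]
  set d : ℝ × X → X →L[ℝ] X →L[ℝ] ℝ := fun p => (fderivWithin ℝ b D p).comp inr with hd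
  have hds : ContDiffOn ℝ ∞ d D := hb'.clm_comp contDiffOn_const
  have hd0 : fderiv ℝ (fun y => b (0, y)) y₀ = d (0, y₀) := by
    have h1 : HasFDerivWithinAt b (fderivWithin ℝ b D (0, y₀)) D (0, y₀) :=
      (hbs.differentiableOn (by simp) _ h0).hasFDerivWithinAt
    have h3 : HasFDerivWithinAt (fun y : X => ((0 : ℝ), y)) inr U y₀ :=
      (hasFDerivAt_prodMk_right 0 y₀).hasFDerivWithinAt
    exact ((h1.comp y₀ h3 fun y hy => ⟨⟨le_rfl, hε⟩, hy⟩).hasFDerivAt (hU.mem_nhds hy₀)).fderiv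
  set L := fun p => contactOp (b p) (d p) with hL
  have hLs : ContDiffOn ℝ ∞ L D := contDiffOn_contactOp hbs hds
  have hL0 : (L (0, y₀)).IsInvertible := by
    simp only [hL]
    rw [← hd0]
    exact hc
  obtain ⟨δ, hδ, hδε, V, hV, hyV, hVU, hE⟩ := exists_Ico_prod_subset hε hU hy₀
    ((hLs.continuousOn _ h0).eventually (isOpen_isInvertible hL0))
  have hsub : Ico 0 δ ×ˢ V ⊆ D := prod_mono (Ico_subset_Ico_right hδε) hVU
  -- Splitting `(1, Z) = (1, 0) + (0, Z)` and moving the known part to the right turns the two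
  -- conditions on `(Z, g)` into one linear equation for `contactOp`.
  set rhs : ℝ × X → (X →L[ℝ] ℝ) × ℝ := fun p =>
    (((fderivWithin ℝ β D p).flip (1, 0)).comp inr - (fderivWithin ℝ β D p (1, 0)).comp inr,
      -β p (1, 0)) with hrhs
  have hrs : ContDiffOn ℝ ∞ rhs D := by
    refine ContDiffOn.prodMk ?_ (hβ.clm_apply contDiffOn_const).neg
    rw [contDiffOn_clm_apply]
    intro w
    simp only [sub_apply, ContinuousLinearMap.comp_apply, ContinuousLinearMap.flip_apply]
    exact ((hβ'.clm_apply contDiffOn_const).clm_apply contDiffOn_const).sub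
      ((hβ'.clm_apply contDiffOn_const).clm_apply contDiffOn_const)
  set S := fun p => (L p).inverse (rhs p) with hS
  have hSs : ContDiffOn ℝ ∞ S (Ico 0 δ ×ˢ V) := by
    intro p hp
    obtain ⟨A, hA⟩ := hE p hp
    have h2 : ContDiffAt ℝ ∞ (ContinuousLinearMap.inverse :
        ((X × ℝ) →L[ℝ] (X →L[ℝ] ℝ) × ℝ) → _) (L p) := by
      rw [← hA]; exact contDiffAt_map_inverse A
    exact (h2.comp_contDiffWithinAt p ((hLs.mono hsub) p hp)).clm_apply ((hrs.mono hsub) p hp)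
  refine ⟨δ, hδ, hδε, V, hV, hyV, hVU, fun p => (S p).1, fun p => (S p).2, hSs.fst, hSs.snd,
    fun p hp => ?_⟩
  have h1 : contactOp (b p) (d p) ((S p).1, (S p).2) = rhs p := by
    obtain ⟨A, hA⟩ := hE p hp
    have h2 : S p = A.symm (rhs p) := by
      simp only [hS]
      rw [← hA, ContinuousLinearMap.inverse_equiv]
      rfl
    have h3 : L p (S p) = rhs p := by
      rw [h2, ← hA]
      exact A.apply_symm_apply _
    exact h3
  rw [hrhs, contactOp_eq_iff] at h1
  obtain ⟨h2, h3⟩ := h1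
  have hsplit : ((1 : ℝ), (S p).1) = (1, 0) + (0, (S p).1) := by simp
  refine ⟨?_, fun w => ?_⟩
  · rw [hsplit, map_add]
    have h4 : β p (0, (S p).1) = -β p (1, 0) := h3
    rw [h4, add_neg_cancel]
  · have h4 := h2 w
    simp only [hd, ContinuousLinearMap.comp_apply, hinr, ContinuousLinearMap.inr_apply,
      sub_apply, ContinuousLinearMap.flip_apply, hbβ p (hsub hp)] at h4
    rw [hsplit, map_add, map_add, add_apply]
    have h5 : b p w = β p (0, w) := rfl
    rw [h5] at h4
    linarith

/-- The flow of the characteristic field straightens a covector field on `[0, ε) × U` which induces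
contact forms on the slices. -/
theorem exists_contact_flow {β : ℝ × X → ℝ × X →L[ℝ] ℝ} {ε : ℝ} (hε : 0 < ε) {U : Set X}
    (hU : IsOpen U) {y₀ : X} (hy₀ : y₀ ∈ U) (hβ : ContDiffOn ℝ ∞ β (Ico 0 ε ×ˢ U))
    (hc : (contactOp ((β (0, y₀)).comp (ContinuousLinearMap.inr ℝ ℝ X))
      (fderiv ℝ (fun y => (β (0, y)).comp (ContinuousLinearMap.inr ℝ ℝ X)) y₀)).IsInvertible) :
    ∃ δ, 0 < δ ∧ δ ≤ ε ∧ ∃ V, IsOpen V ∧ y₀ ∈ V ∧ V ⊆ U ∧ ∃ (x : ℝ × X → X) (η : ℝ × X → ℝ),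
      ContDiffOn ℝ ∞ x (Ico 0 δ ×ˢ V) ∧ ContDiffOn ℝ ∞ η (Ico 0 δ ×ˢ V) ∧
      (∀ q ∈ V, x (0, q) = q) ∧ (∀ q ∈ V, η (0, q) = 0) ∧ (∀ p ∈ Ico 0 δ ×ˢ V, x p ∈ U) ∧
      ∀ p ∈ Ico 0 δ ×ˢ V, 0 < p.1 → ∀ v,
        β (p.1, x p) (v.1, fderiv ℝ x p v) = Real.exp (η p) * β (0, p.2) (0, v.2) := by
  have := FiniteDimensional.complete ℝ X
  obtain ⟨ε', hε', hεε', U', hU', hyU', hUU', Z, g, hZ, hg, hZg⟩ :=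
    exists_characteristic_field hε hU hy₀ hβ hc
  set D := Ico 0 ε ×ˢ U with hD
  have hsub' : Ico 0 ε' ×ˢ U' ⊆ D := prod_mono (Ico_subset_Ico_right hεε') hUU'
  have hmaps : MapsTo (fun p : ℝ × (X × ℝ) => (p.1, p.2.1)) (Ico 0 ε' ×ˢ (U' ×ˢ (univ : Set ℝ)))
    (Ico 0 ε' ×ˢ U') := fun p hp => ⟨hp.1, hp.2.1⟩
  -- The state space is enlarged by a scalar with velocity `g`, so that the flow also yields the
  -- integral `η` of `g` along trajectories.
  have hfield : ContDiffOn ℝ ∞ (fun p : ℝ × (X × ℝ) => (Z (p.1, p.2.1), g (p.1, p.2.1)))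
      (Ico 0 ε' ×ˢ (U' ×ˢ univ)) :=
    (hZ.comp (by fun_prop) hmaps).prodMk (hg.comp (by fun_prop) hmaps)
  obtain ⟨δ, hδ, hδε, V', hV', hyV', hVU', x', hx', hx0, hxU, hxd⟩ :=
    exists_smooth_flow hε' (hU'.prod isOpen_univ) (y₀ := (y₀, (0 : ℝ))) 
      (show (y₀, (0 : ℝ)) ∈ U' ×ˢ univ from ⟨hyU', mem_univ _⟩) hfield
  set V : Set X := {q | (q, (0 : ℝ)) ∈ V'} with hVdef
  have hV : IsOpen V := hV'.preimage (by fun_prop)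
  have hVU : V ⊆ U' := fun q hq => (hVU' hq).1
  set φ : ℝ × X → X × ℝ := fun p => x' (p.1, (p.2, 0)) with hφ
  have hmapsV : MapsTo (fun p : ℝ × X => (p.1, (p.2, (0 : ℝ)))) (Ico 0 δ ×ˢ V)
    (Icc 0 δ ×ˢ V') := fun p hp => ⟨Ico_subset_Icc_self hp.1, hp.2⟩
  have hφs : ContDiffOn ℝ ∞ φ (Ico 0 δ ×ˢ V) := hx'.comp (by fun_prop) hmapsV
  set x : ℝ × X → X := fun p => (φ p).1 with hx
  set η : ℝ × X → ℝ := fun p => (φ p).2 with hη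
  have hxs : ContDiffOn ℝ ∞ x (Ico 0 δ ×ˢ V) := hφs.fst
  have hηs : ContDiffOn ℝ ∞ η (Ico 0 δ ×ˢ V) := hφs.snd
  have hx00 : ∀ q ∈ V, x (0, q) = q := fun q hq => by simp only [hx, hφ]; rw [hx0 _ hq]
  have hη00 : ∀ q ∈ V, η (0, q) = 0 := fun q hq => by simp only [hη, hφ]; rw [hx0 _ hq]
  have hxU' : ∀ p ∈ Ico 0 δ ×ˢ V, x p ∈ U' := fun p hp =>
    (hxU p.1 (Ico_subset_Icc_self hp.1) _ hp.2).1
  have hW : ∀ p ∈ Ico 0 δ ×ˢ V, (p.1, x p) ∈ Ico 0 ε' ×ˢ U' := fun p hp =>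
    ⟨⟨hp.1.1, hp.1.2.trans hδε⟩, hxU' p hp⟩
  refine ⟨δ, hδ, (hδε.le.trans hεε'), V, hV, hyV', hVU.trans hUU', x, η, hxs, hηs, hx00, hη00,
    fun p hp => hUU' (hxU' p hp), ?_⟩
  -- time derivatives
  have hφd : ∀ p ∈ Ico 0 δ ×ˢ V, 0 < p.1 →
      fderiv ℝ φ p (1, 0) = (Z (p.1, x p), g (p.1, x p)) := by
    intro p hp hp0
    have h1 : HasFDerivAt φ (fderiv ℝ φ p) p :=
      ((hφs.contDiffAt (Ico_prod_mem_nhds hV hp hp0)).differentiableAt (by simp)).hasFDerivAt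
    have h3 : HasDerivAt (fun r : ℝ => (r, p.2)) ((1 : ℝ), (0 : X)) p.1 :=
      (hasDerivAt_id p.1).prodMk (hasDerivAt_const _ _)
    have h4 : HasDerivAt (fun r => φ (r, p.2)) (fderiv ℝ φ p (1, 0)) p.1 :=
      HasFDerivAt.comp_hasDerivAt (l := φ) p.1 h1 h3
    exact h4.unique ((hxd p.1 (Ico_subset_Icc_self hp.1) (p.2, 0) hp.2).hasDerivAt
      (Icc_mem_nhds hp0 hp.1.2))
  set W : ℝ × X → ℝ × X := fun p => (p.1, x p) with hWdef
  have hWs : ContDiffOn ℝ ∞ W (Ico 0 δ ×ˢ V) := contDiffOn_fst.prodMk hxs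
  have hx1 : ∀ p ∈ Ico 0 δ ×ˢ V, 0 < p.1 → ∀ v, fderiv ℝ x p v = (fderiv ℝ φ p v).1 := by
    intro p hp hp0 v
    have h1 : HasFDerivAt φ (fderiv ℝ φ p) p :=
      ((hφs.contDiffAt (Ico_prod_mem_nhds hV hp hp0)).differentiableAt (by simp)).hasFDerivAt
    rw [h1.fst.fderiv]; rfl
  have hη1 : ∀ p ∈ Ico 0 δ ×ˢ V, 0 < p.1 → ∀ v, fderiv ℝ η p v = (fderiv ℝ φ p v).2 := by
    intro p hp hp0 v
    have h1 : HasFDerivAt φ (fderiv ℝ φ p) p :=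
      ((hφs.contDiffAt (Ico_prod_mem_nhds hV hp hp0)).differentiableAt (by simp)).hasFDerivAt
    rw [h1.snd.fderiv]; rfl
  have hWd : ∀ p ∈ Ico 0 δ ×ˢ V, 0 < p.1 → ∀ v, fderiv ℝ W p v = (v.1, fderiv ℝ x p v) := by
    intro p hp hp0 v
    have h1 : HasFDerivAt x (fderiv ℝ x p) p :=
      ((hxs.contDiffAt (Ico_prod_mem_nhds hV hp hp0)).differentiableAt (by simp)).hasFDerivAt
    rw [(hasFDerivAt_fst.prodMk h1).fderiv]; rfl
  have hker : ∀ p ∈ Ico 0 δ ×ˢ V, 0 < p.1 → β (W p) (fderiv ℝ W p (1, 0)) = 0 := by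
    intro p hp hp0
    rw [hWd p hp hp0, hx1 p hp hp0, hφd p hp hp0]
    exact (hZg _ (hW p hp)).1
  set κ := fun p => (β (W p)).comp (fderiv ℝ W p) with hκ
  -- This is the Lie derivative along the flow: as `(1, Z)` is in the kernel of `β`, only the
  -- contraction with `dβ` remains, and it equals `g β` on slice vectors.
  have hκd : ∀ p ∈ Ico 0 δ ×ˢ V, 0 < p.1 → DifferentiableAt ℝ κ p ∧ ∀ w,
      fderiv ℝ κ p (1, 0) (0, w) = fderiv ℝ η p (1, 0) * κ p (0, w) := by
    intro p hp hp0
    have hn := Ico_prod_mem_nhds hV hp hp0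
    have hWp : ContDiffAt ℝ 2 W p := (hWs.contDiffAt hn).of_le two_le_infty
    have hDn : D ∈ 𝓝 (W p) := Ico_prod_mem_nhds hU (hsub' (hW p hp)) hp0
    have hβp : DifferentiableAt ℝ β (W p) := (hβ.contDiffAt hDn).differentiableAt (by simp)
    have hnear : ∀ᶠ u in 𝓝 p, β (W u) (fderiv ℝ W u (1, 0)) = 0 := by
      filter_upwards [hn, continuousAt_fst.eventually (lt_mem_nhds hp0)] with u hu hu0
      exact hker u hu hu0
    refine ⟨(hasFDerivAt_pullback hWp hβp).1, fun w => ?_⟩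
    rw [fderiv_pullback_of_eventually_eq_zero hWp hβp hnear, hη1 p hp hp0, hφd p hp hp0]
    simp only [hκ, ContinuousLinearMap.comp_apply]
    rw [hWd p hp hp0, hWd p hp hp0, hx1 p hp hp0 (1, 0), hφd p hp hp0]
    have h1 := (hZg _ (hW p hp)).2 (fderiv ℝ x p (0, w))
    rw [fderivWithin_of_mem_nhds hDn] at h1
    exact h1
  -- the pulled back form at time zero
  have hUDV : UniqueDiffOn ℝ (Ico 0 δ ×ˢ V) := uniqueDiffOn_Ico_prod hV
  -- At `t = 0` the two-sided derivative of `W` carries no information; with the derivative within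
  -- the domain the pullback is continuous down to `t = 0`.
  set κ' := fun p => (β (W p)).comp (fderivWithin ℝ W (Ico 0 δ ×ˢ V) p) with hκ'
  have hκ'c : ContinuousOn κ' (Ico 0 δ ×ˢ V) :=
    (hβ.continuousOn.comp hWs.continuousOn fun p hp => hsub' (hW p hp)).clm_comp
      (hWs.continuousOn_fderivWithin hUDV (by simp))
  have hκκ' : ∀ p ∈ Ico 0 δ ×ˢ V, 0 < p.1 → κ' p = κ p := by
    intro p hp hp0
    simp only [hκ', hκ]
    rw [fderivWithin_of_mem_nhds (Ico_prod_mem_nhds hV hp hp0)]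
  have hκ0 : ∀ q ∈ V, ∀ w, κ' (0, q) (0, w) = β (0, q) (0, w) := by
    intro q hq w
    have h0 : ((0 : ℝ), q) ∈ Ico 0 δ ×ˢ V := ⟨⟨le_rfl, hδ⟩, hq⟩
    have h1 : HasFDerivWithinAt W (fderivWithin ℝ W (Ico 0 δ ×ˢ V) (0, q)) (Ico 0 δ ×ˢ V) (0, q) :=
      (hWs.differentiableOn (by simp) _ h0).hasFDerivWithinAt
    have h3 : HasFDerivWithinAt (fun y : X => ((0 : ℝ), y)) (ContinuousLinearMap.inr ℝ ℝ X) V q :=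
      (hasFDerivAt_prodMk_right 0 q).hasFDerivWithinAt
    have h2 : HasFDerivAt (fun y => W (0, y)) ((fderivWithin ℝ W (Ico 0 δ ×ˢ V) (0, q)).comp
        (ContinuousLinearMap.inr ℝ ℝ X)) q :=
      (h1.comp q h3 fun y hy => ⟨⟨le_rfl, hδ⟩, hy⟩).hasFDerivAt (hV.mem_nhds hq)
    have h4 : HasFDerivAt (fun y => W (0, y)) (ContinuousLinearMap.inr ℝ ℝ X) q :=
      (hasFDerivAt_prodMk_right 0 q).congr_of_eventuallyEq (by
        filter_upwards [hV.mem_nhds hq] with y hy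
        simp only [hWdef]
        rw [hx00 y hy])
    have h5 := congrArg (fun L => L w) (h2.unique h4)
    simp only [ContinuousLinearMap.comp_apply, ContinuousLinearMap.inr_apply] at h5
    simp only [hκ', ContinuousLinearMap.comp_apply]
    rw [h5]
    simp only [hWdef]
    rw [hx00 q hq]
  -- integrate
  have hmain : ∀ p ∈ Ico 0 δ ×ˢ V, 0 < p.1 → ∀ w,
      κ p (0, w) = Real.exp (η p) * β (0, p.2) (0, w) := by
    rintro ⟨r, q⟩ ⟨hr, hq⟩ hr0 w
    have hr0 : 0 < r := hr0
    have hin : ∀ t ∈ Icc 0 r, (t, q) ∈ Ico 0 δ ×ˢ V := fun t ht =>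
      ⟨⟨ht.1, ht.2.trans_lt hr.2⟩, hq⟩
    -- By `hκd` the function `e^{-η} κ'` has zero time derivative for `t > 0`; being continuous at
    -- `0`, it keeps its initial value.
    have hcont : ContinuousOn (fun t => Real.exp (-η (t, q)) * κ' (t, q) (0, w)) (Icc 0 r) := by
      have h1 : ContinuousOn (fun t : ℝ => (t, q)) (Icc 0 r) := by fun_prop
      exact (Real.continuous_exp.comp_continuousOn (hηs.continuousOn.comp h1 hin).neg).mul
        ((hκ'c.comp h1 hin).clm_apply continuousOn_const)
    have hder : ∀ t ∈ Ioo 0 r,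
        HasDerivAt (fun t => Real.exp (-η (t, q)) * κ' (t, q) (0, w)) 0 t := by
      intro t ht
      have hp := hin t (Ioo_subset_Icc_self ht)
      have hn := Ico_prod_mem_nhds hV hp ht.1
      obtain ⟨hκp, hκp'⟩ := hκd _ hp ht.1
      have h3 : HasDerivAt (fun r : ℝ => (r, q)) ((1 : ℝ), (0 : X)) t :=
        (hasDerivAt_id t).prodMk (hasDerivAt_const _ _)
      have h4 : HasDerivAt (fun r => κ (r, q)) (fderiv ℝ κ (t, q) (1, 0)) t :=
        HasFDerivAt.comp_hasDerivAt (l := κ) t hκp.hasFDerivAt h3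
      have h5 : HasDerivAt (fun r => κ (r, q) (0, w)) (fderiv ℝ κ (t, q) (1, 0) (0, w)) t := by
        simpa using h4.clm_apply (hasDerivAt_const t ((0 : ℝ), w))
      have h6 : HasDerivAt (fun r => η (r, q)) (fderiv ℝ η (t, q) (1, 0)) t :=
        HasFDerivAt.comp_hasDerivAt (l := η) t
          ((hηs.contDiffAt hn).differentiableAt (by simp)).hasFDerivAt h3
      have h7 := h6.neg.exp.mul h5
      rw [hκp'] at h7
      refine (h7.congr_deriv ?_).congr_of_eventuallyEq ?_
      · simp only [Pi.neg_apply]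
        ring
      · filter_upwards [Ioo_mem_nhds ht.1 ht.2] with s hs
        simp only [Pi.mul_apply, Pi.neg_apply]
        rw [hκκ' _ (hin s (Ioo_subset_Icc_self hs)) hs.1]
    obtain ⟨c, hc, hc'⟩ := exists_hasDerivAt_eq_slope
      (fun t => Real.exp (-η (t, q)) * κ' (t, q) (0, w)) (fun _ => 0) hr0 hcont hder
    rw [sub_zero, eq_div_iff hr0.ne', zero_mul, hκ0 q hq, hη00 q hq, neg_zero, Real.exp_zero,
      one_mul, hκκ' _ (hin r ⟨hr0.le, le_rfl⟩) hr0, eq_comm, sub_eq_zero] at hc'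
    rw [← hc', ← mul_assoc, ← Real.exp_add, add_neg_cancel, Real.exp_zero, one_mul]
  intro p hp hp0 v
  have h1 := hWd p hp hp0 v
  have h2 : β (p.1, x p) (v.1, fderiv ℝ x p v) = κ p v := by
    simp only [hκ, ContinuousLinearMap.comp_apply]
    rw [h1]
  have h3 : v = v.1 • ((1 : ℝ), (0 : X)) + (0, v.2) := by ext <;> simp
  have h4 : κ p (1, 0) = 0 := hker p hp hp0
  rw [h2]
  conv_lhs => rw [h3, map_add, map_smul, h4, smul_zero, zero_add]
  exact hmain p hp hp0 v.2

end ContactFlow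

/-! ### Collars in a half space and their uniqueness. -/

section ModelSolution

variable {X Y : Type*} [NormedAddCommGroup X] [NormedSpace ℝ X] [NormedAddCommGroup Y]
  [NormedSpace ℝ Y]

/-- A map `κ : [0, δ) × V → Y` into a half space `0 ≤ ℓ` which extends `J : V → Y`, is a local
diffeomorphism, and pulls `lam` back to `r⁻¹ • a`. -/
structure IsModelSolution (ℓ : Y →L[ℝ] ℝ) (lam : Y → Y →L[ℝ] ℝ) (a : X → X →L[ℝ] ℝ) (J : X → Y)
    (δ : ℝ) (V : Set X) (κ : ℝ × X → Y) : Prop where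
  contDiffOn : ContDiffOn ℝ ∞ κ (Ico 0 δ ×ˢ V)
  zero : ∀ y ∈ V, κ (0, y) = J y
  pos : ∀ p ∈ Ico 0 δ ×ˢ V, 0 < p.1 → 0 < ℓ (κ p)
  isInvertible : ∀ p ∈ Ico 0 δ ×ˢ V, (fderivWithin ℝ κ (Ico 0 δ ×ˢ V) p).IsInvertible
  pullback_eq : ∀ p ∈ Ico 0 δ ×ˢ V, 0 < p.1 → ∀ v,
    lam (κ p) (fderiv ℝ κ p v) = 1 / p.1 * a p.2 v.2

variable [FiniteDimensional ℝ X]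

/-- Two model solutions agree near the boundary. -/
theorem IsModelSolution.eventually_eq {ℓ : Y →L[ℝ] ℝ} (hℓ : ℓ ≠ 0) {lam : Y → Y →L[ℝ] ℝ}
    {a : X → X →L[ℝ] ℝ} {J : X → Y} {δ : ℝ} (hδ : 0 < δ) {V : Set X} (hV : IsOpen V)
    {y₀ : X} (hy₀ : y₀ ∈ V) (hJ : ∀ y ∈ V, ℓ (J y) = 0) (ha : ContDiffOn ℝ ∞ a V)
    (hc : (contactOp (a y₀) (fderiv ℝ a y₀)).IsInvertible)
    {κ₁ κ₂ : ℝ × X → Y} (h₁ : IsModelSolution ℓ lam a J δ V κ₁)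
    (h₂ : IsModelSolution ℓ lam a J δ V κ₂) :
    ∀ᶠ p in 𝓝[Ico 0 δ ×ˢ V] ((0 : ℝ), y₀), κ₁ p = κ₂ p := by
  have := FiniteDimensional.complete ℝ X
  set D := Ico 0 δ ×ˢ V with hD
  have h0 : ((0 : ℝ), y₀) ∈ D := ⟨⟨le_rfl, hδ⟩, hy₀⟩
  have hnn : ∀ {κ : ℝ × X → Y}, IsModelSolution ℓ lam a J δ V κ → ∀ p ∈ D, 0 ≤ ℓ (κ p) := by
    intro κ h p hp
    rcases hp.1.1.eq_or_lt with hp0 | hp0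
    · have : p = (0, p.2) := Prod.ext hp0.symm rfl
      rw [this, h.zero _ hp.2, hJ _ hp.2]
    · exact (h.pos p hp hp0).le
  obtain ⟨Θ, hΘ0, hΘs, hΘκ, hΘnn, hΘpos, -, hΘsymm⟩ := exists_halfSpace_inverse hδ hV hy₀
    h₁.contDiffOn hℓ (hnn h₁) (fun y hy => by rw [h₁.zero y hy, hJ y hy]) (h₁.isInvertible _ h0)
  have hκ₂t : ∀ᶠ p in 𝓝[D] ((0 : ℝ), y₀), κ₂ p ∈ Θ.target ∧ p ∈ Θ.source := by
    refine ((h₂.contDiffOn.continuousOn _ h0).eventually (Θ.open_target.mem_nhds ?_)).and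
      (mem_nhdsWithin_of_mem_nhds (Θ.open_source.mem_nhds hΘ0))
    rw [h₂.zero _ hy₀, ← h₁.zero _ hy₀, ← hΘκ _ hΘ0 le_rfl]
    exact Θ.map_source hΘ0
  obtain ⟨δ', hδ', hδδ', V', hV', hy₀', hVV', hE⟩ := exists_Ico_prod_subset hδ hV hy₀ hκ₂t
  have hsub : Ico 0 δ' ×ˢ V' ⊆ D := prod_mono (Ico_subset_Ico_right hδδ') hVV'
  -- The transition map between the two solutions, smooth up to the boundary because `κ₁` has a
  -- local inverse on the half space.
  set T : ℝ × X → ℝ × X := fun p => Θ.symm (κ₂ p) with hT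
  have hTs : ContDiffOn ℝ ∞ T (Ico 0 δ' ×ˢ V') :=
    hΘsymm.comp (h₂.contDiffOn.mono hsub) fun p hp => ⟨(hE p hp).1, hnn h₂ p (hsub hp)⟩
  have hTsrc : ∀ p ∈ Ico 0 δ' ×ˢ V', T p ∈ Θ.source := fun p hp => Θ.map_target (hE p hp).1
  have hΘT : ∀ p ∈ Ico 0 δ' ×ˢ V', Θ (T p) = κ₂ p := fun p hp => Θ.right_inv (hE p hp).1
  have hTnn : ∀ p ∈ Ico 0 δ' ×ˢ V', 0 ≤ (T p).1 := fun p hp => by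
    rw [← hΘnn _ (hTsrc p hp), hΘT p hp]
    exact hnn h₂ p (hsub hp)
  have hTpos : ∀ p ∈ Ico 0 δ' ×ˢ V', 0 < p.1 → 0 < (T p).1 := fun p hp hp0 => by
    rw [← hΘpos _ (hTsrc p hp), hΘT p hp]
    exact h₂.pos p (hsub hp) hp0
  have hTD : ∀ p ∈ Ico 0 δ' ×ˢ V', T p ∈ D := fun p hp =>
    ⟨⟨hTnn p hp, (hΘs (hTsrc p hp)).1⟩, (hΘs (hTsrc p hp)).2⟩
  have hκT : ∀ p ∈ Ico 0 δ' ×ˢ V', κ₁ (T p) = κ₂ p := fun p hp => by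
    rw [← hΘκ _ (hTsrc p hp) (hTnn p hp), hΘT p hp]
  have hT0 : ∀ y ∈ V', T (0, y) = (0, y) := fun y hy => by
    have hp : ((0 : ℝ), y) ∈ Ico 0 δ' ×ˢ V' := ⟨⟨le_rfl, hδ'⟩, hy⟩
    simp only [hT]
    rw [h₂.zero _ (hVV' hy), ← h₁.zero _ (hVV' hy), ← hΘκ _ (hE _ hp).2 le_rfl]
    exact Θ.left_inv (hE _ hp).2
  -- Since `κ₁ ∘ T = κ₂`, the map `T` preserves `a / r`; hence its second component pulls `a` back
  -- to `(T p).1 / p.1` times `a`, the situation of the rigidity theorem.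
  have hpull : ∀ p ∈ Ico 0 δ' ×ˢ V', 0 < p.1 → ∀ v,
      a (T p).2 (fderiv ℝ (fun p => (T p).2) p v) = (T p).1 / p.1 * a p.2 v.2 := by
    intro p hp hp0 v
    have hTp : HasFDerivAt T (fderiv ℝ T p) p :=
      ((hTs.contDiffAt (Ico_prod_mem_nhds hV' hp hp0)).differentiableAt (by simp)).hasFDerivAt
    have hκ : HasFDerivAt κ₁ (fderiv ℝ κ₁ (T p)) (T p) :=
      ((h₁.contDiffOn.contDiffAt
        (Ico_prod_mem_nhds hV (hTD p hp) (hTpos p hp hp0))).differentiableAt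
        (by simp)).hasFDerivAt
    have h3 : HasFDerivAt κ₂ ((fderiv ℝ κ₁ (T p)).comp (fderiv ℝ T p)) p := by
      refine (hκ.comp p hTp).congr_of_eventuallyEq ?_
      filter_upwards [Ico_prod_mem_nhds hV' hp hp0] with q hq
      exact (hκT q hq).symm
    have h4 := h₂.pullback_eq p (hsub hp) hp0 v
    rw [h3.fderiv, ← hκT p hp, ContinuousLinearMap.comp_apply,
      h₁.pullback_eq _ (hTD p hp) (hTpos p hp hp0)] at h4
    rw [hTp.snd.fderiv]
    have h5 : (T p).1 ≠ 0 := (hTpos p hp hp0).ne'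
    field_simp at h4
    change a (T p).2 (fderiv ℝ T p v).2 = _
    field_simp
    linarith
  obtain ⟨δ₃, hδ₃, hδ₃', V₃, hV₃, hy₃, hVV₃, h3⟩ := eq_snd_of_pullback_contact hV ha hδ' hV' hy₀' hc
    hTs.snd (fun p hp => (hTD p hp).2) (fun y hy => by rw [hT0 y hy]) hpull
  have hmem : Iio δ₃ ×ˢ V₃ ∈ 𝓝 ((0 : ℝ), y₀) := prod_mem_nhds (Iio_mem_nhds hδ₃) (hV₃.mem_nhds hy₃)
  filter_upwards [mem_nhdsWithin_of_mem_nhds hmem, self_mem_nhdsWithin] with p hp hpD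
  have hp3 : p ∈ Ico 0 δ₃ ×ˢ V₃ := ⟨⟨hpD.1.1, hp.1⟩, hp.2⟩
  have hp' : p ∈ Ico 0 δ' ×ˢ V' := ⟨⟨hpD.1.1, hp.1.trans_le hδ₃'⟩, hVV₃ hp.2⟩
  have hTp : T p = p := by
    obtain ⟨h4, h5⟩ := h3 p hp3
    refine Prod.ext ?_ h4
    rcases hpD.1.1.eq_or_lt with hp0 | hp0
    · have : p = (0, p.2) := Prod.ext hp0.symm rfl
      rw [this, hT0 _ hp'.2]
    · exact (div_eq_one_iff_eq hp0.ne').1 (h5 hp0)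
  rw [← hκT p hp', hTp]

end ModelSolution

/-! ### Construction of collars in a half space. -/

section Existence

variable {X Y : Type*} [NormedAddCommGroup X] [NormedSpace ℝ X] [NormedAddCommGroup Y]
  [NormedSpace ℝ Y]

lemma fderivWithin_comp_inr {Z : Type*} [NormedAddCommGroup Z] [NormedSpace ℝ Z]
    {f : ℝ × X → Z} {δ : ℝ} (hδ : 0 < δ) {V : Set X} (hV : IsOpen V)
    (hf : ContDiffOn ℝ ∞ f (Ico 0 δ ×ˢ V)) {q : X} (hq : q ∈ V) {L : X →L[ℝ] Z}
    (hL : HasFDerivAt (fun y => f (0, y)) L q) (w : X) :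
    fderivWithin ℝ f (Ico 0 δ ×ˢ V) (0, q) (0, w) = L w := by
  have h0 : ((0 : ℝ), q) ∈ Ico 0 δ ×ˢ V := ⟨⟨le_rfl, hδ⟩, hq⟩
  have h1 := (hf.differentiableOn (by simp) _ h0).hasFDerivWithinAt
  have h3 : HasFDerivWithinAt (fun y : X => ((0 : ℝ), y)) (ContinuousLinearMap.inr ℝ ℝ X) V q :=
    (hasFDerivAt_prodMk_right 0 q).hasFDerivWithinAt
  have h2 := (h1.comp q h3 fun y hy => ⟨⟨le_rfl, hδ⟩, hy⟩).hasFDerivAt (hV.mem_nhds hq)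
  exact congrArg (fun L => L w) (h2.unique hL)

/-- On the kernel of `a`, contraction with `d (c a)` differs from `c` times contraction with `da`
only by a multiple of `a`; that multiple is absorbed in `g`. -/
lemma isInvertible_contactOp_smul [FiniteDimensional ℝ X] {a : X → X →L[ℝ] ℝ} {c : X → ℝ} {y : X}
    (ha : DifferentiableAt ℝ a y) (hc : DifferentiableAt ℝ c y) (hcy : c y ≠ 0)
    (h : (contactOp (a y) (fderiv ℝ a y)).IsInvertible) :
    (contactOp (c y • a y) (fderiv ℝ (fun y => c y • a y) y)).IsInvertible := by
  obtain ⟨w, hw⟩ := exists_apply_eq_one_of_contactOp h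
  refine isInvertible_contactOp ⟨w, by simp [hw, hcy]⟩ fun z g hz hzd => ?_
  have hz0 : a y z = 0 := by simpa [hcy] using hz
  refine eq_zero_of_contactOp h (g := g - fderiv ℝ c y z / c y) hz0 fun w => ?_
  have h1 := hzd w
  have h2 : fderiv ℝ (fun y => c y • a y) y = _ := (hc.hasFDerivAt.smul ha.hasFDerivAt).fderiv
  rw [h2] at h1
  simp only [add_apply, smul_apply, ContinuousLinearMap.smulRight_apply, smul_eq_mul, hz0,
    mul_zero, add_zero] at h1
  field_simp
  linarith

lemma isInvertible_of_injective [FiniteDimensional ℝ X] [FiniteDimensional ℝ Y]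
    (hdim : Module.finrank ℝ X = Module.finrank ℝ Y) {A : X →L[ℝ] Y}
    (hA : ∀ x, A x = 0 → x = 0) : A.IsInvertible := by
  have hinj : Function.Injective (A : X →ₗ[ℝ] Y) := by
    rw [← LinearMap.ker_eq_bot, LinearMap.ker_eq_bot']
    exact hA
  exact ⟨(LinearEquiv.ofInjectiveOfFinrankEq _ hinj hdim).toContinuousLinearEquiv,
    ContinuousLinearMap.ext fun _ => rfl⟩

variable [FiniteDimensional ℝ X] [FiniteDimensional ℝ Y]

/-- The collar `(t, q) ↦ Φ (t, q)` along which the form `β` is a multiple of `a`. -/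
lemma exists_straightened_collar {ℓ : Y →L[ℝ] ℝ} {e : Y} (he : ℓ e = 1) {O : Set Y} (hO : IsOpen O)
    {β : Y → Y →L[ℝ] ℝ} (hβ : ContDiffOn ℝ ∞ β (O ∩ {z | 0 ≤ ℓ z})) {U : Set X} (hU : IsOpen U)
    {y₀ : X} (hy₀ : y₀ ∈ U) {J : X → Y} (hJ : ContDiffOn ℝ ∞ J U) (hJO : MapsTo J U O)
    (hJℓ : ∀ y ∈ U, ℓ (J y) = 0) {a : X → X →L[ℝ] ℝ} (ha : ContDiffOn ℝ ∞ a U) {c : X → ℝ}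
    (hc : ContDiffOn ℝ ∞ c U) (hcpos : ∀ y ∈ U, 0 < c y)
    (hca : ∀ y ∈ U, ∀ w, β (J y) (fderiv ℝ J y w) = c y * a y w)
    (hcontact : (contactOp (a y₀) (fderiv ℝ a y₀)).IsInvertible) :
    ∃ δ, 0 < δ ∧ ∃ V, IsOpen V ∧ y₀ ∈ V ∧ V ⊆ U ∧ ∃ (Φ : ℝ × X → Y) (η : ℝ × X → ℝ),
      ContDiffOn ℝ ∞ Φ (Ico 0 δ ×ˢ V) ∧ ContDiffOn ℝ ∞ η (Ico 0 δ ×ˢ V) ∧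
      (∀ q ∈ V, Φ (0, q) = J q ∧ η (0, q) = 0) ∧ (∀ p ∈ Ico 0 δ ×ˢ V, Φ p ∈ O ∧ ℓ (Φ p) = p.1) ∧
      ∀ p ∈ Ico 0 δ ×ˢ V, 0 < p.1 → ∀ v,
        β (Φ p) (fderiv ℝ Φ p v) = Real.exp (η p) * (c p.2 * a p.2 v.2) := by
  -- A preliminary collar, by translation along `e`; as `ℓ e = 1`, its time is the normal
  -- coordinate. The contact flow is run in these coordinates.
  set Φ₀ : ℝ × X → Y := fun p => J p.2 + p.1 • e with hΦ₀
  have hΦ₀s : ContDiffOn ℝ ∞ Φ₀ (Ico 0 1 ×ˢ U) :=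
    (hJ.comp contDiffOn_snd fun p hp => hp.2).add (contDiffOn_fst.smul contDiffOn_const)
  have hΦ₀ℓ : ∀ p : ℝ × X, p.2 ∈ U → ℓ (Φ₀ p) = p.1 := fun p hp => by
    simp [hΦ₀, hJℓ _ hp, he]
  have h01 : ((0 : ℝ), y₀) ∈ Ico (0 : ℝ) 1 ×ˢ U := ⟨⟨le_rfl, one_pos⟩, hy₀⟩
  obtain ⟨ε, hε, hε1, U', hU', hyU', hUU', hE⟩ := exists_Ico_prod_subset one_pos hU hy₀
    (P := fun p => Φ₀ p ∈ O) ((hΦ₀s.continuousOn _ h01).eventually (hO.mem_nhds (by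
      change J y₀ + (0 : ℝ) • e ∈ O
      rw [zero_smul, add_zero]
      exact hJO hy₀)))
  have hsub : Ico 0 ε ×ˢ U' ⊆ Ico 0 1 ×ˢ U := prod_mono (Ico_subset_Ico_right hε1) hUU'
  set Φ₀' : ℝ × X → ℝ × X →L[ℝ] Y := fun p =>
    (fderiv ℝ J p.2).comp (ContinuousLinearMap.snd ℝ ℝ X) +
      (ContinuousLinearMap.fst ℝ ℝ X).smulRight e with hΦ₀'
  have hΦ₀d : ∀ p : ℝ × X, p.2 ∈ U → HasFDerivAt Φ₀ (Φ₀' p) p := by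
    intro p hp
    have h1 : HasFDerivAt J (fderiv ℝ J p.2) p.2 :=
      ((hJ.contDiffAt (hU.mem_nhds hp)).differentiableAt (by simp)).hasFDerivAt
    exact (h1.comp p hasFDerivAt_snd).add (hasFDerivAt_fst.smul_const e)
  have hJ' : ContDiffOn ℝ ∞ (fderiv ℝ J) U := ((contDiffOn_infty_iff_fderiv_of_isOpen hU).1 hJ).2
  have hΦ₀'s : ContDiffOn ℝ ∞ Φ₀' (Ico 0 ε ×ˢ U') :=
    ((hJ'.comp contDiffOn_snd fun p hp => hUU' hp.2).clm_comp contDiffOn_const).add contDiffOn_const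
  set b : ℝ × X → ℝ × X →L[ℝ] ℝ := fun p => (β (Φ₀ p)).comp (Φ₀' p) with hb
  have hbs : ContDiffOn ℝ ∞ b (Ico 0 ε ×ˢ U') := by
    refine (hβ.comp (hΦ₀s.mono hsub) fun p hp => ⟨hE p hp, ?_⟩).clm_comp hΦ₀'s
    change 0 ≤ ℓ (Φ₀ p)
    rw [hΦ₀ℓ p (hUU' hp.2)]
    exact hp.1.1
  have hb0 : ∀ y ∈ U, ∀ w, b (0, y) (0, w) = c y * a y w := by
    intro y hy w
    simp only [hb, hΦ₀, hΦ₀', ContinuousLinearMap.comp_apply, add_apply,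
      ContinuousLinearMap.coe_snd', ContinuousLinearMap.smulRight_apply,
      ContinuousLinearMap.coe_fst', zero_smul, add_zero]
    exact hca y hy w
  have hb0' : ∀ y ∈ U, (b (0, y)).comp (ContinuousLinearMap.inr ℝ ℝ X) = c y • a y := by
    intro y hy
    ext w
    exact hb0 y hy w
  have hbc : (contactOp ((b (0, y₀)).comp (ContinuousLinearMap.inr ℝ ℝ X))
      (fderiv ℝ (fun y => (b (0, y)).comp (ContinuousLinearMap.inr ℝ ℝ X)) y₀)).IsInvertible := by
    have h1 : (fun y => (b (0, y)).comp (ContinuousLinearMap.inr ℝ ℝ X)) =ᶠ[𝓝 y₀]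
        fun y => c y • a y := by
      filter_upwards [hU.mem_nhds hy₀] with y hy
      exact hb0' y hy
    rw [h1.fderiv_eq, hb0' y₀ hy₀]
    exact isInvertible_contactOp_smul ((ha.contDiffAt (hU.mem_nhds hy₀)).differentiableAt (by simp))
      ((hc.contDiffAt (hU.mem_nhds hy₀)).differentiableAt (by simp)) (hcpos _ hy₀).ne' hcontact
  obtain ⟨δ, hδ, hδε, V, hV, hyV, hVU, x, η, hx, hη, hx0, hη0, hxU, hmain⟩ :=
    exists_contact_flow hε hU' hyU' hbs hbc
  have hW : ∀ p ∈ Ico 0 δ ×ˢ V, (p.1, x p) ∈ Ico 0 ε ×ˢ U' := fun p hp =>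
    ⟨⟨hp.1.1, hp.1.2.trans_le hδε⟩, hxU p hp⟩
  refine ⟨δ, hδ, V, hV, hyV, hVU.trans hUU', fun p => Φ₀ (p.1, x p), η,
    hΦ₀s.comp (contDiffOn_fst.prodMk hx) fun p hp => hsub (hW p hp), hη, fun q hq => ?_,
    fun p hp => ⟨hE _ (hW p hp), hΦ₀ℓ (p.1, x p) (hUU' (hxU p hp))⟩, fun p hp hp0 v => ?_⟩
  · exact ⟨by simp [hΦ₀, hx0 q hq], hη0 q hq⟩
  · have h1 : HasFDerivAt x (fderiv ℝ x p) p :=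
      ((hx.contDiffAt (Ico_prod_mem_nhds hV hp hp0)).differentiableAt (by simp)).hasFDerivAt
    have h2 : HasFDerivAt (fun p => Φ₀ (p.1, x p)) ((Φ₀' (p.1, x p)).comp
        ((ContinuousLinearMap.fst ℝ ℝ X).prod (fderiv ℝ x p))) p :=
      HasFDerivAt.comp (g := Φ₀) p (hΦ₀d (p.1, x p) (hUU' (hxU p hp))) (hasFDerivAt_fst.prodMk h1)
    rw [h2.fderiv, ← hb0 p.2 (hUU' (hVU hp.2)), ← hmain p hp hp0 v]
    rfl

/-- Existence of model solutions. -/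
theorem exists_isModelSolution (hdim : Module.finrank ℝ Y = Module.finrank ℝ X + 1)
    {ℓ : Y →L[ℝ] ℝ} {e : Y} (he : ℓ e = 1) {O : Set Y}
    (hO : IsOpen O) {β lam : Y → Y →L[ℝ] ℝ} (hβ : ContDiffOn ℝ ∞ β (O ∩ {z | 0 ≤ ℓ z}))
    {u : Y → ℝ} (hu : ContDiffOn ℝ ∞ u (O ∩ {z | 0 ≤ ℓ z}))
    (hu0 : ∀ z ∈ O, ℓ z = 0 → u z = 0) (hupos : ∀ z ∈ O, 0 < ℓ z → 0 < u z)
    (hβlam : ∀ z ∈ O, 0 < ℓ z → β z = u z • lam z) {U : Set X} (hU : IsOpen U)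
    {y₀ : X} (hy₀ : y₀ ∈ U) {J : X → Y} (hJ : ContDiffOn ℝ ∞ J U) (hJO : MapsTo J U O)
    (hJℓ : ∀ y ∈ U, ℓ (J y) = 0) (hJinj : ∀ w, fderiv ℝ J y₀ w = 0 → w = 0)
    (hu' : fderivWithin ℝ u (O ∩ {z | 0 ≤ ℓ z}) (J y₀) ≠ 0)
    {a : X → X →L[ℝ] ℝ} (ha : ContDiffOn ℝ ∞ a U) {c : X → ℝ}
    (hc : ContDiffOn ℝ ∞ c U) (hcpos : ∀ y ∈ U, 0 < c y)
    (hca : ∀ y ∈ U, ∀ w, β (J y) (fderiv ℝ J y w) = c y * a y w)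
    (hcontact : (contactOp (a y₀) (fderiv ℝ a y₀)).IsInvertible) :
    ∃ δ, 0 < δ ∧ ∃ V, IsOpen V ∧ y₀ ∈ V ∧ V ⊆ U ∧ ∃ κ, IsModelSolution ℓ lam a J δ V κ ∧
      MapsTo κ (Ico 0 δ ×ˢ V) O ∧
      ∀ y ∈ V, HasDerivWithinAt (fun r => u (κ (r, y))) (c y) (Ici 0) 0 := by
  have := FiniteDimensional.complete ℝ X
  obtain ⟨δ, hδ, V, hV, hyV, hVU, Φ, η, hΦ, hη, hΦη0, hΦO, hΦβ⟩ :=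
    exists_straightened_collar he hO hβ hU hy₀ hJ hJO hJℓ ha hc hcpos hca hcontact
  set D := Ico 0 δ ×ˢ V with hD
  have hUD : UniqueDiffOn ℝ D := uniqueDiffOn_Ico_prod hV
  have hΦ0 : ∀ q ∈ V, Φ (0, q) = J q := fun q hq => (hΦη0 q hq).1
  have h0 : ((0 : ℝ), y₀) ∈ D := ⟨⟨le_rfl, hδ⟩, hyV⟩
  have hΦT : MapsTo Φ D (O ∩ {z | 0 ≤ ℓ z}) := fun p hp => ⟨(hΦO p hp).1, by
    change 0 ≤ ℓ (Φ p)
    rw [(hΦO p hp).2]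
    exact hp.1.1⟩
  have hfac : ∀ p ∈ D, 0 < Real.exp (η p) * c p.2 := fun p hp =>
    mul_pos (Real.exp_pos _) (hcpos _ (hVU hp.2))
  have hfacs : ContDiffOn ℝ ∞ (fun p => Real.exp (η p) * c p.2) D :=
    hη.exp.mul (hc.comp contDiffOn_snd fun p hp => hVU hp.2)
  -- Because `β = u λ`, the pullback of `λ` by `Φ` is `a / ρ`.
  set ρ : ℝ × X → ℝ := fun p => u (Φ p) / (Real.exp (η p) * c p.2) with hρ
  have hρs : ContDiffOn ℝ ∞ ρ D := (hu.comp hΦ hΦT).div hfacs fun p hp => (hfac p hp).ne'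
  have hρ0 : ∀ q ∈ V, ρ (0, q) = 0 := fun q hq => by
    simp only [hρ]
    rw [hΦ0 q hq, hu0 _ (hJO (hVU hq)) (hJℓ _ (hVU hq)), zero_div]
  have hρnn : ∀ p ∈ D, 0 ≤ ρ p := fun p hp => by
    rcases hp.1.1.eq_or_lt with hp0 | hp0
    · have : p = (0, p.2) := Prod.ext hp0.symm rfl
      rw [this, hρ0 _ hp.2]
    · exact (div_pos (hupos _ (hΦO p hp).1 (by rwa [(hΦO p hp).2])) (hfac p hp)).le
  -- Replacing the time coordinate by `ρ` turns `a / ρ` into `a / r`; the solution is `Φ` composed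
  -- with the inverse of `G`.
  set G : ℝ × X → ℝ × X := fun p => (ρ p, p.2) with hG
  have hGs : ContDiffOn ℝ ∞ G D := hρs.prodMk contDiffOn_snd
  have hG' : ∀ p ∈ D, ∀ v, fderivWithin ℝ G D p v = (fderivWithin ℝ ρ D p v, v.2) := by
    intro p hp v
    have h1 : HasFDerivWithinAt ρ (fderivWithin ℝ ρ D p) D p :=
      (hρs.differentiableOn (by simp) _ hp).hasFDerivWithinAt
    rw [(h1.prodMk hasFDerivWithinAt_snd).fderivWithin (hUD p hp)]
    rfl
  -- invertibility of the derivative of the collar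
  have hJd : HasFDerivAt J (fderiv ℝ J y₀) y₀ :=
    ((hJ.contDiffAt (hU.mem_nhds hy₀)).differentiableAt (by simp)).hasFDerivAt
  have hΦ'0 : ∀ w, fderivWithin ℝ Φ D (0, y₀) (0, w) = fderiv ℝ J y₀ w := fun w => by
    refine fderivWithin_comp_inr hδ hV hΦ hyV (hJd.congr_of_eventuallyEq ?_) w
    filter_upwards [hV.mem_nhds hyV] with y hy
    exact hΦ0 y hy
  have hΦd : HasFDerivWithinAt Φ (fderivWithin ℝ Φ D (0, y₀)) D (0, y₀) :=
    (hΦ.differentiableOn (by simp) _ h0).hasFDerivWithinAt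
  have hℓΦ : ∀ v, ℓ (fderivWithin ℝ Φ D (0, y₀) v) = v.1 := by
    intro v
    have h1 : HasFDerivWithinAt (fun p => ℓ (Φ p)) (ℓ.comp (fderivWithin ℝ Φ D (0, y₀))) D
      (0, y₀) := ℓ.hasFDerivAt.comp_hasFDerivWithinAt _ hΦd
    have h2 : HasFDerivWithinAt (fun p => ℓ (Φ p)) (ContinuousLinearMap.fst ℝ ℝ X) D (0, y₀) :=
      hasFDerivWithinAt_fst.congr (fun p hp => (hΦO p hp).2) (hΦO _ h0).2
    exact congrArg (fun L => L v) ((hUD _ h0).eq h1 h2)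
  have hdim' : Module.finrank ℝ (ℝ × X) = Module.finrank ℝ Y := by
    rw [hdim, Module.finrank_prod, Module.finrank_self, add_comm]
  have hΦinv : (fderivWithin ℝ Φ D (0, y₀)).IsInvertible := by
    refine isInvertible_of_injective hdim' fun v hv => ?_
    have h1 : v.1 = 0 := by rw [← hℓΦ v, hv, map_zero]
    have h2 : v = (0, v.2) := Prod.ext h1 rfl
    rw [h2, hΦ'0] at hv
    rw [h2, hJinj _ hv]
    rfl
  -- the normal derivative of `ρ` does not vanish
  have hρd : HasFDerivWithinAt ρ (fderivWithin ℝ ρ D (0, y₀)) D (0, y₀) :=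
    (hρs.differentiableOn (by simp) _ h0).hasFDerivWithinAt
  have hρw : ∀ w, fderivWithin ℝ ρ D (0, y₀) (0, w) = 0 := fun w =>
    fderivWithin_comp_inr hδ hV hρs hyV (L := 0)
      ((hasFDerivAt_const (0 : ℝ) y₀).congr_of_eventuallyEq
      (by
        filter_upwards [hV.mem_nhds hyV] with y hy
        exact hρ0 y hy)) w
  -- Otherwise `dρ = 0` at the base point. Since `u ∘ Φ = ρ e^η c` and `ρ = 0` there, also `d(u ∘ Φ)
  -- = 0`, and invertibility of `dΦ` gives `du = 0`.
  have hρr : fderivWithin ℝ ρ D (0, y₀) (1, 0) ≠ 0 := by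
    intro h
    have hρz : fderivWithin ℝ ρ D (0, y₀) = 0 := by
      ext
      · simpa using h
      · simpa using hρw _
    have h1 : HasFDerivWithinAt u (fderivWithin ℝ u (O ∩ {z | 0 ≤ ℓ z}) (Φ (0, y₀)))
        (O ∩ {z | 0 ≤ ℓ z}) (Φ (0, y₀)) :=
      (hu.differentiableOn (by simp) _ (hΦT h0)).hasFDerivWithinAt
    have h2 := h1.comp _ hΦd hΦT
    have h3 : HasFDerivWithinAt (fun p => ρ p * (Real.exp (η p) * c p.2)) _ D (0, y₀) :=
      hρd.mul ((hfacs.differentiableOn (by simp) _ h0).hasFDerivWithinAt)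
    have h4 : HasFDerivWithinAt (fun p => ρ p * (Real.exp (η p) * c p.2))
        ((fderivWithin ℝ u (O ∩ {z | 0 ≤ ℓ z}) (Φ (0, y₀))).comp (fderivWithin ℝ Φ D (0, y₀)))
        D (0, y₀) := h2.congr (fun p hp => div_mul_cancel₀ _ (hfac p hp).ne')
          (div_mul_cancel₀ _ (hfac _ h0).ne')
    have h5 := (hUD _ h0).eq h4 h3
    rw [hρz, hρ0 _ hyV, zero_smul, smul_zero, zero_add, hΦ0 _ hyV] at h5
    obtain ⟨A, hA⟩ := hΦinv
    refine hu' (ContinuousLinearMap.ext fun z => ?_)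
    obtain ⟨v, rfl⟩ := A.surjective z
    have h6 : A v = fderivWithin ℝ Φ D (0, y₀) v := congrArg (fun L => L v) hA
    rw [h6]
    exact congrArg (fun L => L v) h5
  have hGinv : (fderivWithin ℝ G D (0, y₀)).IsInvertible := by
    refine isInvertible_of_injective rfl fun v hv => ?_
    rw [hG' _ h0] at hv
    have h2 : v.2 = 0 := congrArg Prod.snd hv
    have h1 : fderivWithin ℝ ρ D (0, y₀) v = 0 := congrArg Prod.fst hv
    have h3 : v = v.1 • ((1 : ℝ), (0 : X)) := by ext <;> simp [h2]
    rw [h3, map_smul, smul_eq_mul] at h1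
    have h4 := (mul_eq_zero.1 h1).resolve_right hρr
    rw [h3, h4, zero_smul]
  have hfst : ContinuousLinearMap.fst ℝ ℝ X ≠ 0 := fun h => by
    simpa using congrArg (fun L => L ((1 : ℝ), (0 : X))) h
  obtain ⟨Θ, hΘ0, hΘs, hΘG, hΘnn, hΘpos, hΘinv, hΘsymm⟩ := exists_halfSpace_inverse hδ hV hyV hGs
    hfst hρnn hρ0 hGinv
  have hΘ00 : ∀ y, ((0 : ℝ), y) ∈ Θ.source → Θ (0, y) = (0, y) := fun y hy => by
    rw [hΘG _ hy le_rfl]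
    simp only [hG]
    rw [hρ0 y (hΘs hy).2]
  have h0t : ((0 : ℝ), y₀) ∈ Θ.target := by
    rw [← hΘ00 _ hΘ0]
    exact Θ.map_source hΘ0
  have hs00 : Θ.symm (0, y₀) = (0, y₀) := by
    conv_lhs => rw [← hΘ00 _ hΘ0]
    exact Θ.left_inv hΘ0
  have hev : ∀ᶠ p in 𝓝[Ico 0 δ ×ˢ V] ((0 : ℝ), y₀), p ∈ Θ.target ∧ ((0, p.2) ∈ Θ.source ∧
      (p.1 < 0 ∨ (fderivWithin ℝ Φ D (Θ.symm p)).IsInvertible)) := by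
    refine Filter.Eventually.and (mem_nhdsWithin_of_mem_nhds (Θ.open_target.mem_nhds h0t))
      (Filter.Eventually.and ?_ ?_)
    · refine mem_nhdsWithin_of_mem_nhds ?_
      have h1 : ContinuousAt (fun p : ℝ × X => ((0 : ℝ), p.2)) ((0 : ℝ), y₀) := by fun_prop
      exact h1.preimage_mem_nhds (Θ.open_source.mem_nhds hΘ0)
    · have h1 : ∀ᶠ p in 𝓝[D] ((0 : ℝ), y₀), (fderivWithin ℝ Φ D p).IsInvertible :=
        (hΦ.continuousOn_fderivWithin hUD (by simp) _ h0).eventually (isOpen_isInvertible hΦinv)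
      rw [eventually_nhdsWithin_iff] at h1
      have h2 : Tendsto Θ.symm (𝓝 ((0 : ℝ), y₀)) (𝓝 ((0 : ℝ), y₀)) := by
        have := Θ.continuousAt_symm h0t
        rwa [ContinuousAt, hs00] at this
      filter_upwards [mem_nhdsWithin_of_mem_nhds (h2.eventually h1),
        mem_nhdsWithin_of_mem_nhds (Θ.open_target.mem_nhds h0t)] with p hp hpt
      by_cases hp0 : p.1 < 0
      · exact Or.inl hp0
      · right
        have hsrc := Θ.map_target hpt
        refine hp ⟨⟨?_, (hΘs hsrc).1⟩, (hΘs hsrc).2⟩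
        rw [← hΘnn _ hsrc, Θ.right_inv hpt]
        exact not_lt.1 hp0
  obtain ⟨δ', hδ', hδδ', V', hV', hy₀', hVV', hE⟩ := exists_Ico_prod_subset hδ hV hyV hev
  set D' := Ico 0 δ' ×ˢ V' with hD'
  have hUD' : UniqueDiffOn ℝ D' := uniqueDiffOn_Ico_prod hV'
  have hsrc : ∀ p ∈ D', Θ.symm p ∈ Θ.source := fun p hp => Θ.map_target (hE p hp).1
  have hinv : ∀ p ∈ D', Θ (Θ.symm p) = p := fun p hp => Θ.right_inv (hE p hp).1
  have hnn : ∀ p ∈ D', 0 ≤ (Θ.symm p).1 := fun p hp => by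
    rw [← hΘnn _ (hsrc p hp), hinv p hp]
    exact hp.1.1
  have hmD : ∀ p ∈ D', Θ.symm p ∈ D := fun p hp =>
    ⟨⟨hnn p hp, (hΘs (hsrc p hp)).1⟩, (hΘs (hsrc p hp)).2⟩
  have hpos : ∀ p ∈ D', 0 < p.1 → 0 < (Θ.symm p).1 := fun p hp hp0 => by
    rw [← hΘpos _ (hsrc p hp), hinv p hp]
    exact hp0
  have hGsymm : ∀ p ∈ D', G (Θ.symm p) = p := fun p hp => by
    rw [← hΘG _ (hsrc p hp) (hnn p hp), hinv p hp]
  have hsnd : ∀ p ∈ D', (Θ.symm p).2 = p.2 := fun p hp => by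
    have h : (G (Θ.symm p)).2 = p.2 := by rw [hGsymm p hp]
    exact h
  have hρsymm : ∀ p ∈ D', ρ (Θ.symm p) = p.1 := fun p hp => by
    have h : (G (Θ.symm p)).1 = p.1 := by rw [hGsymm p hp]
    exact h
  have hsymm0 : ∀ y ∈ V', Θ.symm (0, y) = (0, y) := fun y hy => by
    have h1 := (hE (0, y) ⟨⟨le_rfl, hδ'⟩, hy⟩).2.1
    conv_lhs => rw [← hΘ00 y h1]
    exact Θ.left_inv h1
  have hsymms : ContDiffOn ℝ ∞ Θ.symm D' := hΘsymm.mono fun p hp => ⟨(hE p hp).1, hp.1.1⟩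
  have huκ : ∀ p ∈ D', u (Φ (Θ.symm p)) = p.1 * (Real.exp (η (Θ.symm p)) * c p.2) := fun p hp => by
    have h1 := hρsymm p hp
    simp only [hρ] at h1
    rw [div_eq_iff (hfac _ (hmD p hp)).ne', hsnd p hp] at h1
    exact h1
  have hκs : ContDiffOn ℝ ∞ (fun p => Φ (Θ.symm p)) D' := hΦ.comp hsymms hmD
  -- `S` is the derivative of the inverse of `G`: injective because `G` undoes it, and preserving
  -- the second component because `G` does.
  have hκd : ∀ p ∈ D', ∃ S : (ℝ × X) →L[ℝ] ℝ × X, S.IsInvertible ∧ (∀ v, (S v).2 = v.2) ∧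
      HasFDerivWithinAt (fun p => Φ (Θ.symm p)) ((fderivWithin ℝ Φ D (Θ.symm p)).comp S) D' p := by
    intro p hp
    have h1 : HasFDerivWithinAt Θ.symm (fderivWithin ℝ Θ.symm D' p) D' p :=
      (hsymms.differentiableOn (by simp) _ hp).hasFDerivWithinAt
    have h2 : HasFDerivWithinAt Φ (fderivWithin ℝ Φ D (Θ.symm p)) D (Θ.symm p) :=
      (hΦ.differentiableOn (by simp) _ (hmD p hp)).hasFDerivWithinAt
    have h3 : HasFDerivWithinAt G (fderivWithin ℝ G D (Θ.symm p)) D (Θ.symm p) :=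
      (hGs.differentiableOn (by simp) _ (hmD p hp)).hasFDerivWithinAt
    have h4 : HasFDerivWithinAt (fun p => p) ((fderivWithin ℝ G D (Θ.symm p)).comp
        (fderivWithin ℝ Θ.symm D' p)) D' p :=
      (h3.comp p h1 hmD).congr (fun q hq => (hGsymm q hq).symm) (hGsymm p hp).symm
    have h5 := (hUD' p hp).eq h4 (hasFDerivWithinAt_id p D')
    have h6 : ∀ v, fderivWithin ℝ G D (Θ.symm p) (fderivWithin ℝ Θ.symm D' p v) = v := fun v =>
      congrArg (fun L => L v) h5
    refine ⟨fderivWithin ℝ Θ.symm D' p, ?_, fun v => ?_, h2.comp p h1 hmD⟩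
    · refine isInvertible_of_injective rfl fun v hv => ?_
      rw [← h6 v, hv, map_zero]
    · have h7 := congrArg Prod.snd (h6 v)
      rwa [hG' _ (hmD p hp)] at h7
  refine ⟨δ', hδ', V', hV', hy₀', hVV'.trans hVU, fun p => Φ (Θ.symm p), ⟨hκs, fun y hy => ?_,
    fun p hp hp0 => ?_, fun p hp => ?_, fun p hp hp0 v => ?_⟩, fun p hp => (hΦO _ (hmD p hp)).1,
    fun y hy => ?_⟩
  · rw [hsymm0 y hy, hΦ0 y (hVV' hy)]
  · rw [(hΦO _ (hmD p hp)).2]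
    exact hpos p hp hp0
  · obtain ⟨S, hS, -, hd⟩ := hκd p hp
    rw [hd.fderivWithin (hUD' p hp)]
    exact ((hE p hp).2.2.resolve_left (not_lt.2 hp.1.1)).comp hS
  · obtain ⟨S, -, hS, hd⟩ := hκd p hp
    rw [(hd.hasFDerivAt (Ico_prod_mem_nhds hV' hp hp0)).fderiv]
    have hz := hmD p hp
    have hz0 := hpos p hp hp0
    have h1 := hΦβ _ hz hz0 (S v)
    rw [hβlam _ (hΦO _ hz).1 (by rwa [(hΦO _ hz).2]), smul_apply, smul_eq_mul, huκ p hp, hS,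
      hsnd p hp] at h1
    rw [fderivWithin_of_mem_nhds (Ico_prod_mem_nhds hV hz hz0), ContinuousLinearMap.comp_apply]
    have h2 : Real.exp (η (Θ.symm p)) * c p.2 ≠ 0 :=
      (mul_pos (Real.exp_pos _) (hcpos _ (hVU (hVV' hp.2)))).ne'
    rw [div_mul_eq_mul_div, one_mul, eq_div_iff hp0.ne']
    refine mul_left_cancel₀ h2 ?_
    linarith
  · have h0' : ((0 : ℝ), y) ∈ D' := ⟨⟨le_rfl, hδ'⟩, hy⟩
    have h1 : ContinuousWithinAt (fun r : ℝ => Real.exp (η (Θ.symm (r, y))) * c y)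
        (Ico 0 δ') 0 := by
      have h2 : ContinuousOn (fun r : ℝ => η (Θ.symm (r, y))) (Ico 0 δ') :=
        hη.continuousOn.comp (hsymms.continuousOn.comp (by fun_prop) fun r hr => ⟨hr, hy⟩)
          fun r hr => hmD _ ⟨hr, hy⟩
      exact ((Real.continuous_exp.comp_continuousOn h2).mul continuousOn_const) 0 ⟨le_rfl, hδ'⟩
    -- By `huκ` the slope at `0` is exactly `e^η c`, and `η` tends to `0`.
    have h3 : HasDerivWithinAt (fun r => u (Φ (Θ.symm (r, y)))) (c y) (Ico 0 δ') 0 := by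
      rw [hasDerivWithinAt_iff_tendsto_slope]
      have h4 : Tendsto (fun r : ℝ => Real.exp (η (Θ.symm (r, y))) * c y) (𝓝[Ico 0 δ' \ {0}] 0)
          (𝓝 (c y)) := by
        have h5 := h1.tendsto.mono_left
          (nhdsWithin_mono 0 (sdiff_subset (s := Ico 0 δ') (t := {0})))
        rwa [hsymm0 y hy, (hΦη0 y (hVV' hy)).2, Real.exp_zero, one_mul] at h5
      refine h4.congr' ?_
      filter_upwards [self_mem_nhdsWithin] with r hr
      rw [slope_def_field, huκ (r, y) ⟨hr.1, hy⟩, huκ _ h0']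
      have h6 : r ≠ 0 := hr.2
      field_simp
      ring
    exact h3.mono_of_mem_nhdsWithin (Ico_mem_nhdsGE hδ')

end Existence

/-! ### One-forms on manifolds as covector fields in charts. -/

section Covectors

variable {E : Type*} [NormedAddCommGroup E] [NormedSpace ℝ E]
  {H : Type*} [TopologicalSpace H] {I : ModelWithCorners ℝ E H}
  {M : Type*} [TopologicalSpace M] [ChartedSpace H M]
  {E' : Type*} [NormedAddCommGroup E'] [NormedSpace ℝ E']
  {H' : Type*} [TopologicalSpace H'] {I' : ModelWithCorners ℝ E' H'}
  {N : Type*} [TopologicalSpace N] [ChartedSpace H' N]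

/-- The covector given by an alternating form of degree one. -/
def toDual (E : Type*) [NormedAddCommGroup E] [NormedSpace ℝ E] :
    (E [⋀^Fin 1]→L[ℝ] ℝ) →L[ℝ] E →L[ℝ] ℝ :=
  ((ContinuousAlternatingMap.ofSubsingletonLIE (𝕜 := ℝ) (E := E) (F := ℝ)
    (0 : Fin 1)).symm.toContinuousLinearEquiv : (E [⋀^Fin 1]→L[ℝ] ℝ) →L[ℝ] E →L[ℝ] ℝ)

lemma toDual_apply (f : E [⋀^Fin 1]→L[ℝ] ℝ) (v : E) : toDual E f v = f ![v] := by
  have h : (fun _ => v : Fin 1 → E) = ![v] := by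
    ext i
    fin_cases i
    rfl
  rw [← h]
  obtain ⟨g, rfl⟩ := (ContinuousAlternatingMap.ofSubsingletonLIE (𝕜 := ℝ) (E := E) (F := ℝ)
    (0 : Fin 1)).surjective f
  have h1 : toDual E (ContinuousAlternatingMap.ofSubsingletonLIE (0 : Fin 1) g) = g :=
    (ContinuousAlternatingMap.ofSubsingletonLIE (𝕜 := ℝ) (E := E) (F := ℝ)
      (0 : Fin 1)).symm_apply_apply g
  rw [h1]
  rfl

/-- The derivative of a map between manifolds, as a linear map between the model spaces. -/
def derivAt (I : ModelWithCorners ℝ E H) (I' : ModelWithCorners ℝ E' H') (f : M → N) (x : M) :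
    E →L[ℝ] E' :=
  mfderiv I I' f x

/-- The derivative within a set of a map between manifolds, as a linear map between the model
spaces. -/
def derivWithinAt (I : ModelWithCorners ℝ E H) (I' : ModelWithCorners ℝ E' H') (f : M → N)
    (s : Set M) (x : M) : E →L[ℝ] E' :=
  mfderivWithin I I' f s x

/-- A 1-form, as a field of covectors on the model space. -/
def covector (Ω : DiffForm I M 1) (x : M) : E →L[ℝ] ℝ :=
  toDual E (Ω x)

lemma covector_apply (Ω : DiffForm I M 1) (x : M) (v : TangentSpace I x) :
    covector Ω x v = Ω x ![v] :=
  toDual_apply (E := E) (Ω x) v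

lemma eq_of_covector_eq {Ω Ω' : DiffForm I M 1} {x : M} (h : covector Ω x = covector Ω' x) :
    Ω x = Ω' x := by
  refine ContinuousAlternatingMap.ext fun v => ?_
  have h1 : v = ![v 0] := by
    ext i
    fin_cases i
    rfl
  rw [h1, ← covector_apply, ← covector_apply, h]

/-- The expression in a chart of a 1-form, as a field of covectors. -/
def chartCovector (Ω : DiffForm I M 1) (x₀ : M) (y : E) : E →L[ℝ] ℝ :=
  toDual E (localRep Ω x₀ y)

lemma chartCovector_apply (Ω : DiffForm I M 1) (x₀ : M) (y v : E) :
    chartCovector Ω x₀ y v = covector Ω ((extChartAt I x₀).symm y)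
      (derivWithinAt 𝓘(ℝ, E) I (extChartAt I x₀).symm (range I) y v) := by
  rw [chartCovector, toDual_apply, localRep]
  refine Eq.trans ?_ (covector_apply Ω ((extChartAt I x₀).symm y)
    (mfderivWithin 𝓘(ℝ, E) I (extChartAt I x₀).symm (range I) y v)).symm
  change (Ω ((extChartAt I x₀).symm y)) _ = _
  congr 1
  ext i
  fin_cases i
  rfl

lemma covector_pullback (f : M → N) (Ω : DiffForm I' N 1) (x : M) (v : E) :
    covector (pullback f Ω : DiffForm I M 1) x v = covector Ω (f x) (derivAt I I' f x v) := by
  refine (covector_apply (pullback f Ω : DiffForm I M 1) x v).trans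
    (Eq.trans ?_ (covector_apply Ω (f x) (mfderiv I I' f x v)).symm)
  change (Ω (f x)) _ = _
  congr 1
  ext i
  fin_cases i
  rfl

lemma derivWithinAt_symm_derivAt [IsManifold I 1 M] {x₀ x : M}
    (hx : x ∈ (extChartAt I x₀).source) (v : E) :
    derivWithinAt 𝓘(ℝ, E) I (extChartAt I x₀).symm (range I) (extChartAt I x₀ x)
      (derivAt I 𝓘(ℝ, E) (extChartAt I x₀) x v) = v :=
  congrArg (fun L => L v) (mfderivWithin_extChartAt_symm_comp_mfderiv_extChartAt' hx)

lemma chartCovector_derivAt [IsManifold I 1 M] (Ω : DiffForm I M 1) {x₀ x : M}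
    (hx : x ∈ (extChartAt I x₀).source) (v : E) :
    chartCovector Ω x₀ (extChartAt I x₀ x) (derivAt I 𝓘(ℝ, E) (extChartAt I x₀) x v) =
      covector Ω x v := by
  rw [chartCovector_apply, derivWithinAt_symm_derivAt hx, (extChartAt I x₀).left_inv hx]

/-- The derivative of the preferred chart at its own base point is the identity, under the
identification of the tangent space with the model space. -/
lemma chartCovector_self [IsManifold I 1 M] (Ω : DiffForm I M 1) (x₀ : M) :
    chartCovector Ω x₀ (extChartAt I x₀ x₀) = covector Ω x₀ := by
  ext v
  have h : derivAt I 𝓘(ℝ, E) (extChartAt I x₀) x₀ v = v :=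
    congrArg (fun L => L v) (mfderiv_extChartAt_self (I := I) (x := x₀))
  rw [← chartCovector_derivAt Ω (mem_extChartAt_source (I := I) x₀) v, h]

lemma contDiffOn_chartCovector {Ω : DiffForm I M 1} {U : Set M} (h : IsSmoothFormOn Ω U) (x₀ : M) :
    ContDiffOn ℝ ∞ (chartCovector Ω x₀)
      ((extChartAt I x₀).target ∩ (extChartAt I x₀).symm ⁻¹' U) :=
  (toDual E).contDiff.comp_contDiffOn (h x₀)

lemma contDiffOn_chartCovector_univ {Ω : DiffForm I M 1} (h : IsSmoothFormOn Ω univ) (x₀ : M) :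
    ContDiffOn ℝ ∞ (chartCovector Ω x₀) (extChartAt I x₀).target := by
  have := contDiffOn_chartCovector h x₀
  rwa [preimage_univ, inter_univ] at this

lemma extD_apply {Ω : DiffForm I M 1} (h : IsSmoothFormOn Ω univ) (x : M) (v w : E) :
    (extD Ω x : E [⋀^Fin 2]→L[ℝ] ℝ) ![v, w] =
      fderivWithin ℝ (chartCovector Ω x) (range I) (extChartAt I x x) v w -
        fderivWithin ℝ (chartCovector Ω x) (range I) (extChartAt I x x) w v := by
  have hd : DifferentiableWithinAt ℝ (localRep Ω x) (range I) (extChartAt I x x) := by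
    have h1 := h x
    rw [preimage_univ, inter_univ] at h1
    exact (h1.differentiableOn (by simp) _ (mem_extChartAt_target x)).mono_of_mem_nhdsWithin
      (extChartAt_target_mem_nhdsWithin x)
  have hu : UniqueDiffWithinAt ℝ (range I) (extChartAt I x x) :=
    I.uniqueDiffOn _ (mem_range_self _)
  have h2 : ∀ v w, fderivWithin ℝ (chartCovector Ω x) (range I) (extChartAt I x x) v w =
      fderivWithin ℝ (localRep Ω x) (range I) (extChartAt I x x) v ![w] := by
    intro v w
    have h3 : HasFDerivWithinAt (chartCovector Ω x) _ (range I) (extChartAt I x x) :=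
      (toDual E).hasFDerivAt.comp_hasFDerivWithinAt _ hd.hasFDerivWithinAt
    rw [h3.fderivWithin hu, ← toDual_apply]
    rfl
  change extDerivWithin (localRep Ω x) (range I) (extChartAt I x x) ![v, w] = _
  rw [extDerivWithin, ContinuousAlternatingMap.alternatizeUncurryFin_apply, Fin.sum_univ_two,
    h2, h2]
  have e0 : Fin.removeNth (0 : Fin 2) ![v, w] = ![w] := by
    ext i; fin_cases i; rfl
  have e1 : Fin.removeNth (1 : Fin 2) ![v, w] = ![v] := by
    ext i; fin_cases i; rfl
  rw [e0, e1]
  simp [sub_eq_add_neg]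

end Covectors

/-! ### Contact forms in charts. -/

section Contact

variable {m : ℕ} {K : Type*} [TopologicalSpace K]
  [ChartedSpace (EuclideanSpace ℝ (Fin (2 * m + 1))) K] [IsManifold (𝓡 (2 * m + 1)) ∞ K]

/-- At the centre of the chart both `α` and `extD α` are read off from `chartCovector` without
change of basis, so the nonvanishing of `α ∧ (dα)^m` gives the two conditions for invertibility. -/
lemma IsContactForm.isInvertible_contactOp {α : DiffForm (𝓡 (2 * m + 1)) K 1}
    (h : IsContactForm α) (q : K) :
    (contactOp (chartCovector α q (extChartAt (𝓡 (2 * m + 1)) q q))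
      (fderiv ℝ (chartCovector α q) (extChartAt (𝓡 (2 * m + 1)) q q))).IsInvertible := by
  have : IsManifold (𝓡 (2 * m + 1)) 1 K := .of_le (m := 1) (n := ∞) (by simp)
  have hfd : FiniteDimensional ℝ (TangentSpace (𝓡 (2 * m + 1)) q) :=
    inferInstanceAs (FiniteDimensional ℝ (EuclideanSpace ℝ (Fin (2 * m + 1))))
  have hfr : Module.finrank ℝ (TangentSpace (𝓡 (2 * m + 1)) q) = 2 * m + 1 :=
    finrank_euclideanSpace_fin (𝕜 := ℝ) (n := 2 * m + 1)
  obtain ⟨v, hv⟩ := h.contact q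
  rw [chartCovector_self]
  refine IdealLiouville.isInvertible_contactOp ?_ fun z g hz hzd => ?_
  · obtain ⟨w, hw⟩ := exists_ne_zero_of_wedgePow_ne_zero hv
    exact ⟨w, by rwa [← covector_apply] at hw⟩
  · refine eq_zero_of_wedgePow_ne_zero hfr hv (z := z) (g := g) ?_ fun w => ?_
    · exact (covector_apply α q z).symm.trans hz
    · refine (extD_apply h.smooth q z w).trans ?_
      rw [← covector_apply, modelWithCornersSelf_coe, range_id, fderivWithin_univ]
      exact hzd w

end Contact

/-! ### Collars of a manifold, and their expressions in charts. -/

section Collar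

variable {X : Type*} [NormedAddCommGroup X] [NormedSpace ℝ X]
  {K : Type*} [TopologicalSpace K] [ChartedSpace X K]
  {Y : Type*} [NormedAddCommGroup Y] [NormedSpace ℝ Y]
  {H : Type*} [TopologicalSpace H] {I : ModelWithCorners ℝ Y H}
  {F : Type*} [TopologicalSpace F] [ChartedSpace H F]

/-- A local diffeomorphism `κ : [0, δ) × V → F` which extends `j : V → F` and pulls `lam` back to
`r⁻¹ • α`. -/
structure IsCollar (I : ModelWithCorners ℝ Y H) (j : K → F) (lam : DiffForm I F 1)
    (α : DiffForm 𝓘(ℝ, X) K 1) (δ : ℝ) (V : Set K) (κ : ℝ × K → F) : Prop where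
  contMDiffOn : ContMDiffOn (𝓘(ℝ, ℝ).prod 𝓘(ℝ, X)) I ∞ κ (Ico 0 δ ×ˢ V)
  zero : ∀ q ∈ V, κ (0, q) = j q
  mem_interior : ∀ p ∈ Ico 0 δ ×ˢ V, 0 < p.1 → κ p ∈ I.interior F
  isInvertible : ∀ p ∈ Ico 0 δ ×ˢ V,
    (derivWithinAt (𝓘(ℝ, ℝ).prod 𝓘(ℝ, X)) I κ (Ico 0 δ ×ˢ V) p).IsInvertible
  pullback_eq : ∀ p ∈ Ico 0 δ ×ˢ V, 0 < p.1 → ∀ v : ℝ × X,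
    covector lam (κ p) (derivAt (𝓘(ℝ, ℝ).prod 𝓘(ℝ, X)) I κ p v) = 1 / p.1 * covector α p.2 v.2

lemma uniqueMDiffOn_Ico_prod {δ : ℝ} {V : Set K} (hV : IsOpen V) :
    UniqueMDiffOn (𝓘(ℝ, ℝ).prod 𝓘(ℝ, X)) (Ico 0 δ ×ˢ V) :=
  (uniqueDiffOn_Ico (0 : ℝ) δ).uniqueMDiffOn.prod hV.uniqueMDiffOn

section Charts

variable [IsManifold 𝓘(ℝ, X) ∞ K] [IsManifold I ∞ F] {S : Set ℝ} {V : Set K} {W : Set X}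
  {q₀ : K} {x₀ : F}

lemma contMDiffOn_prod_extChartAt_symm (hW : W ⊆ (extChartAt 𝓘(ℝ, X) q₀).target) :
    ContMDiffOn 𝓘(ℝ, ℝ × X) (𝓘(ℝ, ℝ).prod 𝓘(ℝ, X)) ∞
      (fun p : ℝ × X => (p.1, (extChartAt 𝓘(ℝ, X) q₀).symm p.2)) (S ×ˢ W) :=
  contDiff_fst.contMDiff.contMDiffOn.prodMk ((contMDiffOn_extChartAt_symm q₀).comp
    contDiff_snd.contMDiff.contMDiffOn fun _ hp => hW hp.2)

lemma contMDiffOn_prod_extChartAt (hV : V ⊆ (extChartAt 𝓘(ℝ, X) q₀).source) :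
    ContMDiffOn (𝓘(ℝ, ℝ).prod 𝓘(ℝ, X)) 𝓘(ℝ, ℝ × X) ∞
      (fun p : ℝ × K => (p.1, extChartAt 𝓘(ℝ, X) q₀ p.2)) (S ×ˢ V) := by
  have h := contMDiffOn_extChartAt (I := 𝓘(ℝ, X)) (x := q₀) (n := ∞)
  rw [← extChartAt_source 𝓘(ℝ, X) q₀] at h
  exact contMDiff_fst.contMDiffOn.prodMk_space (h.comp contMDiff_snd.contMDiffOn
    fun p hp => hV hp.2)

/-- The expression in charts of a map defined on `ℝ × K`. -/
lemma contDiffOn_written {κ : ℝ × K → F}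
    (hκ : ContMDiffOn (𝓘(ℝ, ℝ).prod 𝓘(ℝ, X)) I ∞ κ (S ×ˢ V))
    (hW : W ⊆ (extChartAt 𝓘(ℝ, X) q₀).target)
    (hWV : MapsTo (extChartAt 𝓘(ℝ, X) q₀).symm W V)
    (hκW : ∀ p ∈ S ×ˢ W, κ (p.1, (extChartAt 𝓘(ℝ, X) q₀).symm p.2) ∈ (extChartAt I x₀).source) :
    ContDiffOn ℝ ∞ (fun p : ℝ × X =>
      extChartAt I x₀ (κ (p.1, (extChartAt 𝓘(ℝ, X) q₀).symm p.2))) (S ×ˢ W) := by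
  rw [← contMDiffOn_iff_contDiffOn]
  have h := contMDiffOn_extChartAt (I := I) (x := x₀) (n := ∞)
  rw [← extChartAt_source I x₀] at h
  exact h.comp (hκ.comp (contMDiffOn_prod_extChartAt_symm hW) fun p hp => ⟨hp.1, hWV hp.2⟩) hκW

lemma hasFDerivWithinAt_written {κ : ℝ × K → F}
    (hκ : ContMDiffOn (𝓘(ℝ, ℝ).prod 𝓘(ℝ, X)) I ∞ κ (S ×ˢ V))
    (hW : W ⊆ (extChartAt 𝓘(ℝ, X) q₀).target)
    (hWV : MapsTo (extChartAt 𝓘(ℝ, X) q₀).symm W V)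
    (hκW : ∀ p ∈ S ×ˢ W, κ (p.1, (extChartAt 𝓘(ℝ, X) q₀).symm p.2) ∈ (extChartAt I x₀).source)
    {p : ℝ × X} (hp : p ∈ S ×ˢ W) :
    HasFDerivWithinAt (fun p : ℝ × X =>
        extChartAt I x₀ (κ (p.1, (extChartAt 𝓘(ℝ, X) q₀).symm p.2)))
      ((derivAt I 𝓘(ℝ, Y) (extChartAt I x₀) (κ (p.1, (extChartAt 𝓘(ℝ, X) q₀).symm p.2))).comp
        ((derivWithinAt (𝓘(ℝ, ℝ).prod 𝓘(ℝ, X)) I κ (S ×ˢ V)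
          (p.1, (extChartAt 𝓘(ℝ, X) q₀).symm p.2)).comp
        ((ContinuousLinearMap.fst ℝ ℝ X).prod
          ((derivWithinAt 𝓘(ℝ, X) 𝓘(ℝ, X) (extChartAt 𝓘(ℝ, X) q₀).symm (range 𝓘(ℝ, X)) p.2).comp
          (ContinuousLinearMap.snd ℝ ℝ X))))) (S ×ˢ W) p := by
  have : IsManifold 𝓘(ℝ, X) 1 K := .of_le (m := 1) (n := ∞) (by simp)
  have : IsManifold I 1 F := .of_le (m := 1) (n := ∞) (by simp)
  have h1 : HasMFDerivWithinAt 𝓘(ℝ, X) 𝓘(ℝ, X) (extChartAt 𝓘(ℝ, X) q₀).symm (range 𝓘(ℝ, X)) p.2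
      (mfderivWithin 𝓘(ℝ, X) 𝓘(ℝ, X) (extChartAt 𝓘(ℝ, X) q₀).symm (range 𝓘(ℝ, X)) p.2) :=
    (mdifferentiableWithinAt_extChartAt_symm (hW hp.2)).hasMFDerivWithinAt
  have h2 : HasMFDerivWithinAt 𝓘(ℝ, ℝ × X) 𝓘(ℝ, X) (Prod.snd : ℝ × X → X) (S ×ˢ W) p
      (ContinuousLinearMap.snd ℝ ℝ X) := hasFDerivWithinAt_snd.hasMFDerivWithinAt
  have h3 : HasMFDerivWithinAt 𝓘(ℝ, ℝ × X) 𝓘(ℝ, ℝ) (Prod.fst : ℝ × X → ℝ) (S ×ˢ W) p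
      (ContinuousLinearMap.fst ℝ ℝ X) := hasFDerivWithinAt_fst.hasMFDerivWithinAt
  have h4 := h3.prodMk (h1.comp p h2 fun q hq => by simp)
  have h5 : HasMFDerivWithinAt (𝓘(ℝ, ℝ).prod 𝓘(ℝ, X)) I κ (S ×ˢ V)
      (p.1, (extChartAt 𝓘(ℝ, X) q₀).symm p.2) _ :=
    ((hκ.mdifferentiableOn (by simp)) _ ⟨hp.1, hWV hp.2⟩).hasMFDerivWithinAt
  have h6 : HasMFDerivAt I 𝓘(ℝ, Y) (extChartAt I x₀)
      (κ (p.1, (extChartAt 𝓘(ℝ, X) q₀).symm p.2)) _ :=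
    (mdifferentiableAt_extChartAt (by
      rw [← extChartAt_source I]; exact hκW p hp)).hasMFDerivAt
  have hm : S ×ˢ W ⊆ (fun q : ℝ × X => (q.1, (extChartAt 𝓘(ℝ, X) q₀).symm q.2)) ⁻¹' (S ×ˢ V) :=
    fun q hq => ⟨hq.1, hWV hq.2⟩
  have h7 := h6.comp_hasMFDerivWithinAt p (h5.comp p h4 hm)
  exact h7.hasFDerivWithinAt

lemma isInvertible_fst_prod {A : X →L[ℝ] X} (hA : A.IsInvertible) :
    ((ContinuousLinearMap.fst ℝ ℝ X).prod
      (A.comp (ContinuousLinearMap.snd ℝ ℝ X))).IsInvertible := by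
  obtain ⟨e, rfl⟩ := hA
  exact ⟨(ContinuousLinearEquiv.refl ℝ ℝ).prodCongr e, ContinuousLinearMap.ext fun _ => rfl⟩

lemma isInvertible_derivAt_extChartAt {x : F} (hx : x ∈ (extChartAt I x₀).source) :
    (derivAt I 𝓘(ℝ, Y) (extChartAt I x₀) x).IsInvertible := by
  have : IsManifold I 1 F := .of_le (m := 1) (n := ∞) (by simp)
  exact isInvertible_mfderiv_extChartAt hx

lemma isInvertible_derivWithinAt_extChartAt_symm {y : Y} (hy : y ∈ (extChartAt I x₀).target) :
    (derivWithinAt 𝓘(ℝ, Y) I (extChartAt I x₀).symm (range I) y).IsInvertible := by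
  have : IsManifold I 1 F := .of_le (m := 1) (n := ∞) (by simp)
  exact isInvertible_mfderivWithin_extChartAt_symm hy

lemma derivWithinAt_of_mem_nhds {E E' H H' M N : Type*} [NormedAddCommGroup E] [NormedSpace ℝ E]
    [TopologicalSpace H] {I : ModelWithCorners ℝ E H}
    [TopologicalSpace M] [ChartedSpace H M]
    [NormedAddCommGroup E'] [NormedSpace ℝ E']
    [TopologicalSpace H'] {I' : ModelWithCorners ℝ E' H'}
    [TopologicalSpace N] [ChartedSpace H' N] {f : M → N} {s : Set M} {x : M}
    (h : s ∈ 𝓝 x) : derivWithinAt I I' f s x = derivAt I I' f x :=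
  mfderivWithin_of_mem_nhds h

/-- A collar is a model solution in charts. -/
lemma IsCollar.isModelSolution {j : K → F} {lam : DiffForm I F 1}
    {α : DiffForm 𝓘(ℝ, X) K 1} {δ : ℝ} {κ : ℝ × K → F} (h : IsCollar I j lam α δ V κ)
    (hVo : IsOpen V) {δ' : ℝ} (hδ' : δ' ≤ δ) (hWo : IsOpen W)
    (hW : W ⊆ (extChartAt 𝓘(ℝ, X) q₀).target)
    (hWV : MapsTo (extChartAt 𝓘(ℝ, X) q₀).symm W V)
    (hκW : ∀ p ∈ Ico 0 δ' ×ˢ W,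
      κ (p.1, (extChartAt 𝓘(ℝ, X) q₀).symm p.2) ∈ (extChartAt I x₀).source)
    {ℓ : Y →L[ℝ] ℝ}
    (hℓ : ∀ x ∈ (extChartAt I x₀).source, x ∈ I.interior F → 0 < ℓ (extChartAt I x₀ x)) :
    IsModelSolution ℓ (chartCovector lam x₀) (chartCovector α q₀)
      (fun y => extChartAt I x₀ (j ((extChartAt 𝓘(ℝ, X) q₀).symm y))) δ' W
      (fun p => extChartAt I x₀ (κ (p.1, (extChartAt 𝓘(ℝ, X) q₀).symm p.2))) := by
  have : IsManifold 𝓘(ℝ, X) 1 K := .of_le (m := 1) (n := ∞) (by simp)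
  have : IsManifold I 1 F := .of_le (m := 1) (n := ∞) (by simp)
  have hsub : Ico 0 δ' ×ˢ V ⊆ Ico 0 δ ×ˢ V := prod_mono_left (Ico_subset_Ico_right hδ')
  have hmem : ∀ p ∈ Ico 0 δ' ×ˢ W, (p.1, (extChartAt 𝓘(ℝ, X) q₀).symm p.2) ∈ Ico 0 δ ×ˢ V :=
    fun p hp => hsub ⟨hp.1, hWV hp.2⟩
  have hW' : Ico 0 δ' ×ˢ W ⊆ Ico 0 δ ×ˢ W := prod_mono_left (Ico_subset_Ico_right hδ')
  have hd : ∀ p ∈ Ico 0 δ' ×ˢ W, HasFDerivWithinAt (fun p : ℝ × X =>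
        extChartAt I x₀ (κ (p.1, (extChartAt 𝓘(ℝ, X) q₀).symm p.2)))
      ((derivAt I 𝓘(ℝ, Y) (extChartAt I x₀) (κ (p.1, (extChartAt 𝓘(ℝ, X) q₀).symm p.2))).comp
        ((derivWithinAt (𝓘(ℝ, ℝ).prod 𝓘(ℝ, X)) I κ (Ico 0 δ ×ˢ V)
          (p.1, (extChartAt 𝓘(ℝ, X) q₀).symm p.2)).comp
        ((ContinuousLinearMap.fst ℝ ℝ X).prod
          ((derivWithinAt 𝓘(ℝ, X) 𝓘(ℝ, X) (extChartAt 𝓘(ℝ, X) q₀).symm (range 𝓘(ℝ, X)) p.2).comp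
          (ContinuousLinearMap.snd ℝ ℝ X))))) (Ico 0 δ' ×ˢ W) p := by
    intro p hp
    have h1 := hasFDerivWithinAt_written (h.contMDiffOn.mono hsub) hW hWV hκW hp
    have h2 : derivWithinAt (𝓘(ℝ, ℝ).prod 𝓘(ℝ, X)) I κ (Ico 0 δ' ×ˢ V)
        (p.1, (extChartAt 𝓘(ℝ, X) q₀).symm p.2) =
        derivWithinAt (𝓘(ℝ, ℝ).prod 𝓘(ℝ, X)) I κ (Ico 0 δ ×ˢ V)
        (p.1, (extChartAt 𝓘(ℝ, X) q₀).symm p.2) :=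
      mfderivWithin_subset hsub (uniqueMDiffOn_Ico_prod hVo _ ⟨hp.1, hWV hp.2⟩)
        (h.contMDiffOn.mdifferentiableOn (by simp) _ (hmem p hp))
    rwa [h2] at h1
  refine ⟨contDiffOn_written (h.contMDiffOn.mono hsub) hW hWV hκW, fun y hy => ?_,
    fun p hp hp0 => ?_, fun p hp => ?_, fun p hp hp0 v => ?_⟩
  · rw [h.zero _ (hWV hy)]
  · exact hℓ _ (hκW p hp) (h.mem_interior _ (hmem p hp) hp0)
  · rw [(hd p hp).fderivWithin (uniqueDiffOn_Ico_prod hWo p hp)]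
    exact (isInvertible_derivAt_extChartAt (hκW p hp)).comp ((h.isInvertible _ (hmem p hp)).comp
      (isInvertible_fst_prod (isInvertible_derivWithinAt_extChartAt_symm (hW hp.2))))
  · rw [((hd p hp).hasFDerivAt (Ico_prod_mem_nhds hWo hp hp0)).fderiv,
      derivWithinAt_of_mem_nhds (Ico_prod_mem_nhds hVo (hmem p hp) hp0),
      ContinuousLinearMap.comp_apply, chartCovector_derivAt lam (hκW p hp),
      ContinuousLinearMap.comp_apply, h.pullback_eq _ (hmem p hp) hp0, chartCovector_apply]
    rfl

/-- A model solution in charts gives a collar. -/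
lemma IsModelSolution.isCollar {j : K → F} {lam : DiffForm I F 1}
    {α : DiffForm 𝓘(ℝ, X) K 1} {δ : ℝ} {κ : ℝ × X → Y} {ℓ : Y →L[ℝ] ℝ}
    (h : IsModelSolution ℓ (chartCovector lam x₀) (chartCovector α q₀)
      (fun y => extChartAt I x₀ (j ((extChartAt 𝓘(ℝ, X) q₀).symm y))) δ W κ)
    (hWo : IsOpen W) (hκW : MapsTo κ (Ico 0 δ ×ˢ W) (extChartAt I x₀).target)
    (hjW : ∀ y ∈ W, j ((extChartAt 𝓘(ℝ, X) q₀).symm y) ∈ (extChartAt I x₀).source)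
    (hℓ : ∀ z ∈ (extChartAt I x₀).target, 0 < ℓ z → (extChartAt I x₀).symm z ∈ I.interior F) :
    IsCollar I j lam α δ ((extChartAt 𝓘(ℝ, X) q₀).source ∩ extChartAt 𝓘(ℝ, X) q₀ ⁻¹' W)
      (fun p => (extChartAt I x₀).symm (κ (p.1, extChartAt 𝓘(ℝ, X) q₀ p.2))) := by
  have : IsManifold 𝓘(ℝ, X) 1 K := .of_le (m := 1) (n := ∞) (by simp)
  have : IsManifold I 1 F := .of_le (m := 1) (n := ∞) (by simp)
  set V := (extChartAt 𝓘(ℝ, X) q₀).source ∩ extChartAt 𝓘(ℝ, X) q₀ ⁻¹' W with hV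
  have hVo : IsOpen V := isOpen_extChartAt_preimage' q₀ hWo
  have hVW : ∀ p ∈ Ico 0 δ ×ˢ V, (p.1, extChartAt 𝓘(ℝ, X) q₀ p.2) ∈ Ico 0 δ ×ˢ W :=
    fun p hp => ⟨hp.1, hp.2.2⟩
  have hd : ∀ p ∈ Ico 0 δ ×ˢ V, HasMFDerivWithinAt (𝓘(ℝ, ℝ).prod 𝓘(ℝ, X)) I
      (fun p => (extChartAt I x₀).symm (κ (p.1, extChartAt 𝓘(ℝ, X) q₀ p.2))) (Ico 0 δ ×ˢ V) p
      ((derivWithinAt 𝓘(ℝ, Y) I (extChartAt I x₀).symm (range I)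
          (κ (p.1, extChartAt 𝓘(ℝ, X) q₀ p.2))).comp
        ((fderivWithin ℝ κ (Ico 0 δ ×ˢ W) (p.1, extChartAt 𝓘(ℝ, X) q₀ p.2)).comp
        ((ContinuousLinearMap.fst ℝ ℝ X).prod
          ((derivAt 𝓘(ℝ, X) 𝓘(ℝ, X) (extChartAt 𝓘(ℝ, X) q₀) p.2).comp
          (ContinuousLinearMap.snd ℝ ℝ X))))) := by
    intro p hp
    have h1 : HasMFDerivAt 𝓘(ℝ, X) 𝓘(ℝ, X) (extChartAt 𝓘(ℝ, X) q₀) p.2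
        (mfderiv 𝓘(ℝ, X) 𝓘(ℝ, X) (extChartAt 𝓘(ℝ, X) q₀) p.2) :=
      (mdifferentiableAt_extChartAt
        (by rw [← extChartAt_source 𝓘(ℝ, X)]; exact hp.2.1)).hasMFDerivAt
    have h2 := hasMFDerivWithinAt_snd (I := 𝓘(ℝ, ℝ)) (I' := 𝓘(ℝ, X)) (s := Ico 0 δ ×ˢ V) p
    have h3 := hasMFDerivWithinAt_fst (I := 𝓘(ℝ, ℝ)) (I' := 𝓘(ℝ, X)) (s := Ico 0 δ ×ˢ V) p
    have h4 : HasMFDerivWithinAt (𝓘(ℝ, ℝ).prod 𝓘(ℝ, X)) 𝓘(ℝ, ℝ × X)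
        (fun p : ℝ × K => (p.1, extChartAt 𝓘(ℝ, X) q₀ p.2)) (Ico 0 δ ×ˢ V) p
        ((ContinuousLinearMap.fst ℝ ℝ X).prod
          ((derivAt 𝓘(ℝ, X) 𝓘(ℝ, X) (extChartAt 𝓘(ℝ, X) q₀) p.2).comp
          (ContinuousLinearMap.snd ℝ ℝ X))) := by
      have h5 := h1.comp_hasMFDerivWithinAt p h2
      exact ⟨h3.1.prodMk h5.1, h3.2.prodMk h5.2⟩
    have h5 : HasMFDerivWithinAt 𝓘(ℝ, ℝ × X) 𝓘(ℝ, Y) κ (Ico 0 δ ×ˢ W)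
        (p.1, extChartAt 𝓘(ℝ, X) q₀ p.2) _ :=
      (h.contDiffOn.differentiableOn (by simp) _ (hVW p hp)).hasFDerivWithinAt.hasMFDerivWithinAt
    have h6 : HasMFDerivWithinAt 𝓘(ℝ, Y) I (extChartAt I x₀).symm (range I)
        (κ (p.1, extChartAt 𝓘(ℝ, X) q₀ p.2)) _ :=
      (mdifferentiableWithinAt_extChartAt_symm (hκW (hVW p hp))).hasMFDerivWithinAt
    have hm : Ico 0 δ ×ˢ V ⊆ (fun q : ℝ × K => κ (q.1, extChartAt 𝓘(ℝ, X) q₀ q.2)) ⁻¹' range I :=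
      fun q hq => extChartAt_target_subset_range x₀ (hκW (hVW q hq))
    exact h6.comp p (h5.comp p h4 hVW) hm
  refine ⟨?_, fun q hq => ?_, fun p hp hp0 => ?_, fun p hp => ?_, fun p hp hp0 v => ?_⟩
  · exact (contMDiffOn_extChartAt_symm x₀).comp (h.contDiffOn.contMDiffOn.comp
      (contMDiffOn_prod_extChartAt inter_subset_left) hVW) fun p hp => hκW (hVW p hp)
  · have h1 := hjW _ hq.2
    rw [h.zero _ hq.2]
    rw [(extChartAt 𝓘(ℝ, X) q₀).left_inv hq.1] at h1 ⊢
    exact (extChartAt I x₀).left_inv h1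
  · exact hℓ _ (hκW (hVW p hp)) (h.pos _ (hVW p hp) hp0)
  · have h1 := (hd p hp).mfderivWithin (uniqueMDiffOn_Ico_prod hVo p hp)
    rw [derivWithinAt, h1]
    exact (isInvertible_derivWithinAt_extChartAt_symm (hκW (hVW p hp))).comp
      ((h.isInvertible _ (hVW p hp)).comp
        (isInvertible_fst_prod (isInvertible_derivAt_extChartAt hp.2.1)))
  · have h1 := ((hd p hp).hasMFDerivAt (Ico_prod_mem_nhds hVo hp hp0)).mfderiv
    have h2 := h.pullback_eq _ (hVW p hp) hp0 (v.1, derivAt 𝓘(ℝ, X) 𝓘(ℝ, X)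
      (extChartAt 𝓘(ℝ, X) q₀) p.2 v.2)
    rw [chartCovector_apply, chartCovector_derivAt α hp.2.1,
      ← fderivWithin_of_mem_nhds (Ico_prod_mem_nhds hWo (hVW p hp) hp0)] at h2
    rw [derivAt, h1]
    exact h2

end Charts

end Collar

/-! ### Immersions: injective derivatives and expressions in charts. -/

section Immersion

variable {X : Type*} [NormedAddCommGroup X] [NormedSpace ℝ X]
  {K : Type*} [TopologicalSpace K] [ChartedSpace X K] [IsManifold 𝓘(ℝ, X) ∞ K]
  {Y : Type*} [NormedAddCommGroup Y] [NormedSpace ℝ Y]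
  {H : Type*} [TopologicalSpace H] {I : ModelWithCorners ℝ Y H}
  {F : Type*} [TopologicalSpace F] [ChartedSpace H F] [IsManifold I ∞ F]

/-- The derivative of an immersion is injective. -/
lemma derivAt_eq_zero_of_isImmersionAt {f : K → F} {x : K}
    (h : Manifold.IsImmersionAt 𝓘(ℝ, X) I ∞ f x) {v : X}
    (hv : derivAt 𝓘(ℝ, X) I f x v = 0) : v = 0 := by
  set e := h.domChart.extend 𝓘(ℝ, X) with he
  -- In adapted charts `f` is the inclusion of a factor. Projecting back to that factor gives a
  -- differentiable `g` with `g ∘ f` equal to a chart, whose derivative is injective.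
  set g : F → X := fun y => (h.equiv.symm (h.codChart.extend I y)).1 with hg
  have hx := h.mem_domChart_source
  have hgf : ∀ y ∈ h.domChart.source, g (f y) = e y := by
    intro y hy
    have h1 := h.writtenInCharts (e.map_source (by rwa [he, OpenPartialHomeomorph.extend_source]))
    simp only [Function.comp_apply] at h1
    rw [e.left_inv (by rwa [he, OpenPartialHomeomorph.extend_source])] at h1
    simp only [hg]
    rw [h1, ContinuousLinearEquiv.symm_apply_apply]
  have hgd : MDifferentiableAt I 𝓘(ℝ, X) g (f x) := by
    have h1 : MDifferentiableAt I 𝓘(ℝ, Y) (h.codChart.extend I) (f x) :=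
      ((h.codChart.contMDiffOn_extend h.codChart_mem_maximalAtlas).contMDiffAt
        (h.codChart.open_source.mem_nhds h.mem_codChart_source)).mdifferentiableAt (by simp)
    have h2 : MDifferentiableAt 𝓘(ℝ, Y) 𝓘(ℝ, X) (fun y => (h.equiv.symm y).1)
        (h.codChart.extend I (f x)) :=
      (h.equiv.symm.differentiableAt.fst).mdifferentiableAt
    exact h2.comp (f x) h1
  have hfd : MDifferentiableAt 𝓘(ℝ, X) I f x := h.contMDiffAt.mdifferentiableAt (by simp)
  have hed : MDifferentiableAt 𝓘(ℝ, X) 𝓘(ℝ, X) e x :=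
    ((h.domChart.contMDiffOn_extend h.domChart_mem_maximalAtlas).contMDiffAt
      (h.domChart.open_source.mem_nhds hx)).mdifferentiableAt (by simp)
  have hed' : MDifferentiableAt 𝓘(ℝ, X) 𝓘(ℝ, X) e.symm (e x) := by
    refine ((contMDiffOn_extend_symm h.domChart_mem_maximalAtlas).contMDiffAt
      ?_).mdifferentiableAt (by simp)
    refine IsOpen.mem_nhds ?_ ?_
    · simpa using h.domChart.open_target
    · exact ⟨_, h.domChart.map_source hx, rfl⟩
  have h1 : mfderiv 𝓘(ℝ, X) 𝓘(ℝ, X) e x = (mfderiv I 𝓘(ℝ, X) g (f x)).comp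
      (mfderiv 𝓘(ℝ, X) I f x) := by
    rw [← mfderiv_comp x hgd hfd]
    refine Filter.EventuallyEq.mfderiv_eq ?_
    filter_upwards [h.domChart.open_source.mem_nhds hx] with y hy
    exact (hgf y hy).symm
  have h2 : (mfderiv 𝓘(ℝ, X) 𝓘(ℝ, X) e.symm (e x)).comp (mfderiv 𝓘(ℝ, X) 𝓘(ℝ, X) e x) =
      mfderiv 𝓘(ℝ, X) 𝓘(ℝ, X) (id : K → K) x := by
    rw [← mfderiv_comp x hed' hed]
    refine Filter.EventuallyEq.mfderiv_eq ?_
    filter_upwards [h.domChart.open_source.mem_nhds hx] with y hy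
    exact e.left_inv (by rwa [he, OpenPartialHomeomorph.extend_source])
  have h3 : mfderiv 𝓘(ℝ, X) 𝓘(ℝ, X) e x v = 0 := by
    rw [h1]
    exact (congrArg (mfderiv I 𝓘(ℝ, X) g (f x)) hv).trans (map_zero _)
  have h4 := congrArg (fun L => L v) h2
  rw [mfderiv_id] at h4
  exact h4.symm.trans ((congrArg (mfderiv 𝓘(ℝ, X) 𝓘(ℝ, X) e.symm (e x)) h3).trans (map_zero _))

/-- The expression of a map in charts and its derivative. -/
lemma hasFDerivAt_written {f : K → F} (hf : ContMDiff 𝓘(ℝ, X) I ∞ f) {q₀ : K} {x₀ : F} {y : X}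
    (hy : y ∈ (extChartAt 𝓘(ℝ, X) q₀).target)
    (hfy : f ((extChartAt 𝓘(ℝ, X) q₀).symm y) ∈ (extChartAt I x₀).source) :
    ContDiffAt ℝ ∞ (fun y => extChartAt I x₀ (f ((extChartAt 𝓘(ℝ, X) q₀).symm y))) y ∧
    HasFDerivAt (fun y => extChartAt I x₀ (f ((extChartAt 𝓘(ℝ, X) q₀).symm y)))
      ((derivAt I 𝓘(ℝ, Y) (extChartAt I x₀) (f ((extChartAt 𝓘(ℝ, X) q₀).symm y))).comp
        ((derivAt 𝓘(ℝ, X) I f ((extChartAt 𝓘(ℝ, X) q₀).symm y)).comp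
          (derivWithinAt 𝓘(ℝ, X) 𝓘(ℝ, X) (extChartAt 𝓘(ℝ, X) q₀).symm (range 𝓘(ℝ, X)) y))) y := by
  have : IsManifold 𝓘(ℝ, X) 1 K := .of_le (m := 1) (n := ∞) (by simp)
  have : IsManifold I 1 F := .of_le (m := 1) (n := ∞) (by simp)
  constructor
  · rw [← contMDiffAt_iff_contDiffAt]
    have h1 : ContMDiffAt 𝓘(ℝ, X) 𝓘(ℝ, X) ∞ (extChartAt 𝓘(ℝ, X) q₀).symm y :=
      (contMDiffOn_extChartAt_symm q₀).contMDiffAt ((isOpen_extChartAt_target q₀).mem_nhds hy)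
    have h2 : ContMDiffAt I 𝓘(ℝ, Y) ∞ (extChartAt I x₀) (f ((extChartAt 𝓘(ℝ, X) q₀).symm y)) :=
      contMDiffAt_extChartAt' (by rwa [← extChartAt_source I])
    exact h2.comp y (hf.contMDiffAt.comp y h1)
  · have h1 : HasMFDerivWithinAt 𝓘(ℝ, X) 𝓘(ℝ, X) (extChartAt 𝓘(ℝ, X) q₀).symm (range 𝓘(ℝ, X)) y
        (mfderivWithin 𝓘(ℝ, X) 𝓘(ℝ, X) (extChartAt 𝓘(ℝ, X) q₀).symm (range 𝓘(ℝ, X)) y) :=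
      (mdifferentiableWithinAt_extChartAt_symm hy).hasMFDerivWithinAt
    have h2 : HasMFDerivAt 𝓘(ℝ, X) 𝓘(ℝ, X) (extChartAt 𝓘(ℝ, X) q₀).symm y
        (mfderivWithin 𝓘(ℝ, X) 𝓘(ℝ, X) (extChartAt 𝓘(ℝ, X) q₀).symm (range 𝓘(ℝ, X)) y) :=
      h1.hasMFDerivAt (by simp)
    have h6 : HasMFDerivAt I 𝓘(ℝ, Y) (extChartAt I x₀)
        (f ((extChartAt 𝓘(ℝ, X) q₀).symm y)) _ :=
      (mdifferentiableAt_extChartAt (by rwa [← extChartAt_source I])).hasMFDerivAt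
    have h3 : HasMFDerivAt 𝓘(ℝ, X) I f ((extChartAt 𝓘(ℝ, X) q₀).symm y) _ :=
      (hf.mdifferentiable (by simp) _).hasMFDerivAt
    exact (h6.comp y (h3.comp y h2)).hasFDerivAt

end Immersion

/-! ### Interior and boundary points through the normal coordinate. -/

section HalfSpaceCharts

variable {n : ℕ} [NeZero n] {F : Type*} [TopologicalSpace F]
  [ChartedSpace (EuclideanHalfSpace n) F]

/-- The coordinate normal to the boundary of the half space. -/
def normalCoord (n : ℕ) [NeZero n] : EuclideanSpace ℝ (Fin n) →L[ℝ] ℝ :=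
  EuclideanSpace.proj 0

lemma normalCoord_apply (z : EuclideanSpace ℝ (Fin n)) : normalCoord n z = z 0 := rfl

lemma normalCoord_single : normalCoord n (EuclideanSpace.single 0 1) = 1 := by
  simp [normalCoord_apply]

lemma normalCoord_ne_zero : normalCoord n ≠ 0 := fun h => by
  have := normalCoord_single (n := n)
  rw [h] at this
  exact zero_ne_one this

/-- An open set whose intersection with the half space is the target of a chart. -/
def openTarget (x₀ : F) : Set (EuclideanSpace ℝ (Fin n)) :=
  (𝓡∂ n).symm ⁻¹' (chartAt (EuclideanHalfSpace n) x₀).target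

lemma isOpen_openTarget (x₀ : F) : IsOpen (openTarget (n := n) x₀) :=
  (chartAt (EuclideanHalfSpace n) x₀).open_target.preimage (𝓡∂ n).continuous_symm

lemma extChartAt_target_eq (x₀ : F) :
    (extChartAt (𝓡∂ n) x₀).target = openTarget x₀ ∩ {z | 0 ≤ normalCoord n z} := by
  rw [extChartAt_target, range_modelWithCornersEuclideanHalfSpace]
  rfl

variable [IsManifold (𝓡∂ n) ∞ F]

/-- Being an interior point can be tested in any chart of the atlas. The chart target is an open set
cut with the closed half space, so its interior is the part with positive normal coordinate. -/
lemma mem_interior_iff {x₀ x : F} (hx : x ∈ (extChartAt (𝓡∂ n) x₀).source) :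
    x ∈ (𝓡∂ n).interior F ↔ 0 < normalCoord n (extChartAt (𝓡∂ n) x₀ x) := by
  have h1 := (𝓡∂ n).isInteriorPoint_iff_of_mem_atlas (n := ∞) (M := F) (by simp)
    (chart_mem_atlas (EuclideanHalfSpace n) x₀) (x := x) (by rwa [← extChartAt_source (𝓡∂ n)])
  have h2 : interior (extChartAt (𝓡∂ n) x₀).target = openTarget x₀ ∩ {z | 0 < normalCoord n z} := by
    rw [extChartAt_target_eq, interior_inter, (isOpen_openTarget x₀).interior_eq]
    congr 1
    exact interior_halfSpace 2 0 0
  have h3 : extChartAt (𝓡∂ n) x₀ x ∈ openTarget x₀ := by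
    have := (extChartAt (𝓡∂ n) x₀).map_source hx
    rw [extChartAt_target_eq] at this
    exact this.1
  refine h1.trans ?_
  change extChartAt (𝓡∂ n) x₀ x ∈ interior (extChartAt (𝓡∂ n) x₀).target ↔ _
  rw [h2]
  exact ⟨fun h => h.2, fun h => ⟨h3, h⟩⟩

lemma symm_mem_interior_iff {x₀ : F} {z : EuclideanSpace ℝ (Fin n)}
    (hz : z ∈ (extChartAt (𝓡∂ n) x₀).target) :
    (extChartAt (𝓡∂ n) x₀).symm z ∈ (𝓡∂ n).interior F ↔ 0 < normalCoord n z := by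
  rw [mem_interior_iff ((extChartAt (𝓡∂ n) x₀).map_target hz),
    (extChartAt (𝓡∂ n) x₀).right_inv hz]

lemma normalCoord_eq_zero {x₀ x : F} (hx : x ∈ (extChartAt (𝓡∂ n) x₀).source)
    (hxb : x ∈ (𝓡∂ n).boundary F) : normalCoord n (extChartAt (𝓡∂ n) x₀ x) = 0 := by
  have h1 := (extChartAt (𝓡∂ n) x₀).map_source hx
  rw [extChartAt_target_eq] at h1
  refine le_antisymm (not_lt.1 fun h => ?_) h1.2
  rw [← mem_interior_iff hx] at h
  rw [← (𝓡∂ n).compl_interior] at hxb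
  exact hxb h

end HalfSpaceCharts

/-! ### Collars near a boundary point. -/

section LocalCollar

variable {m : ℕ}
  {F : Type*} [TopologicalSpace F] [ChartedSpace (EuclideanHalfSpace (2 * m + 2)) F]
  {K : Type*} [TopologicalSpace K] [ChartedSpace (EuclideanSpace ℝ (Fin (2 * m + 1))) K]

/-- A covector vanishing on the kernel of a nonzero covector is a multiple of it; equality of
co-orientations makes the factor positive. -/
lemma IsPositiveContactFormOn.exists_pos_smul {β₀ α : DiffForm (𝓡 (2 * m + 1)) K 1}
    (h : IsPositiveContactFormOn β₀ α) (q : K) :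
    ∃ c : ℝ, 0 < c ∧ covector β₀ q = c • covector α q := by
  have hfd : FiniteDimensional ℝ (TangentSpace (𝓡 (2 * m + 1)) q) :=
    inferInstanceAs (FiniteDimensional ℝ (EuclideanSpace ℝ (Fin (2 * m + 1))))
  obtain ⟨v, hv⟩ := h.isContactForm.contact q
  obtain ⟨w, hw⟩ := exists_ne_zero_of_wedgePow_ne_zero hv
  have hker : ∀ v : EuclideanSpace ℝ (Fin (2 * m + 1)), covector α q v = 0 → covector β₀ q v = 0 :=
    fun v hv => (covector_apply β₀ q v).trans
      ((h.ker_eq q v).1 ((covector_apply α q v).symm.trans hv))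
  have hpos : ∀ v : EuclideanSpace ℝ (Fin (2 * m + 1)), 0 < covector α q v → 0 < covector β₀ q v :=
    fun v hv => ((h.pos_iff q v).1 (hv.trans_eq (covector_apply α q v))).trans_eq
      (covector_apply β₀ q v).symm
  obtain ⟨w', hw'⟩ : ∃ w' : EuclideanSpace ℝ (Fin (2 * m + 1)), covector α q w' ≠ 0 :=
    ⟨w, fun h0 => hw ((covector_apply α q w).symm.trans h0)⟩
  obtain ⟨x, hx⟩ : ∃ x : EuclideanSpace ℝ (Fin (2 * m + 1)), covector α q x = 1 :=
    ⟨(covector α q w')⁻¹ • w', by rw [map_smul, smul_eq_mul, inv_mul_cancel₀ hw']⟩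
  refine ⟨covector β₀ q x, hpos x (by rw [hx]; exact one_pos), ?_⟩
  ext v
  have h1 := hker (v - covector α q v • x) (by rw [map_sub, map_smul, hx]; simp)
  rw [map_sub, map_smul, sub_eq_zero] at h1
  rw [h1, smul_apply, smul_eq_mul, smul_eq_mul, mul_comm]

variable [IsManifold (𝓡∂ (2 * m + 2)) ∞ F] [IsManifold (𝓡 (2 * m + 1)) ∞ K]

/-- Existence of collars near a point of the boundary. -/
theorem exists_isCollar {j : K → F} (hj : IsBoundaryInclusion m j)
    {lam : DiffForm (𝓡∂ (2 * m + 2)) F 1} {u : F → ℝ} (hu : IsBoundaryDefining m u)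
    {β : DiffForm (𝓡∂ (2 * m + 2)) F 1} (hβ : IsExtension u lam β)
    {α₀ : DiffForm (𝓡 (2 * m + 1)) K 1} (hα₀ : IsPositiveContactFormOn (pullback j β) α₀) (q₀ : K) :
    ∃ δ, 0 < δ ∧ ∃ V, IsOpen V ∧ q₀ ∈ V ∧ ∃ κ, IsCollar (𝓡∂ (2 * m + 2)) j lam α₀ δ V κ ∧
      ∀ q ∈ V, ∃ c : ℝ, HasDerivWithinAt (fun r => u (κ (r, q))) c (Ici 0) 0 ∧
        covector (pullback j β : DiffForm (𝓡 (2 * m + 1)) K 1) q = c • covector α₀ q := by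
  have : IsManifold (𝓡 (2 * m + 1)) 1 K := .of_le (m := 1) (n := ∞) (by simp)
  have : IsManifold (𝓡∂ (2 * m + 2)) 1 F := .of_le (m := 1) (n := ∞) (by simp)
  have hjs : ContMDiff (𝓡 (2 * m + 1)) (𝓡∂ (2 * m + 2)) ∞ j := hj.isSmoothEmbedding.contMDiff
  set ψ := extChartAt (𝓡 (2 * m + 1)) q₀ with hψ
  set φ := extChartAt (𝓡∂ (2 * m + 2)) (j q₀) with hφ
  set ℓ := normalCoord (2 * m + 2) with hℓ
  set O := openTarget (n := 2 * m + 2) (j q₀) with hO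
  have hT : φ.target = O ∩ {z | 0 ≤ ℓ z} := extChartAt_target_eq (j q₀)
  have hbdry : ∀ q, j q ∈ (𝓡∂ (2 * m + 2)).boundary F := fun q => by
    rw [← hj.range_eq]; exact mem_range_self q
  choose k hk0 hk using fun q => hα₀.exists_pos_smul q
  set J : EuclideanSpace ℝ (Fin (2 * m + 1)) → EuclideanSpace ℝ (Fin (2 * m + 2)) :=
    fun y => φ (j (ψ.symm y)) with hJ
  set U := ψ.target ∩ ψ.symm ⁻¹' (j ⁻¹' φ.source) with hU
  have hUo : IsOpen U := (continuousOn_extChartAt_symm q₀).isOpen_inter_preimage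
    (isOpen_extChartAt_target q₀) ((isOpen_extChartAt_source (j q₀)).preimage hjs.continuous)
  set y₀ := ψ q₀ with hy₀
  have hψy : ψ.symm y₀ = q₀ := ψ.left_inv (mem_extChartAt_source q₀)
  have hyU : y₀ ∈ U := ⟨mem_extChartAt_target q₀, by
    change j (ψ.symm y₀) ∈ φ.source
    rw [hψy]
    exact mem_extChartAt_source (j q₀)⟩
  have hJw := fun y (hy : y ∈ U) => hasFDerivAt_written (x₀ := j q₀) hjs hy.1 hy.2
  have hJs : ContDiffOn ℝ ∞ J U := fun y hy => (hJw y hy).1.contDiffWithinAt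
  have hJT : MapsTo J U φ.target := fun y hy => φ.map_source hy.2
  have hJinj : ∀ w, fderiv ℝ J y₀ w = 0 → w = 0 := by
    intro w hw
    rw [(hJw y₀ hyU).2.fderiv] at hw
    obtain ⟨A, hA⟩ := isInvertible_derivAt_extChartAt (I := 𝓡∂ (2 * m + 2)) hyU.2
    obtain ⟨B, hB⟩ := isInvertible_derivWithinAt_extChartAt_symm (I := 𝓡 (2 * m + 1)) hyU.1
    rw [← hA, ← hB] at hw
    have h1 := A.injective (hw.trans (map_zero A).symm)
    have h2 := derivAt_eq_zero_of_isImmersionAt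
      (hj.isSmoothEmbedding.isImmersion.isImmersionAt _) h1
    exact B.injective (h2.trans (map_zero B).symm)
  set a := chartCovector α₀ q₀ with ha
  set b := chartCovector β (j q₀) with hb
  have has : ContDiffOn ℝ ∞ a U :=
    (contDiffOn_chartCovector_univ hα₀.isContactForm.smooth q₀).mono inter_subset_left
  have hbs : ContDiffOn ℝ ∞ b φ.target := contDiffOn_chartCovector_univ hβ.smooth (j q₀)
  have hba : ∀ y ∈ U, ∀ w, b (J y) (fderiv ℝ J y w) = k (ψ.symm y) * a y w := by
    intro y hy w
    rw [(hJw y hy).2.fderiv, ContinuousLinearMap.comp_apply, hb, hJ, hφ,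
      chartCovector_derivAt β hy.2, ContinuousLinearMap.comp_apply, ← covector_pullback, hk, ha,
      chartCovector_apply]
    rfl
  have hcontact := hα₀.isContactForm.isInvertible_contactOp q₀
  obtain ⟨v₀, hv₀⟩ := exists_apply_eq_one_of_contactOp hcontact
  -- The factor `k` was chosen pointwise. Where `a y v₀ ≠ 0` it is the quotient of the two forms
  -- evaluated on `v₀`, hence smooth.
  set U' := U ∩ {y | a y v₀ ≠ 0} with hU'
  have hav : ContDiffOn ℝ ∞ (fun y => a y v₀) U := has.clm_apply contDiffOn_const
  have hU'o : IsOpen U' := hav.continuousOn.isOpen_inter_preimage hUo isOpen_ne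
  have hyU' : y₀ ∈ U' := ⟨hyU, by
    change a y₀ v₀ ≠ 0
    rw [hv₀]
    exact one_ne_zero⟩
  have hJ' : ContDiffOn ℝ ∞ (fderiv ℝ J) U := ((contDiffOn_infty_iff_fderiv_of_isOpen hUo).1 hJs).2
  have hks : ContDiffOn ℝ ∞ (fun y => k (ψ.symm y)) U' := by
    have h1 : ContDiffOn ℝ ∞ (fun y => b (J y) (fderiv ℝ J y v₀) / a y v₀) U' :=
      (((hbs.comp hJs hJT).clm_apply (hJ'.clm_apply contDiffOn_const)).mono inter_subset_left).div
        (hav.mono inter_subset_left) fun y hy => hy.2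
    refine h1.congr fun y hy => ?_
    rw [hba y hy.1, mul_div_cancel_right₀ _ hy.2]
  have hus : ContDiffOn ℝ ∞ (fun z => u (φ.symm z)) (O ∩ {z | 0 ≤ ℓ z}) := by
    rw [← hT, ← contMDiffOn_iff_contDiffOn]
    exact hu.smooth.comp_contMDiffOn (contMDiffOn_extChartAt_symm (j q₀))
  have hmemT : ∀ z ∈ O, 0 ≤ ℓ z → z ∈ φ.target := fun z hz hz0 => by rw [hT]; exact ⟨hz, hz0⟩
  have hint : ∀ z ∈ φ.target, 0 < ℓ z → φ.symm z ∈ (𝓡∂ (2 * m + 2)).interior F := fun z hz hz0 =>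
    (symm_mem_interior_iff hz).2 hz0
  have hJy₀ : J y₀ = φ (j q₀) := by
    simp only [hJ]
    rw [hψy]
  have hu' : fderivWithin ℝ (fun z => u (φ.symm z)) (O ∩ {z | 0 ≤ ℓ z}) (J y₀) ≠ 0 := by
    intro h0
    refine hu.regular (j q₀) (hbdry q₀) ?_
    have h1 : mfderiv (𝓡∂ (2 * m + 2)) 𝓘(ℝ, ℝ) u (j q₀) =
        fderivWithin ℝ (fun z => u (φ.symm z)) (range (𝓡∂ (2 * m + 2))) (φ (j q₀)) :=
      (hu.smooth.mdifferentiable (by simp) (j q₀)).mfderiv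
    rw [h1, ← hJy₀]
    refine Eq.trans ?_ h0
    -- The range of the model and the target of the chart coincide near the base point, so the
    -- derivatives within the two sets agree.
    rw [← hT, hJy₀]
    refine (fderivWithin_congr_set ?_)
    exact (nhdsWithin_eq_iff_eventuallyEq.1 (nhdsWithin_extChartAt_target_eq (j q₀))).symm
  obtain ⟨δ, hδ, V, hV, hyV, hVU, κ, hκ, hκO, hκu⟩ := exists_isModelSolution
    (X := EuclideanSpace ℝ (Fin (2 * m + 1))) (Y := EuclideanSpace ℝ (Fin (2 * m + 2)))
    (by simp) (ℓ := ℓ) normalCoord_single (isOpen_openTarget (j q₀))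
    (β := b) (lam := chartCovector lam (j q₀)) (by rw [← hO, ← hT]; exact hbs)
    (u := fun z => u (φ.symm z)) hus
    (fun z hz hz0 => (hu.eq_zero_iff _).2 (by
      rw [← (𝓡∂ (2 * m + 2)).compl_interior]
      intro h1
      rw [symm_mem_interior_iff (hmemT z hz hz0.ge)] at h1
      exact h1.ne' hz0))
    (fun z hz hz0 => lt_of_le_of_ne (hu.nonneg _) fun h1 => by
      have h2 := (hu.eq_zero_iff _).1 h1.symm
      rw [← (𝓡∂ (2 * m + 2)).compl_interior] at h2
      exact h2 (hint z (hmemT z hz hz0.le) hz0))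
    (fun z hz hz0 => by
      have h1 := hβ.eq_smul _ (hint z (hmemT z hz hz0.le) hz0)
      have h2 : covector β (φ.symm z) = u (φ.symm z) • covector lam (φ.symm z) := by
        rw [covector, h1]
        exact map_smul (toDual _) _ _
      ext w
      rw [hb, smul_apply, chartCovector_apply, chartCovector_apply, h2, smul_apply])
    hU'o hyU' (hJs.mono inter_subset_left)
    (fun y hy => by
      have := hJT hy.1
      rw [hT] at this
      exact this.1)
    (fun y hy => normalCoord_eq_zero hy.1.2 (hbdry _)) hJinj hu' (has.mono inter_subset_left)
    hks (fun y _ => hk0 _) (fun y hy => hba y hy.1) hcontact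
  have hκT : MapsTo κ (Ico 0 δ ×ˢ V) φ.target := by
    intro p hp
    refine hmemT _ (hκO hp) ?_
    rcases hp.1.1.eq_or_lt with hp0 | hp0
    · have : p = (0, p.2) := Prod.ext hp0.symm rfl
      rw [this, hκ.zero _ hp.2]
      exact (normalCoord_eq_zero (hVU hp.2).1.2 (hbdry _)).ge
    · exact (hκ.pos p hp hp0).le
  refine ⟨δ, hδ, ψ.source ∩ ψ ⁻¹' V, isOpen_extChartAt_preimage' q₀ hV,
    ⟨mem_extChartAt_source q₀, hyV⟩, fun p => φ.symm (κ (p.1, ψ p.2)),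
    hκ.isCollar hV hκT (fun y hy => (hVU hy).1.2) hint, fun q hq =>
    ⟨k q, ?_, hk q⟩⟩
  have h1 := hκu _ hq.2
  rwa [ψ.left_inv hq.1] at h1

end LocalCollar

/-! ### Collars can be recognized locally. -/

section CollarLocality

variable {X : Type*} [NormedAddCommGroup X] [NormedSpace ℝ X]
  {K : Type*} [TopologicalSpace K] [ChartedSpace X K]
  {Y : Type*} [NormedAddCommGroup Y] [NormedSpace ℝ Y]
  {H : Type*} [TopologicalSpace H] {I : ModelWithCorners ℝ Y H}
  {F : Type*} [TopologicalSpace F] [ChartedSpace H F]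

/-- Being a collar is a local property. -/
lemma IsCollar.of_locally {j : K → F} {lam : DiffForm I F 1} {α : DiffForm 𝓘(ℝ, X) K 1} {δ : ℝ}
    {V : Set K} (hV : IsOpen V) {κ : ℝ × K → F}
    (h : ∀ q ∈ V, ∃ δ' V' κ', IsCollar I j lam α δ' V' κ' ∧ δ ≤ δ' ∧ IsOpen V' ∧ q ∈ V' ∧
      ∀ p ∈ Ico 0 δ ×ˢ (V ∩ V'), κ p = κ' p) (hδ : 0 < δ) : IsCollar I j lam α δ V κ := by
  have key : ∀ p ∈ Ico 0 δ ×ˢ V, ∃ δ' V' κ', IsCollar I j lam α δ' V' κ' ∧ p ∈ Ico 0 δ' ×ˢ V' ∧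
      IsOpen V' ∧ Ico 0 δ' ×ˢ V' ∈ 𝓝[Ico 0 δ ×ˢ V] p ∧ κ =ᶠ[𝓝[Ico 0 δ ×ˢ V] p] κ' ∧ κ p = κ' p := by
    intro p hp
    obtain ⟨δ', V', κ', hc, hδ', hV', hq, he⟩ := h p.2 hp.2
    have h1 : (univ : Set ℝ) ×ˢ V' ∈ 𝓝[Ico 0 δ ×ˢ V] p :=
      mem_nhdsWithin_of_mem_nhds ((isOpen_univ.prod hV').mem_nhds ⟨mem_univ _, hq⟩)
    refine ⟨δ', V', κ', hc, ⟨⟨hp.1.1, hp.1.2.trans_le hδ'⟩, hq⟩, hV', ?_, ?_,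
      he p ⟨hp.1, hp.2, hq⟩⟩
    · filter_upwards [h1, self_mem_nhdsWithin] with x hx hxD
      exact ⟨⟨hxD.1.1, hxD.1.2.trans_le hδ'⟩, hx.2⟩
    · filter_upwards [h1, self_mem_nhdsWithin] with x hx hxD
      exact he x ⟨hxD.1, hxD.2, hx.2⟩
  refine ⟨fun p hp => ?_, fun q hq => ?_, fun p hp hp0 => ?_, fun p hp => ?_, fun p hp hp0 v => ?_⟩
  · obtain ⟨δ', V', κ', hc, hp', -, hn, he, he'⟩ := key p hp
    exact ((hc.contMDiffOn p hp').mono_of_mem_nhdsWithin hn).congr_of_eventuallyEq he he'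
  · obtain ⟨δ', V', κ', hc, hp', -, hn, he, he'⟩ := key (0, q) ⟨⟨le_rfl, hδ⟩, hq⟩
    rw [he', hc.zero q hp'.2]
  · obtain ⟨δ', V', κ', hc, hp', -, hn, he, he'⟩ := key p hp
    rw [he']
    exact hc.mem_interior p hp' hp0
  · obtain ⟨δ', V', κ', hc, hp', hV', hn, he, he'⟩ := key p hp
    have hU := uniqueMDiffOn_Ico_prod (X := X) (δ := δ) hV p hp
    have h1 : HasMFDerivWithinAt (𝓘(ℝ, ℝ).prod 𝓘(ℝ, X)) I κ' (Ico 0 δ' ×ˢ V') p _ :=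
      (hc.contMDiffOn.mdifferentiableOn (by simp) p hp').hasMFDerivWithinAt
    have h2 : mfderivWithin (𝓘(ℝ, ℝ).prod 𝓘(ℝ, X)) I κ (Ico 0 δ ×ˢ V) p =
        mfderivWithin (𝓘(ℝ, ℝ).prod 𝓘(ℝ, X)) I κ' (Ico 0 δ' ×ˢ V') p :=
      ((h1.mono_of_mem_nhdsWithin hn).congr_of_eventuallyEq he he').mfderivWithin hU
    rw [derivWithinAt, h2]
    exact hc.isInvertible p hp'
  · obtain ⟨δ', V', κ', hc, hp', hV', hn, he, he'⟩ := key p hp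
    rw [nhdsWithin_eq_nhds.2 (Ico_prod_mem_nhds hV hp hp0)] at he
    have h1 : derivAt (𝓘(ℝ, ℝ).prod 𝓘(ℝ, X)) I κ p = derivAt (𝓘(ℝ, ℝ).prod 𝓘(ℝ, X)) I κ' p :=
      he.mfderiv_eq
    rw [h1, he']
    exact hc.pullback_eq p hp' hp0 v

end CollarLocality

/-! ### Uniqueness of collars on the manifold. -/

section Uniqueness

variable {n : ℕ} [NeZero n] {m : ℕ}
  {F : Type*} [TopologicalSpace F] [ChartedSpace (EuclideanHalfSpace n) F]
  {K : Type*} [TopologicalSpace K] [ChartedSpace (EuclideanSpace ℝ (Fin (2 * m + 1))) K]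
  [IsManifold (𝓡∂ n) ∞ F] [IsManifold (𝓡 (2 * m + 1)) ∞ K]

/-- Two collars agree near the boundary. -/
theorem IsCollar.exists_eqOn {j : K → F} (hj : Continuous j)
    (hjb : ∀ q, j q ∈ (𝓡∂ n).boundary F)
    {lam : DiffForm (𝓡∂ n) F 1} {α : DiffForm (𝓡 (2 * m + 1)) K 1} (hα : IsContactForm α)
    {δ₁ δ₂ : ℝ} {V₁ V₂ : Set K} {κ₁ κ₂ : ℝ × K → F} (h₁ : IsCollar (𝓡∂ n) j lam α δ₁ V₁ κ₁)
    (h₂ : IsCollar (𝓡∂ n) j lam α δ₂ V₂ κ₂) (hδ₁ : 0 < δ₁) (hδ₂ : 0 < δ₂) (hV₁ : IsOpen V₁)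
    (hV₂ : IsOpen V₂) {q : K} (hq₁ : q ∈ V₁) (hq₂ : q ∈ V₂) :
    ∃ ρ, 0 < ρ ∧ ∃ N, IsOpen N ∧ q ∈ N ∧ ∀ p ∈ Ico 0 ρ ×ˢ N, κ₁ p = κ₂ p := by
  set ψ := extChartAt (𝓡 (2 * m + 1)) q with hψ
  set φ := extChartAt (𝓡∂ n) (j q) with hφ
  have hψq : ψ.symm (ψ q) = q := ψ.left_inv (mem_extChartAt_source q)
  set U := ψ.target ∩ ψ.symm ⁻¹' (V₁ ∩ V₂ ∩ j ⁻¹' φ.source) with hU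
  have hUo : IsOpen U := (continuousOn_extChartAt_symm q).isOpen_inter_preimage
    (isOpen_extChartAt_target q)
    ((hV₁.inter hV₂).inter ((isOpen_extChartAt_source (j q)).preimage hj))
  have hyU : ψ q ∈ U := ⟨mem_extChartAt_target q, by
    change ψ.symm (ψ q) ∈ V₁ ∩ V₂ ∩ j ⁻¹' φ.source
    rw [hψq]
    exact ⟨⟨hq₁, hq₂⟩, mem_extChartAt_source (j q)⟩⟩
  set δ := min δ₁ δ₂ with hδ
  have hδ0 : 0 < δ := lt_min hδ₁ hδ₂
  have hev : ∀ {δ' : ℝ} {V' : Set K} {κ : ℝ × K → F}, IsCollar (𝓡∂ n) j lam α δ' V' κ → δ ≤ δ' →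
      MapsTo ψ.symm U V' →
      ∀ᶠ p in 𝓝[Ico 0 δ ×ˢ U] ((0 : ℝ), ψ q), κ (p.1, ψ.symm p.2) ∈ φ.source := by
    intro δ' V' κ h hδ' hm
    have hc : ContinuousOn (fun p : ℝ × EuclideanSpace ℝ (Fin (2 * m + 1)) =>
        κ (p.1, ψ.symm p.2)) (Ico 0 δ ×ˢ U) :=
      h.contMDiffOn.continuousOn.comp (continuousOn_fst.prodMk
        ((continuousOn_extChartAt_symm q).comp continuousOn_snd fun p hp => hp.2.1))
        fun p hp => ⟨⟨hp.1.1, hp.1.2.trans_le hδ'⟩, hm hp.2⟩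
    refine (hc (0, ψ q) ⟨⟨le_rfl, hδ0⟩, hyU⟩).eventually
      ((isOpen_extChartAt_source (j q)).mem_nhds ?_)
    change κ (0, ψ.symm (ψ q)) ∈ φ.source
    rw [h.zero _ (hm hyU), hψq]
    exact mem_extChartAt_source (j q)
  have hm₁ : MapsTo ψ.symm U V₁ := fun y hy => hy.2.1.1
  have hm₂ : MapsTo ψ.symm U V₂ := fun y hy => hy.2.1.2
  obtain ⟨δ', hδ', hδδ', W, hW, hyW, hWU, hE⟩ := exists_Ico_prod_subset hδ0 hUo hyU
    ((hev h₁ (min_le_left _ _) hm₁).and (hev h₂ (min_le_right _ _) hm₂))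
  have hWt : W ⊆ ψ.target := fun y hy => (hWU hy).1
  have hℓ : ∀ x ∈ φ.source, x ∈ (𝓡∂ n).interior F → 0 < normalCoord n (φ x) := fun x hx hxi =>
    (mem_interior_iff hx).1 hxi
  have hs₁ := h₁.isModelSolution (q₀ := q) (x₀ := j q) hV₁ (hδδ'.trans (min_le_left _ _)) hW hWt
    (hm₁.mono_left hWU) (fun p hp => (hE p hp).1) hℓ
  have hs₂ := h₂.isModelSolution (q₀ := q) (x₀ := j q) hV₂ (hδδ'.trans (min_le_right _ _)) hW hWt
    (hm₂.mono_left hWU) (fun p hp => (hE p hp).2) hℓ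
  have hloc := hs₁.eventually_eq normalCoord_ne_zero hδ' hW hyW
    (fun y hy => normalCoord_eq_zero (hWU hy).2.2 (hjb _))
    ((contDiffOn_chartCovector_univ hα.smooth q).mono hWt) (hα.isInvertible_contactOp q) hs₂
  obtain ⟨ρ, hρ, hρδ, N, hN, hyN, hNW, hEN⟩ := exists_Ico_prod_subset hδ' hW hyW hloc
  refine ⟨ρ, hρ, ψ.source ∩ ψ ⁻¹' N, isOpen_extChartAt_preimage' q hN,
    ⟨mem_extChartAt_source q, hyN⟩, fun p hp => ?_⟩
  have hp1 : (p.1, ψ p.2) ∈ Ico 0 ρ ×ˢ N := ⟨hp.1, hp.2.2⟩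
  have hp2 : (p.1, ψ p.2) ∈ Ico 0 δ' ×ˢ W :=
    ⟨⟨hp.1.1, hp.1.2.trans_le hρδ⟩, hNW hp.2.2⟩
  have h3 := φ.injOn (hE _ hp2).1 (hE _ hp2).2 (hEN _ hp1)
  rwa [ψ.left_inv hp.2.1] at h3

end Uniqueness

/-! ### Gluing local collars over the compact boundary. -/

section Gluing

variable {m : ℕ}
  {F : Type*} [TopologicalSpace F] [ChartedSpace (EuclideanHalfSpace (2 * m + 2)) F]
  {K : Type*} [TopologicalSpace K] [ChartedSpace (EuclideanSpace ℝ (Fin (2 * m + 1))) K]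
  [IsManifold (𝓡∂ (2 * m + 2)) ∞ F] [IsManifold (𝓡 (2 * m + 1)) ∞ K] [CompactSpace K] [T2Space K]

/-- Existence of a global collar. -/
theorem exists_isCollar_univ {j : K → F} (hj : IsBoundaryInclusion m j)
    {lam : DiffForm (𝓡∂ (2 * m + 2)) F 1} {u : F → ℝ} (hu : IsBoundaryDefining m u)
    {β : DiffForm (𝓡∂ (2 * m + 2)) F 1} (hβ : IsExtension u lam β)
    {α₀ : DiffForm (𝓡 (2 * m + 1)) K 1} (hα₀ : IsPositiveContactFormOn (pullback j β) α₀) :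
    ∃ δ, 0 < δ ∧ ∃ κ, IsCollar (𝓡∂ (2 * m + 2)) j lam α₀ δ univ κ ∧
      ∀ q, ∃ c : ℝ, HasDerivWithinAt (fun r => u (κ (r, q))) c (Ici 0) 0 ∧
        covector (pullback j β : DiffForm (𝓡 (2 * m + 1)) K 1) q = c • covector α₀ q := by
  have hjc : Continuous j := hj.isSmoothEmbedding.isEmbedding.continuous
  have hjb : ∀ q, j q ∈ (𝓡∂ (2 * m + 2)).boundary F := fun q => by
    rw [← hj.range_eq]; exact mem_range_self q
  -- Asking for a collar over a neighbourhood of the closure leaves room to shrink in the union step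
  -- of the compactness induction.
  let P : Set K → Prop := fun S => ∃ δ, 0 < δ ∧ ∃ V, IsOpen V ∧ closure S ⊆ V ∧ ∃ κ,
    IsCollar (𝓡∂ (2 * m + 2)) j lam α₀ δ V κ ∧
      ∀ q ∈ V, ∃ c : ℝ, HasDerivWithinAt (fun r => u (κ (r, q))) c (Ici 0) 0 ∧
        covector (pullback j β : DiffForm (𝓡 (2 * m + 1)) K 1) q = c • covector α₀ q
  suffices h : P univ by
    obtain ⟨δ, hδ, V, hV, hcl, κ, hκ, hκu⟩ := h
    have : V = univ := univ_subset_iff.1 (by simpa using hcl)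
    subst this
    exact ⟨δ, hδ, κ, hκ, fun q => hκu q (mem_univ q)⟩
  refine isCompact_univ.induction_on ?_ ?_ ?_ ?_
  · exact ⟨1, one_pos, ∅, isOpen_empty, by simp, fun p => j p.2, .of_locally isOpen_empty
      (fun q hq => absurd hq (notMem_empty q)) one_pos, fun q hq => absurd hq (notMem_empty q)⟩
  · rintro S T hST ⟨δ, hδ, V, hV, hcl, κ, hκ, hκu⟩
    exact ⟨δ, hδ, V, hV, (closure_mono hST).trans hcl, κ, hκ, hκu⟩
  · rintro S₁ S₂ ⟨δ₁, hδ₁, V₁, hV₁, hcl₁, κ₁, hκ₁, hκu₁⟩ ⟨δ₂, hδ₂, V₂, hV₂, hcl₂, κ₂, hκ₂, hκu₂⟩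
    obtain ⟨W₁, hW₁, hSW₁, hWV₁⟩ := normal_exists_closure_subset isClosed_closure hV₁ hcl₁
    obtain ⟨W₂, hW₂, hSW₂, hWV₂⟩ := normal_exists_closure_subset isClosed_closure hV₂ hcl₂
    -- uniform agreement on the overlap
    obtain ⟨ρ, hρ, hρe⟩ : ∃ ρ, 0 < ρ ∧
        ∀ p ∈ Ico 0 ρ ×ˢ (closure W₁ ∩ closure W₂), κ₁ p = κ₂ p := by
      refine (isClosed_closure.inter isClosed_closure).isCompact.induction_on
        (p := fun S => ∃ ρ, 0 < ρ ∧ ∀ p ∈ Ico (0 : ℝ) ρ ×ˢ S, κ₁ p = κ₂ p)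
        ⟨1, one_pos, fun p hp => absurd hp.2 (notMem_empty _)⟩ ?_ ?_ ?_
      · rintro S T hST ⟨ρ, hρ, h⟩
        exact ⟨ρ, hρ, fun p hp => h p ⟨hp.1, hST hp.2⟩⟩
      · rintro S T ⟨ρ, hρ, h⟩ ⟨ρ', hρ', h'⟩
        refine ⟨min ρ ρ', lt_min hρ hρ', fun p hp => ?_⟩
        rcases hp.2 with hp2 | hp2
        · exact h p ⟨⟨hp.1.1, hp.1.2.trans_le (min_le_left _ _)⟩, hp2⟩
        · exact h' p ⟨⟨hp.1.1, hp.1.2.trans_le (min_le_right _ _)⟩, hp2⟩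
      · intro q hq
        obtain ⟨ρ, hρ, N, hN, hqN, h⟩ := hκ₁.exists_eqOn hjc hjb hα₀.isContactForm hκ₂ hδ₁ hδ₂
          hV₁ hV₂ (hWV₁ hq.1) (hWV₂ hq.2)
        exact ⟨N, mem_nhdsWithin_of_mem_nhds (hN.mem_nhds hqN), ρ, hρ, h⟩
    classical
    set δ := min ρ (min δ₁ δ₂) with hδ
    have hδ0 : 0 < δ := lt_min hρ (lt_min hδ₁ hδ₂)
    -- The choice made on the overlap is harmless: the two collars agree there for times below `ρ`,
    -- uniformly by compactness of `closure W₁ ∩ closure W₂`.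
    set κ : ℝ × K → F := fun p => if p.2 ∈ W₁ then κ₁ p else κ₂ p with hκ
    have he₁ : ∀ p ∈ Ico 0 δ ×ˢ W₁, κ p = κ₁ p := fun p hp => if_pos hp.2
    have he₂ : ∀ p ∈ Ico 0 δ ×ˢ W₂, κ p = κ₂ p := by
      intro p hp
      by_cases h : p.2 ∈ W₁
      · simp only [hκ]
        rw [if_pos h]
        exact hρe p ⟨⟨hp.1.1, hp.1.2.trans_le (min_le_left _ _)⟩, subset_closure h,
          subset_closure hp.2⟩
      · exact if_neg h
    have hcol : ∀ {δ' : ℝ} {V' W' : Set K} {κ' : ℝ × K → F}, IsOpen W' → W' ⊆ V' → δ ≤ δ' →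
        IsOpen V' → IsCollar (𝓡∂ (2 * m + 2)) j lam α₀ δ' V' κ' →
        IsCollar (𝓡∂ (2 * m + 2)) j lam α₀ δ W' κ' := fun hW' hWV' hδ' hV' h =>
      .of_locally hW' (fun q hq => ⟨_, _, _, h, hδ', hV', hWV' hq, fun p _ => rfl⟩) hδ0
    have hc₁ := hcol hW₁ (subset_closure.trans hWV₁)
      ((min_le_right _ _).trans (min_le_left _ _)) hV₁ hκ₁
    have hc₂ := hcol hW₂ (subset_closure.trans hWV₂)
      ((min_le_right _ _).trans (min_le_right _ _)) hV₂ hκ₂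
    have hder : ∀ {κ' : ℝ × K → F} {q : K} {c : ℝ}, (∀ r ∈ Ico 0 δ, κ (r, q) = κ' (r, q)) →
        HasDerivWithinAt (fun r => u (κ' (r, q))) c (Ici 0) 0 →
        HasDerivWithinAt (fun r => u (κ (r, q))) c (Ici 0) 0 := by
      intro κ' q c he h
      refine h.congr_of_eventuallyEq ?_ (by rw [he 0 ⟨le_rfl, hδ0⟩])
      filter_upwards [Ico_mem_nhdsGE hδ0] with r hr
      rw [he r hr]
    refine ⟨δ, hδ0, W₁ ∪ W₂, hW₁.union hW₂, ?_, κ, .of_locally (hW₁.union hW₂) (fun q hq => ?_) hδ0,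
      fun q hq => ?_⟩
    · rw [closure_union]
      exact union_subset_union hSW₁ hSW₂
    · rcases hq with hq | hq
      · exact ⟨δ, W₁, κ₁, hc₁, le_rfl, hW₁, hq, fun p hp => he₁ p ⟨hp.1, hp.2.2⟩⟩
      · exact ⟨δ, W₂, κ₂, hc₂, le_rfl, hW₂, hq, fun p hp => he₂ p ⟨hp.1, hp.2.2⟩⟩
    · rcases hq with hq | hq
      · obtain ⟨c, hc, hc'⟩ := hκu₁ q (hWV₁ (subset_closure hq))
        exact ⟨c, hder (fun r hr => he₁ (r, q) ⟨hr, hq⟩) hc, hc'⟩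
      · obtain ⟨c, hc, hc'⟩ := hκu₂ q (hWV₂ (subset_closure hq))
        exact ⟨c, hder (fun r hr => he₂ (r, q) ⟨hr, hq⟩) hc, hc'⟩
  · intro q _
    obtain ⟨δ, hδ, V, hV, hqV, κ, hκ, hκu⟩ := exists_isCollar hj hu hβ hα₀ q
    obtain ⟨t, ht, htc, htV⟩ := exists_mem_nhds_isClosed_subset (hV.mem_nhds hqV)
    exact ⟨t, mem_nhdsWithin_of_mem_nhds ht, δ, hδ, V, hV, by rwa [htc.closure_eq], κ, hκ, hκu⟩

end Gluing

/-! ### Changing charts by local homeomorphisms that preserve the model range. -/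

section ModelRestriction

variable {E : Type*} [NormedAddCommGroup E] [NormedSpace ℝ E] {H : Type*} [TopologicalSpace H]

/-- The restriction to the model space of a local homeomorphism of the vector space which preserves
the range of the model. -/
def modelRestr (I : ModelWithCorners ℝ E H) (A : OpenPartialHomeomorph E E)
    (hA : ∀ y ∈ A.source, y ∈ range I ↔ A y ∈ range I) : OpenPartialHomeomorph H H where
  toFun z := I.symm (A (I z))
  invFun z := I.symm (A.symm (I z))
  source := I ⁻¹' A.source
  target := I ⁻¹' A.target
  map_source' z hz := by
    change I (I.symm (A (I z))) ∈ A.target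
    rw [I.right_inv ((hA _ hz).1 (mem_range_self z))]
    exact A.map_source hz
  map_target' z hz := by
    change I (I.symm (A.symm (I z))) ∈ A.source
    rw [I.right_inv ((hA _ (A.map_target hz)).2 (by rw [A.right_inv hz]; exact mem_range_self z))]
    exact A.map_target hz
  left_inv' z hz := by
    rw [I.right_inv ((hA _ hz).1 (mem_range_self z)), A.left_inv hz, I.left_inv]
  right_inv' z hz := by
    rw [I.right_inv ((hA _ (A.map_target hz)).2 (by rw [A.right_inv hz]; exact mem_range_self z)),
      A.right_inv hz, I.left_inv]
  open_source := A.open_source.preimage I.continuous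
  open_target := A.open_target.preimage I.continuous
  continuousOn_toFun := I.continuous_symm.comp_continuousOn
    (A.continuousOn.comp I.continuous.continuousOn fun _ hz => hz)
  continuousOn_invFun := I.continuous_symm.comp_continuousOn
    (A.symm.continuousOn.comp I.continuous.continuousOn fun _ hz => hz)

variable {I : ModelWithCorners ℝ E H} {A : OpenPartialHomeomorph E E}

lemma modelRestr_mem_contDiffGroupoid (hA : ∀ y ∈ A.source, y ∈ range I ↔ A y ∈ range I)
    (h1 : ContDiffOn ℝ ∞ A (A.source ∩ range I))
    (h2 : ContDiffOn ℝ ∞ A.symm (A.target ∩ range I)) :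
    modelRestr I A hA ∈ contDiffGroupoid ∞ I := by
  rw [contDiffGroupoid, mem_groupoid_of_pregroupoid]
  constructor
  · have hs : I.symm ⁻¹' (I ⁻¹' A.source) ∩ range I ⊆ A.source ∩ range I := by
      rintro y ⟨hy, hyr⟩
      refine ⟨?_, hyr⟩
      have : I (I.symm y) ∈ A.source := hy
      rwa [I.right_inv hyr] at this
    change ContDiffOn ℝ ∞ (fun y => I (I.symm (A (I (I.symm y)))))
      (I.symm ⁻¹' (I ⁻¹' A.source) ∩ range I)
    refine (h1.mono hs).congr fun y hy => ?_
    rw [I.right_inv hy.2, I.right_inv ((hA y (hs hy).1).1 hy.2)]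
  · have hs : I.symm ⁻¹' (I ⁻¹' A.target) ∩ range I ⊆ A.target ∩ range I := by
      rintro y ⟨hy, hyr⟩
      refine ⟨?_, hyr⟩
      have : I (I.symm y) ∈ A.target := hy
      rwa [I.right_inv hyr] at this
    change ContDiffOn ℝ ∞ (fun y => I (I.symm (A.symm (I (I.symm y)))))
      (I.symm ⁻¹' (I ⁻¹' A.target) ∩ range I)
    refine (h2.mono hs).congr fun y hy => ?_
    rw [I.right_inv hy.2, I.right_inv ((hA _ (A.map_target (hs hy).1)).2 (by
      rw [A.right_inv (hs hy).1]; exact hy.2))]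

lemma trans_mem_maximalAtlas {M : Type*} [TopologicalSpace M] [ChartedSpace H M]
    {e : OpenPartialHomeomorph M H} (he : e ∈ IsManifold.maximalAtlas I ∞ M)
    {g : OpenPartialHomeomorph H H} (hg : g ∈ contDiffGroupoid ∞ I) :
    e.trans g ∈ IsManifold.maximalAtlas I ∞ M := by
  intro e' he'
  constructor
  · rw [OpenPartialHomeomorph.trans_symm_eq_symm_trans_symm, OpenPartialHomeomorph.trans_assoc]
    exact (contDiffGroupoid ∞ I).trans ((contDiffGroupoid ∞ I).symm hg) (he e' he').1
  · rw [← OpenPartialHomeomorph.trans_assoc]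
    exact (contDiffGroupoid ∞ I).trans (he e' he').2 hg

end ModelRestriction

/-! ### A criterion for immersions with trivial complement. -/

section LocalDiffeomorphism

variable {E : Type*} [NormedAddCommGroup E] [NormedSpace ℝ E] {H : Type*} [TopologicalSpace H]
  {I : ModelWithCorners ℝ E H} {M : Type*} [TopologicalSpace M] [ChartedSpace H M]
  {E' : Type*} [NormedAddCommGroup E'] [NormedSpace ℝ E'] {H' : Type*} [TopologicalSpace H']
  {I' : ModelWithCorners ℝ E' H'} {N : Type*} [TopologicalSpace N] [ChartedSpace H' N]
  [IsManifold I' ∞ N]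

/-- A map which a chart of the source and a modified preferred chart of the target turn into a
linear equivalence is an immersion, with trivial complement. -/
lemma isImmersionAtOfComplement_of_eventually_eq {f : M → N} {x : M} (hf : ContinuousAt f x)
    {e : OpenPartialHomeomorph M H} (he : e ∈ IsManifold.maximalAtlas I ∞ M) (hx : x ∈ e.source)
    {A : OpenPartialHomeomorph E' E'} (L : E ≃L[ℝ] E')
    (hA : ∀ y ∈ A.source, y ∈ range I' ↔ A y ∈ range I')
    (h1 : ContDiffOn ℝ ∞ A (A.source ∩ range I'))
    (h2 : ContDiffOn ℝ ∞ A.symm (A.target ∩ range I'))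
    (hfx : extChartAt I' (f x) (f x) ∈ A.source)
    (hev : ∀ᶠ y in 𝓝 x, A (extChartAt I' (f x) (f y)) = L (e.extend I y)) :
    Manifold.IsImmersionAtOfComplement PUnit.{1} I I' ∞ f x := by
  have hev1 : ∀ᶠ y in 𝓝 x, f y ∈ (extChartAt I' (f x)).source :=
    hf.eventually (extChartAt_source_mem_nhds (f x))
  have hev2 : ∀ᶠ y in 𝓝 x, extChartAt I' (f x) (f y) ∈ A.source :=
    ((continuousAt_extChartAt (I := I') (f x)).comp hf).eventually (A.open_source.mem_nhds hfx)
  obtain ⟨s, hs, hso, hxs⟩ := eventually_nhds_iff.1 (hev1.and (hev2.and hev))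
  refine Manifold.IsImmersionAtOfComplement.mk_of_continuousAt hf
    ((ContinuousLinearEquiv.prodUnique ℝ E PUnit.{1}).trans L)
    (e.restr s) ((chartAt H' (f x)).trans (modelRestr I' A hA)) ?_ ?_ ?_ ?_ ?_
  · rw [e.restr_source' _ hso]
    exact ⟨hx, hxs⟩
  · rw [OpenPartialHomeomorph.trans_source]
    exact ⟨mem_chart_source H' (f x), hfx⟩
  · exact restr_mem_maximalAtlas (contDiffGroupoid ∞ I) he hso
  · exact trans_mem_maximalAtlas (IsManifold.chart_mem_maximalAtlas (f x))
      (modelRestr_mem_contDiffGroupoid hA h1 h2)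
  · intro z hz
    set y := ((e.restr s).extend I).symm z with hy
    have hys : y ∈ (e.restr s).source := by
      rw [← (e.restr s).extend_source (I := I)]
      exact ((e.restr s).extend I).map_target hz
    have hyz : e.extend I y = z := ((e.restr s).extend I).right_inv hz
    rw [e.restr_source' _ hso] at hys
    obtain ⟨hy1, hy2, hy3⟩ := hs y hys.2
    change I' (I'.symm (A (extChartAt I' (f x) (f y)))) = L z
    rw [I'.right_inv ((hA _ hy2).1 ?_), hy3, hyz]
    exact extChartAt_target_subset_range (f x) ((extChartAt I' (f x)).map_source hy1)

end LocalDiffeomorphism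

/-! ### Collars as local homeomorphisms of half spaces. -/

section CollarCharts

variable {X : Type*} [NormedAddCommGroup X] [NormedSpace ℝ X] [FiniteDimensional ℝ X]
  {K : Type*} [TopologicalSpace K] [ChartedSpace X K] [IsManifold 𝓘(ℝ, X) ∞ K]
  {n : ℕ} [NeZero n]
  {F : Type*} [TopologicalSpace F] [ChartedSpace (EuclideanHalfSpace n) F]
  [IsManifold (𝓡∂ n) ∞ F]

/-- The expression of a collar in charts is a local homeomorphism of the half spaces. -/
structure IsCollarChart (n : ℕ) [NeZero n] {F : Type*} [TopologicalSpace F]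
    [ChartedSpace (EuclideanHalfSpace n) F] (κ : ℝ × K → F) (D : Set (ℝ × K)) (p₀ : ℝ × K)
    (Θ : OpenPartialHomeomorph (ℝ × X) (EuclideanSpace ℝ (Fin n))) : Prop where
  mem_source : (p₀.1, extChartAt 𝓘(ℝ, X) p₀.2 p₀.2) ∈ Θ.source
  eq_apply : ∀ p ∈ D, p.2 ∈ (extChartAt 𝓘(ℝ, X) p₀.2).source →
    (p.1, extChartAt 𝓘(ℝ, X) p₀.2 p.2) ∈ Θ.source →
      extChartAt (𝓡∂ n) (κ p₀) (κ p) = Θ (p.1, extChartAt 𝓘(ℝ, X) p₀.2 p.2)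
  nonneg_iff : ∀ p ∈ Θ.source, 0 ≤ normalCoord n (Θ p) ↔ 0 ≤ p.1
  pos : 0 < p₀.1 → ∀ p ∈ Θ.source, 0 < p.1
  contDiffOn : ContDiffOn ℝ ∞ Θ (Θ.source ∩ {p | 0 ≤ p.1})
  contDiffOn_symm : ContDiffOn ℝ ∞ Θ.symm (Θ.target ∩ {z | 0 ≤ normalCoord n z})

/-- At `r = 0` the expression in charts sends the boundary slice to normal coordinate `0` and has
invertible derivative, so the half-space inverse function theorem applies. The condition for `0 <
p₀.1` is vacuous. -/
lemma IsCollar.exists_isCollarChart_zero {j : K → F} (hj : Continuous j)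
    (hjb : ∀ q, j q ∈ (𝓡∂ n).boundary F) {lam : DiffForm (𝓡∂ n) F 1} {α : DiffForm 𝓘(ℝ, X) K 1}
    {δ : ℝ} {V : Set K} {κ : ℝ × K → F} (h : IsCollar (𝓡∂ n) j lam α δ V κ) (hδ : 0 < δ)
    (hV : IsOpen V) {q : K} (hq : q ∈ V) :
    ∃ Θ : OpenPartialHomeomorph (ℝ × X) (EuclideanSpace ℝ (Fin n)),
      IsCollarChart n κ (Ico 0 δ ×ˢ V) (0, q) Θ := by
  have := FiniteDimensional.complete ℝ X
  set ψ := extChartAt 𝓘(ℝ, X) q with hψ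
  set φ := extChartAt (𝓡∂ n) (κ (0, q)) with hφ
  have hψq : ψ.symm (ψ q) = q := ψ.left_inv (mem_extChartAt_source q)
  have hjφ : j q ∈ φ.source := by
    rw [← h.zero q hq]
    exact mem_extChartAt_source _
  set U := ψ.target ∩ ψ.symm ⁻¹' (V ∩ j ⁻¹' φ.source) with hU
  have hUo : IsOpen U := (continuousOn_extChartAt_symm q).isOpen_inter_preimage
    (isOpen_extChartAt_target q) (hV.inter ((isOpen_extChartAt_source _).preimage hj))
  have hyU : ψ q ∈ U := ⟨mem_extChartAt_target q, by
    change ψ.symm (ψ q) ∈ V ∩ j ⁻¹' φ.source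
    rw [hψq]
    exact ⟨hq, hjφ⟩⟩
  have hUV : MapsTo ψ.symm U V := fun y hy => hy.2.1
  have hc : ContinuousOn (fun p : ℝ × X => κ (p.1, ψ.symm p.2)) (Ico 0 δ ×ˢ U) :=
    h.contMDiffOn.continuousOn.comp (continuousOn_fst.prodMk
      ((continuousOn_extChartAt_symm q).comp continuousOn_snd fun p hp => hp.2.1))
      fun p hp => ⟨hp.1, hUV hp.2⟩
  have hev : ∀ᶠ p in 𝓝[Ico 0 δ ×ˢ U] ((0 : ℝ), ψ q), κ (p.1, ψ.symm p.2) ∈ φ.source := by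
    refine (hc (0, ψ q) ⟨⟨le_rfl, hδ⟩, hyU⟩).eventually
      ((isOpen_extChartAt_source _).mem_nhds ?_)
    change κ (0, ψ.symm (ψ q)) ∈ φ.source
    rw [h.zero _ (hUV hyU), hψq]
    exact hjφ
  obtain ⟨δ', hδ', hδδ', W, hW, hyW, hWU, hE⟩ := exists_Ico_prod_subset hδ hUo hyU hev
  have hs := h.isModelSolution (q₀ := q) (x₀ := κ (0, q)) hV hδδ' hW (fun y hy => (hWU hy).1)
    (hUV.mono_left hWU) hE (ℓ := normalCoord n) fun x hx hxi => (mem_interior_iff hx).1 hxi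
  have hnn : ∀ x ∈ φ.source, 0 ≤ normalCoord n (φ x) := fun x hx => by
    have := φ.map_source hx
    rw [hφ, extChartAt_target_eq] at this
    exact this.2
  obtain ⟨Θ, hΘ0, hΘs, hΘe, hΘnn, hΘp, -, hΘsymm⟩ := exists_halfSpace_inverse hδ' hW hyW
    hs.contDiffOn normalCoord_ne_zero (fun p hp => hnn _ (hE p hp))
    (fun y hy => by
      rw [hs.zero y hy]
      exact normalCoord_eq_zero (hWU hy).2.2 (hjb _))
    (hs.isInvertible (0, ψ q) ⟨⟨le_rfl, hδ'⟩, hyW⟩)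
  refine ⟨Θ, hΘ0, fun p hp hp2 hpΘ => ?_, hΘnn, fun h0 => absurd h0 (lt_irrefl _), ?_, hΘsymm⟩
  · rw [hΘe _ hpΘ hp.1.1]
    change φ (κ p) = φ (κ (p.1, ψ.symm (ψ p.2)))
    rw [ψ.left_inv hp2]
  · exact (hs.contDiffOn.mono fun p hp => ⟨⟨hp.2, (hΘs hp.1).1⟩, (hΘs hp.1).2⟩).congr
      fun p hp => hΘe p hp.1 hp.2

/-- At positive time the ordinary inverse function theorem suffices. The source is kept inside times
in `(0, δ)`, where the image is interior, so both sides of the sign condition are true. -/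
lemma IsCollar.exists_isCollarChart_pos {j : K → F} {lam : DiffForm (𝓡∂ n) F 1}
    {α : DiffForm 𝓘(ℝ, X) K 1}
    {δ : ℝ} {V : Set K} {κ : ℝ × K → F} (h : IsCollar (𝓡∂ n) j lam α δ V κ)
    (hV : IsOpen V) {p₀ : ℝ × K} (hp₀ : p₀ ∈ Ico 0 δ ×ˢ V) (h0 : 0 < p₀.1) :
    ∃ Θ : OpenPartialHomeomorph (ℝ × X) (EuclideanSpace ℝ (Fin n)),
      IsCollarChart n κ (Ico 0 δ ×ˢ V) p₀ Θ := by
  have := FiniteDimensional.complete ℝ X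
  obtain ⟨t, q⟩ := p₀
  set ψ := extChartAt 𝓘(ℝ, X) q with hψ
  set φ := extChartAt (𝓡∂ n) (κ (t, q)) with hφ
  have hψq : ψ.symm (ψ q) = q := ψ.left_inv (mem_extChartAt_source q)
  set U := ψ.target ∩ ψ.symm ⁻¹' V with hU
  have hUo : IsOpen U := (continuousOn_extChartAt_symm q).isOpen_inter_preimage
    (isOpen_extChartAt_target q) hV
  have hyU : ψ q ∈ U := ⟨mem_extChartAt_target q, by
    change ψ.symm (ψ q) ∈ V
    rw [hψq]
    exact hp₀.2⟩
  have hIo : Ioo 0 δ ×ˢ V ⊆ Ico 0 δ ×ˢ V := prod_mono_left Ioo_subset_Ico_self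
  have hc : ContinuousOn (fun p : ℝ × X => κ (p.1, ψ.symm p.2)) (Ioo 0 δ ×ˢ U) :=
    h.contMDiffOn.continuousOn.comp (continuousOn_fst.prodMk
      ((continuousOn_extChartAt_symm q).comp continuousOn_snd fun p hp => hp.2.1))
      fun p hp => hIo ⟨hp.1, hp.2.2⟩
  have hO : IsOpen (Ioo 0 δ ×ˢ U ∩ (fun p : ℝ × X => κ (p.1, ψ.symm p.2)) ⁻¹' φ.source) :=
    hc.isOpen_inter_preimage (isOpen_Ioo.prod hUo) (isOpen_extChartAt_source _)
  obtain ⟨S, W, hS, htS, hW, hyW, hSW⟩ := mem_nhds_prod_iff'.1 (hO.mem_nhds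
    (show (t, ψ q) ∈ _ from ⟨⟨⟨h0, hp₀.1.2⟩, hyU⟩, by
      change κ (t, ψ.symm (ψ q)) ∈ φ.source
      rw [hψq]
      exact mem_extChartAt_source _⟩))
  have hmem : (t, ψ q) ∈ S ×ˢ W := ⟨htS, hyW⟩
  have hSo : S ⊆ Ioo 0 δ := fun s hs => (hSW (show (s, ψ q) ∈ S ×ˢ W from ⟨hs, hyW⟩)).1.1
  have hWU : W ⊆ U := fun y hy => (hSW (show (t, y) ∈ S ×ˢ W from ⟨htS, hy⟩)).1.2
  have hE : ∀ p ∈ S ×ˢ W, κ (p.1, ψ.symm p.2) ∈ φ.source := fun p hp => (hSW hp).2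
  set G : ℝ × X → EuclideanSpace ℝ (Fin n) := fun p => φ (κ (p.1, ψ.symm p.2)) with hG
  have hDo : IsOpen (S ×ˢ W) := hS.prod hW
  have hκS : ContMDiffOn (𝓘(ℝ, ℝ).prod 𝓘(ℝ, X)) (𝓡∂ n) ∞ κ (S ×ˢ V) :=
    h.contMDiffOn.mono ((prod_mono_left hSo).trans hIo)
  have hGc : ContDiffOn ℝ ∞ G (S ×ˢ W) :=
    contDiffOn_written hκS (fun y hy => (hWU hy).1) (fun y hy => (hWU hy).2) hE
  have hGd : ∀ p ∈ S ×ˢ W, ∃ G' : (ℝ × X) ≃L[ℝ] EuclideanSpace ℝ (Fin n),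
      HasFDerivAt G (G' : ℝ × X →L[ℝ] EuclideanSpace ℝ (Fin n)) p := by
    intro p hp
    have h1 := (hasFDerivWithinAt_written hκS (fun y hy => (hWU hy).1) (fun y hy => (hWU hy).2) hE
      hp).hasFDerivAt (hDo.mem_nhds hp)
    have hp' : (p.1, ψ.symm p.2) ∈ Ico 0 δ ×ˢ V := hIo ⟨hSo hp.1, (hWU hp.2).2⟩
    have h2 := h.isInvertible _ hp'
    rw [derivWithinAt_of_mem_nhds (Ico_prod_mem_nhds hV hp' (hSo hp.1).1),
      ← derivWithinAt_of_mem_nhds ((hS.prod hV).mem_nhds (show (p.1, ψ.symm p.2) ∈ S ×ˢ V from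
        ⟨hp.1, (hWU hp.2).2⟩))] at h2
    obtain ⟨G', hG'⟩ := (isInvertible_derivAt_extChartAt (hE p hp)).comp (h2.comp
      (isInvertible_fst_prod (isInvertible_derivWithinAt_extChartAt_symm (hWU hp.2).1)))
    exact ⟨G', by rw [hG']; exact h1⟩
  obtain ⟨G', hG'⟩ := hGd _ hmem
  have hat : ∀ p ∈ S ×ˢ W, ContDiffAt ℝ ∞ G p := fun p hp => hGc.contDiffAt (hDo.mem_nhds hp)
  let Θ := ((hat _ hmem).toOpenPartialHomeomorph G hG' (by simp)).restrOpen (S ×ˢ W) hDo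
  have hΘs : ∀ p ∈ Θ.source, p ∈ S ×ˢ W := fun p hp => hp.2
  have hΘG : ∀ p, Θ p = G p := fun _ => rfl
  refine ⟨Θ, ⟨(hat _ hmem).mem_toOpenPartialHomeomorph_source hG' (by simp), hmem⟩,
    fun p hp hp2 hpΘ => ?_, fun p hp => ?_, fun _ p hp => (hSo (hΘs p hp).1).1, ?_, fun z hz => ?_⟩
  · rw [hΘG]
    change φ (κ p) = φ (κ (p.1, ψ.symm (ψ p.2)))
    rw [ψ.left_inv hp2]
  · have hp' := hΘs p hp
    refine iff_of_true ?_ (hSo hp'.1).1.le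
    exact ((mem_interior_iff (hE p hp')).1 (h.mem_interior _ (hIo ⟨hSo hp'.1, (hWU hp'.2).2⟩)
      (hSo hp'.1).1)).le
  · exact hGc.mono fun p hp => hΘs p hp.1
  · have hz' := hΘs _ (Θ.map_target hz.1)
    obtain ⟨B, hB⟩ := hGd _ hz'
    exact (Θ.contDiffAt_symm hz.1 hB (hat _ hz')).contDiffWithinAt

lemma IsCollar.exists_isCollarChart {j : K → F} (hj : Continuous j)
    (hjb : ∀ q, j q ∈ (𝓡∂ n).boundary F) {lam : DiffForm (𝓡∂ n) F 1} {α : DiffForm 𝓘(ℝ, X) K 1}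
    {δ : ℝ} {V : Set K} {κ : ℝ × K → F} (h : IsCollar (𝓡∂ n) j lam α δ V κ)
    (hV : IsOpen V) {p₀ : ℝ × K} (hp₀ : p₀ ∈ Ico 0 δ ×ˢ V) :
    ∃ Θ : OpenPartialHomeomorph (ℝ × X) (EuclideanSpace ℝ (Fin n)),
      IsCollarChart n κ (Ico 0 δ ×ˢ V) p₀ Θ := by
  rcases hp₀.1.1.eq_or_lt with h0 | h0
  · obtain ⟨t, q⟩ := p₀
    obtain rfl : 0 = t := h0
    exact h.exists_isCollarChart_zero hj hjb hp₀.1.2 hV hp₀.2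
  · exact h.exists_isCollarChart_pos hV hp₀ h0

/-- A collar is injective near every point. -/
lemma IsCollarChart.exists_injOn {κ : ℝ × K → F} {D : Set (ℝ × K)} {p₀ : ℝ × K}
    {Θ : OpenPartialHomeomorph (ℝ × X) (EuclideanSpace ℝ (Fin n))}
    (h : IsCollarChart n κ D p₀ Θ) : ∃ N ∈ 𝓝 p₀, InjOn κ (N ∩ D) := by
  set ψ := extChartAt 𝓘(ℝ, X) p₀.2 with hψ
  have hc : ContinuousAt (fun p : ℝ × K => (p.1, ψ p.2)) p₀ :=
    continuousAt_fst.prodMk ((continuousAt_extChartAt p₀.2).comp continuousAt_snd)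
  refine ⟨_, inter_mem (hc.preimage_mem_nhds (Θ.open_source.mem_nhds h.mem_source))
    (continuousAt_snd.preimage_mem_nhds (extChartAt_source_mem_nhds (I := 𝓘(ℝ, X)) p₀.2)), ?_⟩
  rintro p ⟨⟨hpΘ, hpψ⟩, hpD⟩ p' ⟨⟨hpΘ', hpψ'⟩, hpD'⟩ he
  have h1 := Θ.injOn hpΘ hpΘ' (by
    rw [← h.eq_apply p hpD hpψ hpΘ, ← h.eq_apply p' hpD' hpψ' hpΘ', he])
  obtain ⟨h2, h3⟩ := Prod.mk.inj h1
  exact Prod.ext h2 (ψ.injOn hpψ hpψ' h3)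

end CollarCharts

/-! ### Collars are immersions of `[0, R] × K`. -/

section CollarImmersion

/-- The chart of `F` is modified by `A = T ∘ Θ⁻¹`, which undoes the collar and then applies `T`; in
it, the map becomes the linear equivalence `L` in the chart `e`. The map `T` must match the half
space of `F` with the condition `0 ≤ p.1` near the point, so that `A` preserves the model range. The
complement is a point, as the dimensions agree. -/
lemma IsCollarChart.isImmersionAtOfComplement {X : Type*} [NormedAddCommGroup X] [NormedSpace ℝ X]
    {K : Type*} [TopologicalSpace K] [ChartedSpace X K] {n : ℕ} [NeZero n]
    {F : Type*} [TopologicalSpace F] [ChartedSpace (EuclideanHalfSpace n) F]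
    [IsManifold (𝓡∂ n) ∞ F]
    {E : Type*} [NormedAddCommGroup E] [NormedSpace ℝ E] {H : Type*} [TopologicalSpace H]
    {I : ModelWithCorners ℝ E H} {M : Type*} [TopologicalSpace M] [ChartedSpace H M]
    {κ : ℝ × K → F} {D : Set (ℝ × K)} {g : M → ℝ × K} (hg : Continuous g) {x : M}
    (hgD : ∀ y, g y ∈ D) (hκg : ContinuousAt (fun y => κ (g y)) x)
    {Θ : OpenPartialHomeomorph (ℝ × X) (EuclideanSpace ℝ (Fin n))}
    (hΘ : IsCollarChart n κ D (g x) Θ) (T : (ℝ × X) ≃ₜ EuclideanSpace ℝ (Fin n))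
    (hT : ContDiff ℝ ∞ T) (hT' : ContDiff ℝ ∞ T.symm) {S : Set (ℝ × X)} (hS : IsOpen S)
    (hxS : ((g x).1, extChartAt 𝓘(ℝ, X) (g x).2 (g x).2) ∈ S)
    (hTS : ∀ p ∈ Θ.source ∩ S, 0 ≤ p.1 ↔ 0 ≤ normalCoord n (T p))
    {e : OpenPartialHomeomorph M H} (he : e ∈ IsManifold.maximalAtlas I ∞ M) (hx : x ∈ e.source)
    (L : E ≃L[ℝ] EuclideanSpace ℝ (Fin n))
    (hL : ∀ y, T ((g y).1, extChartAt 𝓘(ℝ, X) (g x).2 (g y).2) = L (e.extend I y)) :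
    Manifold.IsImmersionAtOfComplement PUnit.{1} I (𝓡∂ n) ∞ (fun y => κ (g y)) x := by
  set ψ := extChartAt 𝓘(ℝ, X) (g x).2 with hψ
  let A := (Θ.restrOpen S hS).symm.transHomeomorph T
  have hA : ∀ z, A z = T (Θ.symm z) := fun _ => rfl
  have hA' : ∀ z, A.symm z = Θ (T.symm z) := fun _ => rfl
  have hAs : ∀ z ∈ A.source, z ∈ Θ.target ∧ Θ.symm z ∈ Θ.source ∩ S := fun z hz =>
    ⟨hz.1, (Θ.restrOpen S hS).map_target hz⟩
  have hAt : ∀ z ∈ A.target, T.symm z ∈ Θ.source ∩ S := fun z hz => hz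
  have hr : ∀ z, z ∈ range (𝓡∂ n) ↔ 0 ≤ normalCoord n z := fun z => by
    rw [range_modelWithCornersEuclideanHalfSpace]
    rfl
  have hψx : (g x).2 ∈ ψ.source := mem_extChartAt_source _
  have hκx : extChartAt (𝓡∂ n) (κ (g x)) (κ (g x)) = Θ ((g x).1, ψ (g x).2) :=
    hΘ.eq_apply _ (hgD x) hψx hΘ.mem_source
  refine isImmersionAtOfComplement_of_eventually_eq hκg he hx (A := A) L (fun z hz => ?_)
    ?_ ?_ ?_ ?_
  · obtain ⟨h1, h2⟩ := hAs z hz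
    rw [hr, hr, hA, ← hTS _ h2, ← hΘ.nonneg_iff _ h2.1, Θ.right_inv h1]
  · exact hT.comp_contDiffOn (hΘ.contDiffOn_symm.mono fun z hz => ⟨(hAs z hz.1).1, (hr z).1 hz.2⟩)
  · refine hΘ.contDiffOn.comp hT'.contDiffOn fun z hz => ⟨(hAt z hz.1).1, ?_⟩
    refine (hTS _ (hAt z hz.1)).2 ?_
    rw [T.apply_symm_apply]
    exact (hr z).1 hz.2
  · change extChartAt (𝓡∂ n) (κ (g x)) (κ (g x)) ∈ (Θ.restrOpen S hS).target
    rw [hκx]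
    exact (Θ.restrOpen S hS).map_source ⟨hΘ.mem_source, hxS⟩
  · have h1 : ContinuousAt (fun y => ψ (g y).2) x :=
      ContinuousAt.comp (f := fun y => (g y).2) (continuousAt_extChartAt (g x).2)
        hg.snd.continuousAt
    have h2 : ∀ᶠ y in 𝓝 x, ((g y).1, ψ (g y).2) ∈ Θ.source :=
      (hg.fst.continuousAt.prodMk h1).eventually (Θ.open_source.mem_nhds hΘ.mem_source)
    have h3 : ∀ᶠ y in 𝓝 x, (g y).2 ∈ ψ.source :=
      hg.snd.continuousAt.eventually (extChartAt_source_mem_nhds (g x).2)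
    filter_upwards [h2, h3] with y hy1 hy2
    rw [hΘ.eq_apply _ (hgD y) hy2 hy1, hA, Θ.left_inv hy1, hL]

/-- Coordinates on a half space in which the first coordinate is the normal one. -/
lemma exists_normalCoord_equiv (k : ℕ) :
    ∃ L : (ℝ × EuclideanSpace ℝ (Fin k)) ≃L[ℝ] EuclideanSpace ℝ (Fin (k + 1)),
      ∀ p, normalCoord (k + 1) (L p) = p.1 :=
  ⟨((ContinuousLinearEquiv.refl ℝ ℝ).prodCongr (EuclideanSpace.equiv (Fin k) ℝ)).trans
    ((Fin.consEquivL ℝ fun _ => ℝ).trans (EuclideanSpace.equiv (Fin (k + 1)) ℝ).symm),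
    fun _ => rfl⟩

/-- The coordinate of a one-dimensional space. -/
def lineEquiv : EuclideanSpace ℝ (Fin 1) ≃L[ℝ] ℝ :=
  (EuclideanSpace.equiv (Fin 1) ℝ).trans (ContinuousLinearEquiv.funUnique (Fin 1) ℝ ℝ)

variable {m : ℕ}
  {F : Type*} [TopologicalSpace F] [ChartedSpace (EuclideanHalfSpace (2 * m + 2)) F]
  {K : Type*} [TopologicalSpace K] [ChartedSpace (EuclideanSpace ℝ (Fin (2 * m + 1))) K]
  [IsManifold (𝓡∂ (2 * m + 2)) ∞ F] [IsManifold (𝓡 (2 * m + 1)) ∞ K]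

lemma IsCollar.continuous_restrict {X : Type*} [NormedAddCommGroup X] [NormedSpace ℝ X]
    {K : Type*} [TopologicalSpace K] [ChartedSpace X K]
    {Y : Type*} [NormedAddCommGroup Y] [NormedSpace ℝ Y]
    {H : Type*} [TopologicalSpace H] {I : ModelWithCorners ℝ Y H}
    {F : Type*} [TopologicalSpace F] [ChartedSpace H F] {j : K → F}
    {lam : DiffForm I F 1} {α : DiffForm 𝓘(ℝ, X) K 1} {δ R : ℝ}
    {κ : ℝ × K → F} (h : IsCollar I j lam α δ univ κ) (hR : R < δ) :
    Continuous fun y : Icc (0 : ℝ) R × K => κ (y.1, y.2) :=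
  h.contMDiffOn.continuousOn.comp_continuous (by fun_prop)
    fun y => ⟨⟨y.1.2.1, y.1.2.2.trans_lt hR⟩, mem_univ _⟩

/-- A collar is an immersion of a manifold with boundary. -/
lemma IsCollar.isImmersionAtOfComplement {j : K → F} (hj : Continuous j)
    (hjb : ∀ q, j q ∈ (𝓡∂ (2 * m + 2)).boundary F) {lam : DiffForm (𝓡∂ (2 * m + 2)) F 1}
    {α : DiffForm (𝓡 (2 * m + 1)) K 1} {δ : ℝ} {κ : ℝ × K → F}
    (h : IsCollar (𝓡∂ (2 * m + 2)) j lam α δ univ κ) {R : ℝ} [hR : Fact (0 < R)] (hRδ : R < δ)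
    (x : Icc (0 : ℝ) R × K) :
    Manifold.IsImmersionAtOfComplement PUnit.{1} ((𝓡∂ 1).prod (𝓡 (2 * m + 1))) (𝓡∂ (2 * m + 2)) ∞
      (fun y : Icc (0 : ℝ) R × K => κ (y.1, y.2)) x := by
  have hgD : ∀ y : Icc (0 : ℝ) R × K, ((y.1 : ℝ), y.2) ∈ Ico 0 δ ×ˢ (univ : Set K) :=
    fun y => ⟨⟨y.1.2.1, y.1.2.2.trans_lt hRδ⟩, mem_univ _⟩
  have hc := h.continuous_restrict hRδ
  obtain ⟨Θ, hΘ⟩ := h.exists_isCollarChart hj hjb isOpen_univ (hgD x)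
  obtain ⟨L, hL⟩ := exists_normalCoord_equiv (2 * m + 1)
  rcases x.1.2.1.eq_or_lt with h0 | h0
  -- At `r = 0` the left chart has coordinate `r - 0`, which is already the normal coordinate; `T`
  -- is linear.
  · refine hΘ.isImmersionAtOfComplement (g := fun y : Icc (0 : ℝ) R × K => ((y.1 : ℝ), y.2))
      (by fun_prop) hgD
      hc.continuousAt L.toHomeomorph L.contDiff L.symm.contDiff isOpen_univ (mem_univ _)
      (fun p _ => by rw [← hL p]; rfl)
      (e := (IccLeftChart 0 R).prod (chartAt (EuclideanSpace ℝ (Fin (2 * m + 1))) x.2))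
      (IsManifold.mem_maximalAtlas_prod (IsManifold.subset_maximalAtlas (mem_insert _ _))
        (IsManifold.chart_mem_maximalAtlas x.2)) ⟨?_, mem_chart_source _ _⟩
      ((lineEquiv.prodCongr (ContinuousLinearEquiv.refl ℝ _)).trans L) fun y => ?_
    · change (x.1 : ℝ) < R
      rw [← h0]
      exact hR.out
    · change L ((y.1 : ℝ), _) = L ((y.1 : ℝ) - 0, _)
      rw [sub_zero]
      rfl
  · set ψ := extChartAt (𝓡 (2 * m + 1)) x.2 with hψ
    -- At `r > 0` the right chart has coordinate `R - r`, which near `r = R` would take negative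
    -- values on a neighbourhood of the image, an interior point of `F`. A shear therefore adds the
    -- first coordinate of the `K` factor. The translation `c` makes that coordinate equal to `1` at
    -- the point, so the normal coordinate is at least `1` there and positive nearby. The
    -- translation goes into the chart of `K`, so that the remaining map is linear.
    set c : EuclideanSpace ℝ (Fin (2 * m + 1)) := EuclideanSpace.single 0 1 - ψ x.2 with hcdef
    let T : (ℝ × EuclideanSpace ℝ (Fin (2 * m + 1))) ≃ₜ EuclideanSpace ℝ (Fin (2 * m + 2)) :=
      { toFun := fun p => L (R - p.1 + normalCoord (2 * m + 1) (p.2 + c), p.2 + c)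
        invFun := fun z => (R - (L.symm z).1 + normalCoord (2 * m + 1) (L.symm z).2,
          (L.symm z).2 - c)
        left_inv := fun p => by
          beta_reduce
          rw [L.symm_apply_apply, add_sub_cancel_right]
          exact Prod.ext (by ring) rfl
        right_inv := fun z => by
          beta_reduce
          rw [sub_add_cancel]
          have h1 : R - (R - (L.symm z).1 + normalCoord (2 * m + 1) (L.symm z).2) +
              normalCoord (2 * m + 1) (L.symm z).2 = (L.symm z).1 := by ring
          rw [h1]
          exact L.apply_symm_apply z
        continuous_toFun := by fun_prop
        continuous_invFun := by fun_prop }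
    have hTc : ContDiff ℝ ∞ T := by
      change ContDiff ℝ ∞ fun p : ℝ × EuclideanSpace ℝ (Fin (2 * m + 1)) =>
        L (R - p.1 + normalCoord (2 * m + 1) (p.2 + c), p.2 + c)
      fun_prop
    have hTc' : ContDiff ℝ ∞ T.symm := by
      change ContDiff ℝ ∞ fun z : EuclideanSpace ℝ (Fin (2 * m + 2)) =>
        (R - (L.symm z).1 + normalCoord (2 * m + 1) (L.symm z).2, (L.symm z).2 - c)
      have := L.symm.contDiff (n := ∞)
      fun_prop
    have hTn : ∀ p, normalCoord (2 * m + 2) (T p) =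
        R - p.1 + normalCoord (2 * m + 1) (p.2 + c) := fun p => hL _
    let shear : (ℝ × EuclideanSpace ℝ (Fin (2 * m + 1))) ≃L[ℝ]
        ℝ × EuclideanSpace ℝ (Fin (2 * m + 1)) :=
      ContinuousLinearEquiv.equivOfInverse
        ((ContinuousLinearMap.fst ℝ _ _ + (normalCoord (2 * m + 1)).comp
          (ContinuousLinearMap.snd ℝ _ _)).prod (ContinuousLinearMap.snd ℝ _ _))
        ((ContinuousLinearMap.fst ℝ _ _ - (normalCoord (2 * m + 1)).comp
          (ContinuousLinearMap.snd ℝ _ _)).prod (ContinuousLinearMap.snd ℝ _ _))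
        (fun p => by simp) (fun p => by simp)
    refine hΘ.isImmersionAtOfComplement (g := fun y : Icc (0 : ℝ) R × K => ((y.1 : ℝ), y.2))
      (by fun_prop) hgD
      hc.continuousAt T hTc hTc' (S := {p | 0 < normalCoord (2 * m + 2) (T p)})
      (isOpen_lt continuous_const ((normalCoord (2 * m + 2)).continuous.comp T.continuous)) ?_
      (fun p hp => iff_of_true (hΘ.pos h0 p hp.1).le hp.2.le)
      (e := (IccRightChart 0 R).prod ((chartAt (EuclideanSpace ℝ (Fin (2 * m + 1))) x.2).trans
        (modelRestr (𝓡 (2 * m + 1)) (Homeomorph.addRight c).toOpenPartialHomeomorph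
          fun _ _ => by simp)))
      (IsManifold.mem_maximalAtlas_prod (IsManifold.subset_maximalAtlas (mem_insert_of_mem _ rfl))
        (trans_mem_maximalAtlas (IsManifold.chart_mem_maximalAtlas x.2)
          (modelRestr_mem_contDiffGroupoid _ ?_ ?_))) ⟨h0, ?_⟩
      ((lineEquiv.prodCongr (ContinuousLinearEquiv.refl ℝ _)).trans (shear.trans L)) fun y => ?_
    · change 0 < normalCoord (2 * m + 2) (T ((x.1 : ℝ), ψ x.2))
      rw [hTn, hcdef, add_sub_cancel, normalCoord_single]
      linarith [x.1.2.2]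
    · exact (contDiff_id.add contDiff_const).contDiffOn
    · exact (contDiff_id.add contDiff_const).contDiffOn
    · rw [OpenPartialHomeomorph.trans_source]
      exact ⟨mem_chart_source _ _, mem_univ _⟩
    · rfl

end CollarImmersion

/-! ### Injectivity on a thin collar. -/

section Restriction

variable {X : Type*} [NormedAddCommGroup X] [NormedSpace ℝ X] [FiniteDimensional ℝ X]
  {K : Type*} [TopologicalSpace K] [ChartedSpace X K] [IsManifold 𝓘(ℝ, X) ∞ K] [CompactSpace K]
  {n : ℕ} [NeZero n]
  {F : Type*} [TopologicalSpace F] [ChartedSpace (EuclideanHalfSpace n) F]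
  [IsManifold (𝓡∂ n) ∞ F] [T2Space F]

/-- A collar is injective near the boundary. -/
lemma IsCollar.exists_injective {j : K → F} (hj : Continuous j) (hji : Function.Injective j)
    (hjb : ∀ q, j q ∈ (𝓡∂ n).boundary F) {lam : DiffForm (𝓡∂ n) F 1} {α : DiffForm 𝓘(ℝ, X) K 1}
    {δ : ℝ} (hδ : 0 < δ) {κ : ℝ × K → F} (h : IsCollar (𝓡∂ n) j lam α δ univ κ) :
    ∃ R, 0 < R ∧ R < δ ∧ Function.Injective fun y : Icc (0 : ℝ) R × K => κ (y.1, y.2) := by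
  have hδ2 : δ / 2 < δ := half_lt_self hδ
  have hδ0 : 0 < δ / 2 := half_pos hδ
  set z : Icc (0 : ℝ) (δ / 2) := ⟨0, le_rfl, hδ0.le⟩ with hz
  set g : Icc (0 : ℝ) (δ / 2) × K → ℝ × K := fun y => (y.1, y.2) with hg
  have hgc : Continuous g := by fun_prop
  have hgD : ∀ y, g y ∈ Ico 0 δ ×ˢ (univ : Set K) :=
    fun y => ⟨⟨y.1.2.1, y.1.2.2.trans_lt hδ2⟩, mem_univ _⟩
  have hinj : InjOn (fun y => κ (g y)) ({z} ×ˢ univ) := by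
    rintro ⟨a, p⟩ ⟨ha, -⟩ ⟨b, q⟩ ⟨hb, -⟩ he
    obtain rfl : a = z := ha
    obtain rfl : b = z := hb
    have h1 : κ (0, p) = κ (0, q) := he
    rw [h.zero p (mem_univ p), h.zero q (mem_univ q)] at h1
    rw [hji h1]
  -- The map is injective on the compact slice `r = 0`, where it is `j`, and locally injective at
  -- each of its points; hence it is injective on a neighbourhood of the slice, which contains a
  -- thin tube `[0, R] × K`.
  obtain ⟨t, ht, hti⟩ := hinj.exists_mem_nhdsSet (isCompact_singleton.prod isCompact_univ)
    (fun y _ => (h.continuous_restrict hδ2).continuousAt) fun y _ => by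
      obtain ⟨Θ, hΘ⟩ := h.exists_isCollarChart hj hjb isOpen_univ (hgD y)
      obtain ⟨N, hN, hNi⟩ := hΘ.exists_injOn
      refine ⟨g ⁻¹' N, hgc.continuousAt.preimage_mem_nhds hN, fun a ha b hb he => ?_⟩
      obtain ⟨h1, h2⟩ := Prod.mk.inj (hNi ⟨ha, hgD a⟩ ⟨hb, hgD b⟩ he)
      exact Prod.ext (Subtype.ext h1) h2
  obtain ⟨u, hu, hut, hu'⟩ := mem_nhdsSet_iff_exists.1 ht
  obtain ⟨v, w, hv, -, hzv, hw, hvw⟩ := generalized_tube_lemma isCompact_singleton isCompact_univ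
    hu hut
  obtain ⟨ε, hε, hεv⟩ := Metric.isOpen_iff.1 hv z (hzv rfl)
  refine ⟨min (ε / 2) (δ / 2), lt_min (half_pos hε) hδ0, (min_le_right _ _).trans_lt hδ2,
    fun a b he => ?_⟩
  set i : Icc (0 : ℝ) (min (ε / 2) (δ / 2)) × K → Icc (0 : ℝ) (δ / 2) × K :=
    fun y => (⟨y.1, y.1.2.1, y.1.2.2.trans (min_le_right _ _)⟩, y.2) with hi
  have hit : ∀ y, i y ∈ t := fun y => hu' (hvw ⟨hεv (by
    rw [Metric.mem_ball, Subtype.dist_eq]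
    change dist (y.1 : ℝ) 0 < ε
    rw [Real.dist_0_eq_abs, abs_of_nonneg y.1.2.1]
    exact (y.1.2.2.trans (min_le_left _ _)).trans_lt (half_lt_self hε)), hw (mem_univ _)⟩)
  obtain ⟨h1, h2⟩ := Prod.mk.inj (hti (hit a) (hit b) he)
  exact Prod.ext (Subtype.ext (Subtype.mk.inj h1)) h2

end Restriction

/-! ### The pulled back form on `[0, R] × K`. -/

section Pullback

variable {X : Type*} [NormedAddCommGroup X] [NormedSpace ℝ X]
  {K : Type*} [TopologicalSpace K] [ChartedSpace X K]
  {Y : Type*} [NormedAddCommGroup Y] [NormedSpace ℝ Y]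
  {H : Type*} [TopologicalSpace H] {I : ModelWithCorners ℝ Y H}
  {F : Type*} [TopologicalSpace F] [ChartedSpace H F]

/-- By the chain rule through the inclusion `[0, R] → ℝ`. The derivative of that inclusion need not
be computed, since the pulled back form only sees the `K` component of a vector. -/
lemma IsCollar.pullback_restrict_eq {j : K → F} {lam : DiffForm I F 1} {α : DiffForm 𝓘(ℝ, X) K 1}
    {δ R : ℝ} [Fact (0 < R)] (hR : R < δ) {κ : ℝ × K → F} (h : IsCollar I j lam α δ univ κ)
    {p : Icc (0 : ℝ) R × K} (hp : 0 < (p.1 : ℝ)) :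
    (pullback (fun y : Icc (0 : ℝ) R × K => κ (y.1, y.2)) lam :
        DiffForm ((𝓡∂ 1).prod 𝓘(ℝ, X)) _ 1) p =
      (1 / (p.1 : ℝ)) • pullback Prod.snd α p := by
  have hpD : ((p.1 : ℝ), p.2) ∈ Ico 0 δ ×ˢ (univ : Set K) :=
    ⟨⟨hp.le, p.1.2.2.trans_lt hR⟩, mem_univ _⟩
  have hκ : HasMFDerivAt (𝓘(ℝ, ℝ).prod 𝓘(ℝ, X)) I κ ((p.1 : ℝ), p.2) _ :=
    ((h.contMDiffOn.mdifferentiableOn (by simp) _ hpD).mdifferentiableAt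
      (Ico_prod_mem_nhds isOpen_univ hpD hp)).hasMFDerivAt
  have h1 : HasMFDerivAt (𝓡∂ 1) 𝓘(ℝ, ℝ) (fun t : Icc (0 : ℝ) R => (t : ℝ)) p.1 _ :=
    (contMDiff_subtypeVal_Icc (n := 1) p.1).mdifferentiableAt (by simp) |>.hasMFDerivAt
  have h2 := hasMFDerivAt_fst (I := 𝓡∂ 1) (I' := 𝓘(ℝ, X)) p
  have h3 := hasMFDerivAt_snd (I := 𝓡∂ 1) (I' := 𝓘(ℝ, X)) p
  have h4 := hκ.comp p ((h1.comp p h2).prodMk h3)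
  refine eq_of_covector_eq
    (Ω := pullback (fun y : Icc (0 : ℝ) R × K => κ (y.1, y.2)) lam)
    (Ω' := fun p => (1 / (p.1 : ℝ)) • pullback Prod.snd α p) (ContinuousLinearMap.ext fun v => ?_)
  rw [covector_pullback]
  have h5 : derivAt ((𝓡∂ 1).prod 𝓘(ℝ, X)) I (fun y : Icc (0 : ℝ) R × K => κ (y.1, y.2)) p v =
      derivAt (𝓘(ℝ, ℝ).prod 𝓘(ℝ, X)) I κ ((p.1 : ℝ), p.2)
        (derivAt (𝓡∂ 1) 𝓘(ℝ, ℝ) (fun t : Icc (0 : ℝ) R => (t : ℝ)) p.1 v.1, v.2) :=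
    congrArg (fun L => L v) h4.mfderiv
  rw [h5]
  refine (h.pullback_eq _ hpD hp _).trans ?_
  have h6 : covector (pullback Prod.snd α : DiffForm ((𝓡∂ 1).prod 𝓘(ℝ, X)) (Icc (0 : ℝ) R × K) 1)
      p v = covector α p.2 v.2 := by
    rw [covector_pullback]
    exact congrArg (covector α p.2) (congrArg (fun L => L v) h3.mfderiv)
  rw [← h6]
  rfl

end Pullback

end IdealLiouville

end

theorem mainTheorem8 {m : ℕ}
    {F : Type*} [TopologicalSpace F] [ChartedSpace (EuclideanHalfSpace (2 * m + 2)) F]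
    [IsManifold (𝓡∂ (2 * m + 2)) ∞ F] [CompactSpace F] [T2Space F]
    {K : Type*} [TopologicalSpace K] [ChartedSpace (EuclideanSpace ℝ (Fin (2 * m + 1))) K]
    [IsManifold (𝓡 (2 * m + 1)) ∞ K]
    (j : K → F) (hj : IdealLiouville.IsBoundaryInclusion m j)
    (Ω : IdealLiouville.DiffForm (𝓡∂ (2 * m + 2)) F 2)
    (hΩ : IdealLiouville.IsIdealLiouvilleDomain j Ω)
    (lam : IdealLiouville.DiffForm (𝓡∂ (2 * m + 2)) F 1)
    (hlam : IdealLiouville.IsIdealLiouvilleForm j Ω lam)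
    (u : F → ℝ) (hu : IdealLiouville.IsBoundaryDefining m u)
    (β : IdealLiouville.DiffForm (𝓡∂ (2 * m + 2)) F 1)
    (hβ : IdealLiouville.IsExtension u lam β)
    (α₀ : IdealLiouville.DiffForm (𝓡 (2 * m + 1)) K 1)
    (hα₀ : IdealLiouville.IsPositiveContactFormOn (IdealLiouville.pullback j β) α₀) :
    ∃ (R : ℝ) (hR : Fact (0 < R)) (ι : Set.Icc (0 : ℝ) R × K → F),
      Manifold.IsSmoothEmbedding ((𝓡∂ 1).prod (𝓡 (2 * m + 1))) (𝓡∂ (2 * m + 2)) ∞ ι ∧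
      (∀ q : K, ι (⟨0, le_rfl, hR.out.le⟩, q) = j q) ∧
      (∀ p : Set.Icc (0 : ℝ) R × K, 0 < (p.1 : ℝ) →
        ι p ∈ (𝓡∂ (2 * m + 2)).interior F ∧
        (IdealLiouville.pullback ι lam :
            IdealLiouville.DiffForm ((𝓡∂ 1).prod (𝓡 (2 * m + 1))) _ 1) p =
          (1 / (p.1 : ℝ)) • IdealLiouville.pullback Prod.snd α₀ p) ∧
      (∀ p : Set.Icc (0 : ℝ) R × K, 0 < (p.1 : ℝ) →
        (IdealLiouville.pullback ι β :
            IdealLiouville.DiffForm ((𝓡∂ 1).prod (𝓡 (2 * m + 1))) _ 1) p =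
          (u (ι p) / (p.1 : ℝ)) • IdealLiouville.pullback Prod.snd α₀ p) ∧
      (∀ q : K, ∃ c : ℝ,
        HasDerivWithinAt (fun r : ℝ => u (ι (Set.projIcc 0 R hR.out.le r, q))) c
          (Set.Icc 0 R) 0 ∧
        (IdealLiouville.pullback j β : IdealLiouville.DiffForm (𝓡 (2 * m + 1)) K 1) q =
          c • α₀ q) := by
  have hji : Function.Injective j := hj.isSmoothEmbedding.isEmbedding.injective
  have hjb : ∀ q, j q ∈ (𝓡∂ (2 * m + 2)).boundary F := fun q => by
    rw [← hj.range_eq]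
    exact Set.mem_range_self q
  -- The boundary is closed in the compact Hausdorff space `F`; this makes `K` compact and
  -- Hausdorff, as the gluing requires.
  have hjc : Topology.IsClosedEmbedding j :=
    ⟨hj.isSmoothEmbedding.isEmbedding, by
      rw [hj.range_eq]
      exact ModelWithCorners.isClosed_boundary (n := ∞) (by simp)⟩
  have : CompactSpace K := hjc.compactSpace
  have : T2Space K := hjc.isEmbedding.t2Space
  obtain ⟨δ, hδ, κ, hκ, hκu⟩ := IdealLiouville.exists_isCollar_univ hj hu hβ hα₀
  obtain ⟨R, hR, hRδ, hinj⟩ := hκ.exists_injective hjc.continuous hji hjb hδ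
  have hRf : Fact (0 < R) := ⟨hR⟩
  have hint : ∀ p : Set.Icc (0 : ℝ) R × K, 0 < (p.1 : ℝ) →
      κ (p.1, p.2) ∈ (𝓡∂ (2 * m + 2)).interior F := fun p hp =>
    hκ.mem_interior _ ⟨⟨hp.le, p.1.2.2.trans_lt hRδ⟩, Set.mem_univ _⟩ hp
  have hlamp := fun (p : Set.Icc (0 : ℝ) R × K) (hp : 0 < (p.1 : ℝ)) =>
    hκ.pullback_restrict_eq hRδ hp
  refine ⟨R, hRf, fun y => κ (y.1, y.2),
    ⟨Manifold.IsImmersionOfComplement.isImmersion (F := PUnit.{1})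
      (hκ.isImmersionAtOfComplement hjc.continuous hjb hRδ), ?_⟩,
    fun q => hκ.zero q (Set.mem_univ q), fun p hp => ⟨hint p hp, hlamp p hp⟩,
    fun p hp => ?_, fun q => ?_⟩
  · exact ((hκ.continuous_restrict hRδ).isClosedEmbedding hinj).isEmbedding
  · have h1 : (IdealLiouville.pullback (fun y : Set.Icc (0 : ℝ) R × K => κ (y.1, y.2)) β :
        IdealLiouville.DiffForm ((𝓡∂ 1).prod (𝓡 (2 * m + 1))) _ 1) p =
        u (κ (p.1, p.2)) • IdealLiouville.pullback
          (fun y : Set.Icc (0 : ℝ) R × K => κ (y.1, y.2)) lam p := by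
      rw [IdealLiouville.pullback, hβ.eq_smul _ (hint p hp)]
      rfl
    rw [h1, hlamp p hp, smul_smul, mul_one_div]
  · obtain ⟨c, hc, hcβ⟩ := hκu q
    -- `c` is the factor between the two contact forms at `q`, which the construction of the collar
    -- already identified with the normal derivative of `u ∘ κ`.
    refine ⟨c, ?_, ?_⟩
    · refine (hc.mono Set.Icc_subset_Ici_self).congr (fun r hr => ?_) ?_
      · rw [Set.projIcc_of_mem hR.le hr]
      · rw [Set.projIcc_left]
    · exact IdealLiouville.eq_of_covector_eq (Ω := IdealLiouville.pullback j β)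
        (Ω' := fun q => c • α₀ q) (hcβ.trans (ContinuousLinearMap.ext fun v => rfl))
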